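/- **Setup.** All alphabets are finite, and entropies and mutual informations are in bits. Let $P_{Y_f,Z_f|X_f}$ be a discrete memoryless broadcast channel (DMBC) from Alice to Bob (who receives $Y_f$) and Eve (who receives $Z_f$), and let $P_{Y_b,Z_b|X_b}$ be an independent DMBC from Bob to Alice (who receives $Y_b$) and Eve (who receives $Z_b$). Alice and Bob have independent local randomness. **Security.** Suppose a protocol uses the forward channel $n_f$ times and the backward channel $n_b$ times and results in a key $S$ of one party, an estimate $\hat S$ of the other party, and a view $View_E$ of Eve. It is $(R,\delta)$-secure if $$\frac{H(S)}{n_f+n_b}>R-\delta,\qquad \Pr(\hat S\ne S)<\delta,\qquad \frac{H(S|View_E)}{H(S)}>1-\delta .$$ A NULL (failure) output of either party is counted as $\hat S\neq S$, and the last condition is required when $H(S)\neq0$. **The interactive channel coding (ICC) protocol initiated by Alice.** Fix $P_{X_f}$, $P_{V_f|Y_f}$, $P_{W_{2,b}}$, $P_{W_{1,b}|W_{2,b}}$, $P_{X_b|W_{1,b}}$, $\epsilon>0$, $n_f\ge 1$ and $n_b=n_{b,1}+n_{b,2}\ge1$. Fix a set $\mathcal V_\epsilon$ of $\epsilon$-typical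 sequences in $\mathcal V_f^{n_f}$, a non-empty set $\mathcal W_\epsilon$ of $\epsilon$-typical sequences in $\mathcal W_{1,b}^{n_{b,1}}$, a systematic encoder $Enc(v,w)=(v,w\,\|\,p(v,w))$ with parity-check words $p(v,w)\in\mathcal W_{1,b}^{n_{b,2}}$, and a function $g$ on $\mathcal V_\epsilon\times\mathcal W_\epsilon$ that partitions this set into parts of equal size. Typicality is understood in the sense of empirical entropy. 1. Alice sends an i.i.d. sequence $X_f^{n_f}$ with law $P_{X_f}$. 2. Bob chooses $V\in\mathcal V_\epsilon$ that is $\epsilon$-jointly typical with the received $Y_f^{n_f}$ (NULL if there is none) and, independently, a uniformly random $W\in\mathcal W_\epsilon$. He passes $W\|p(V,W)$ through the memoryless channel $P_{X_b|W_{1,b}}$ and sends the resulting $X_b^{n_b}$ over the backward channel (after a NULL he sends a fixed sequence). 3. Alice looks for the unique $(\hat V,\hat W)\in\mathcal V_\epsilon\times\mathcal W_\epsilon$ such that $(\hat V\|\hat W\|p(\hat V,\hat W))$ and $(X_f^{n_f}\|Y_b^{n_b})$ are $\epsilon$-bipartite jointly typical with respect to $(P_{V_f,X_f},P_{W_{1,b},Y_b})$,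 and returns NULL if there is none. 4. The key is $S=g(V,W)$ and its estimate is $\hat S=g(\hat V,\hat W)$. Eve's view is $(Z_f^{n_f},Z_b^{n_b})$. The ICC protocol initiated by Bob is obtained by exchanging the two parties and the two channels. **Theorem.** Let $V_f$, $W_{1,b}$, $W_{2,b}$ range over random variables on finite alphabets with $$V_f\leftrightarrow Y_f\leftrightarrow(X_f,Z_f),\qquad W_{2,b}\leftrightarrow W_{1,b}\leftrightarrow X_b\leftrightarrow(Y_b,Z_b),$$ where $V_f$ and $(W_{1,b},W_{2,b})$ are independent, and put $$R^A_{s1}=I(V_f;X_f)-I(V_f;Z_f),\qquad R^A_{s2}=I(W_{1,b};Y_b|W_{2,b})-I(W_{1,b};Z_b|W_{2,b}).$$ Let $$R^{ICC}_A=\sup_{n_f,n_b,P_{X_f,V_f},P_{X_b,W_{2,b},W_{1,b}}}\left\{\frac{n_fR^A_{s1}+n_bR^A_{s2}}{n_f+n_b}\ :\ n_f I(V_f;Y_f|X_f)<n_b I(W_{1,b};Y_b)\right\}$$ (with the value $0$ if the constraint cannot be met). Define $R^{ICC}_B$ in the same way with the roles of the two parties, and of the indices $f$ and $b$, exchanged.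 Then both suprema are finite, and the ICC protocol achieves the secret-key rate $R^{ICC}=\max\{R^{ICC}_A,R^{ICC}_B\}$: for every $\delta>0$ there is an ICC protocol, initiated by Alice or by Bob, that is $(R^{ICC},\delta)$-secure. -/

import Mathlib

open scoped ENNReal

noncomputable section

namespace TwoDMBC

/-! Shannon information quantities, in bits. Random variables are functions on a common finite
sample space that carries a probability mass function. -/

/-- Shannon entropy, in bits, of a distribution on a finite set. -/
def entropy {α : Type*} [Fintype α] (p : PMF α) : ℝ :=
  ∑ a, Real.negMulLog (p a).toReal / Real.log 2

section Information

variable {Ω α β γ : Type*} [Fintype α] [Fintype β] [Fintype γ]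

/-- `H(A)`. -/
def rvEntropy (μ : PMF Ω) (A : Ω → α) : ℝ := entropy (μ.map A)

/-- `H(A | B) = H(A, B) - H(B)`. -/
def condEntropy (μ : PMF Ω) (A : Ω → α) (B : Ω → β) : ℝ :=
  rvEntropy μ (fun ω => (A ω, B ω)) - rvEntropy μ B

/-- `I(A ; B) = H(A) - H(A | B)`. -/
def mutualInfo (μ : PMF Ω) (A : Ω → α) (B : Ω → β) : ℝ :=
  rvEntropy μ A - condEntropy μ A B

/-- `I(A ; B | C) = H(A | C) - H(A | B, C)`. -/
def condMutualInfo (μ : PMF Ω) (A : Ω → α) (B : Ω → β) (C : Ω → γ) : ℝ :=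
  condEntropy μ A C - condEntropy μ A (fun ω => (B ω, C ω))

end Information

/-! Channels and their memoryless use. -/

/-- A discrete memoryless broadcast channel `X → (Y, Z)`, given by `P_{Y,Z|X}`: `Y` is received by
the legitimate receiver and `Z` by the eavesdropper. -/
abbrev DMBC (X Y Z : Type*) := X → PMF (Y × Z)

/-- The law of a sequence of `n` independent symbols, the `i`-th one with law `p i`. -/
def indepSeq {α : Type*} [Fintype α] {n : ℕ} (p : Fin n → PMF α) : PMF (Fin n → α) :=
  PMF.ofFintype (fun u => ∏ i, p i (u i)) (by
    classical
    have h : ∀ i, ∑ a, p i a = 1 := fun i => by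
      rw [← tsum_fintype (L := .unconditional _)]; exact (p i).tsum_coe
    have h2 := Finset.prod_univ_sum (fun _ : Fin n => (Finset.univ : Finset α))
      (fun i a => p i a)
    rw [Fintype.piFinset_univ] at h2
    rw [← h2]
    simp [h])

/-- The output of a channel `C` that is used once for each symbol of `u`, without memory. -/
def useChannel {α β : Type*} [Fintype β] (C : α → PMF β) {n : ℕ} (u : Fin n → α) :
    PMF (Fin n → β) :=
  indepSeq fun i => C (u i)

/-! Auxiliary variables and single-letter rates. The initiator sends over the forward channel, the
responder over the backward channel. -/

/-- A choice of `P_{X_f}` and of the auxiliary variable `V` of the first round, on a finite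
alphabet. Since `V` is obtained from `Y_f` alone by the conditional law `V|Y_f`, the chain
`V ↔ Y_f ↔ (X_f, Z_f)` holds, and all such variables arise in this way. -/
structure SourceAux (Xf Yf : Type*) where
  /-- size of the alphabet of `V` -/
  cardV : ℕ
  /-- `P_{X_f}` -/
  lawX : PMF Xf
  /-- `P_{V | Y_f}` -/
  kernelV : Yf → PMF (Fin cardV)

/-- A choice of `W₂`, `W₁` and `X_b` of the second round, on finite alphabets of `W₂` and `W₁`.
The factorization is the one of a chain `W₂ ↔ W₁ ↔ X_b ↔ (Y_b, Z_b)`. -/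
structure ChannelAux (Xb : Type*) where
  /-- size of the alphabet of `W₁` -/
  cardW1 : ℕ
  /-- size of the alphabet of `W₂` -/
  cardW2 : ℕ
  /-- `P_{W₂}` -/
  lawW2 : PMF (Fin cardW2)
  /-- `P_{W₁ | W₂}` -/
  kernelW1 : Fin cardW2 → PMF (Fin cardW1)
  /-- `P_{X_b | W₁}` -/
  kernelX : Fin cardW1 → PMF Xb

namespace SourceAux

variable {Xf Yf Zf : Type*} [Fintype Xf] [Fintype Yf] [Fintype Zf]
variable (a : SourceAux Xf Yf) (F : DMBC Xf Yf Zf)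

/-- The joint law of `(V, X_f, Y_f, Z_f)`. -/
def law : PMF (Fin a.cardV × Xf × Yf × Zf) :=
  a.lawX.bind fun x => (F x).bind fun yz => (a.kernelV yz.1).map fun v => (v, x, yz.1, yz.2)

/-- `P_{V, X_f}`. -/
def lawVX : PMF (Fin a.cardV × Xf) := (a.law F).map fun ω => (ω.1, ω.2.1)

/-- `P_{V, Y_f}`. -/
def lawVY : PMF (Fin a.cardV × Yf) := (a.law F).map fun ω => (ω.1, ω.2.2.1)

/-- `P_V`. -/
def lawV : PMF (Fin a.cardV) := (a.law F).map fun ω => ω.1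

/-- `I(V ; X_f) - I(V ; Z_f)`. -/
def secretRate : ℝ :=
  mutualInfo (a.law F) (fun ω => ω.1) (fun ω => ω.2.1)
    - mutualInfo (a.law F) (fun ω => ω.1) (fun ω => ω.2.2.2)

/-- `I(V ; Y_f | X_f)`. -/
def helperRate : ℝ :=
  condMutualInfo (a.law F) (fun ω => ω.1) (fun ω => ω.2.2.1) (fun ω => ω.2.1)

end SourceAux

namespace ChannelAux

variable {Xb Yb Zb : Type*} [Fintype Yb] [Fintype Zb]
variable (c : ChannelAux Xb) (B : DMBC Xb Yb Zb)

/-- The joint law of `(W₂, W₁, X_b, Y_b, Z_b)`. -/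
def law : PMF (Fin c.cardW2 × Fin c.cardW1 × Xb × Yb × Zb) :=
  c.lawW2.bind fun w2 => (c.kernelW1 w2).bind fun w1 => (c.kernelX w1).bind fun x =>
    (B x).map fun yz => (w2, w1, x, yz.1, yz.2)

/-- `P_{W₁}`. -/
def lawW1 : PMF (Fin c.cardW1) := c.lawW2.bind c.kernelW1

/-- `P_{W₁, Y_b}`. -/
def lawW1Y : PMF (Fin c.cardW1 × Yb) := (c.law B).map fun ω => (ω.2.1, ω.2.2.2.1)

/-- `I(W₁ ; Y_b | W₂) - I(W₁ ; Z_b | W₂)`. -/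
def secretRate : ℝ :=
  condMutualInfo (c.law B) (fun ω => ω.2.1) (fun ω => ω.2.2.2.1) (fun ω => ω.1)
    - condMutualInfo (c.law B) (fun ω => ω.2.1) (fun ω => ω.2.2.2.2) (fun ω => ω.1)

/-- `I(W₁ ; Y_b)`. -/
def totalRate : ℝ :=
  mutualInfo (c.law B) (fun ω => ω.2.1) (fun ω => ω.2.2.2.1)

end ChannelAux

/-- The set of rates over which the maximum is taken when the sender of the channel `F`
initiates the protocol and the sender of the channel `B` responds. -/
def rateSet {Xf Yf Zf Xb Yb Zb : Type*} [Fintype Xf] [Fintype Yf] [Fintype Zf]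
    [Fintype Yb] [Fintype Zb] (F : DMBC Xf Yf Zf) (B : DMBC Xb Yb Zb) : Set ℝ :=
  {r | ∃ (nf nb : ℕ) (a : SourceAux Xf Yf) (c : ChannelAux Xb),
    nf * a.helperRate F < nb * c.totalRate B ∧
    r = (nf * a.secretRate F + nb * c.secretRate B) / (nf + nb)}

/-- `R^ICC` for the protocol that is initiated by the sender of the channel `F`. -/
def rateICC {Xf Yf Zf Xb Yb Zb : Type*} [Fintype Xf] [Fintype Yf] [Fintype Zf]
    [Fintype Yb] [Fintype Zb] (F : DMBC Xf Yf Zf) (B : DMBC Xb Yb Zb) : ℝ :=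
  sSup (rateSet F B)

/-! Typical and bipartite typical sequences. -/

/-- The probability of a sequence under the product law `pⁿ`. -/
def seqProb {α : Type*} (p : PMF α) {n : ℕ} (u : Fin n → α) : ℝ := ∏ i, (p (u i)).toReal

/-- `u` is `ε`-typical with respect to `p`. -/
def IsTypical {α : Type*} [Fintype α] (p : PMF α) (ε : ℝ) {n : ℕ} (u : Fin n → α) : Prop :=
  seqProb p u ≠ 0 ∧ |-(1 / (n : ℝ)) * Real.logb 2 (seqProb p u) - entropy p| < ε

/-- `(u, v)` is an `ε`-jointly typical pair with respect to `p`. -/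
def IsJointlyTypical {α β : Type*} [Fintype α] [Fintype β] (p : PMF (α × β)) (ε : ℝ) {n : ℕ}
    (u : Fin n → α) (v : Fin n → β) : Prop :=
  IsTypical (p.map Prod.fst) ε u ∧ IsTypical (p.map Prod.snd) ε v ∧
    IsTypical p ε (fun i => (u i, v i))

/-- The concatenation `(u || t)` is an `ε`-bipartite typical sequence with respect to `(p, q)`. -/
def IsBipartiteTypical {α β : Type*} [Fintype α] [Fintype β] (p : PMF α) (q : PMF β) (ε : ℝ)
    {n d : ℕ} (u : Fin n → α) (t : Fin d → β) : Prop :=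
  seqProb p u * seqProb q t ≠ 0 ∧
    |-(1 / ((n : ℝ) + d)) * Real.logb 2 (seqProb p u * seqProb q t)
      - (n * entropy p + d * entropy q) / ((n : ℝ) + d)| < ε

/-- `((u || t), (u' || t'))` is an `ε`-bipartite jointly typical pair of sequences with respect to
`(p, q)`. -/
def IsBipartiteJointlyTypical {α α' β β' : Type*} [Fintype α] [Fintype α'] [Fintype β]
    [Fintype β'] (p : PMF (α × α')) (q : PMF (β × β')) (ε : ℝ) {n d : ℕ}
    (u : Fin n → α) (t : Fin d → β) (u' : Fin n → α') (t' : Fin d → β') : Prop :=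
  IsBipartiteTypical (p.map Prod.fst) (q.map Prod.fst) ε u t ∧
  IsBipartiteTypical (p.map Prod.snd) (q.map Prod.snd) ε u' t' ∧
  IsBipartiteTypical p q ε (fun i => (u i, u' i)) (fun i => (t i, t' i))

/-! The two-round interactive channel coding protocol. -/

/-- An interactive channel coding protocol over the forward channel `F` (initiator to responder)
and the backward channel `B` (responder to initiator). Codewords `v` and information words `w` are
handled through their indices; `none` stands for NULL. -/
structure ICCProtocol {Xf Yf Zf Xb Yb Zb : Type*} [Fintype Xf] [Fintype Yf] [Fintype Zf]
    [Fintype Yb] [Fintype Zb] (F : DMBC Xf Yf Zf) (B : DMBC Xb Yb Zb) where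
  /-- the input law of the first round and the variable `V` -/
  src : SourceAux Xf Yf
  /-- the variables `W₂`, `W₁` and `X_b` of the second round -/
  chn : ChannelAux Xb
  /-- number of uses of the forward channel -/
  nf : ℕ
  /-- length of the information part of the backward transmission -/
  nb1 : ℕ
  /-- length of the parity-check part of the backward transmission -/
  nb2 : ℕ
  nf_pos : 0 < nf
  nb_pos : 0 < nb1 + nb2
  /-- the parameter of typicality -/
  ε : ℝ
  ε_pos : 0 < ε
  /-- number of words in the codebook of `V`-sequences -/
  cardF : ℕ
  /-- number of words in the set of information words (`W₁`-sequences) -/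
  cardB : ℕ
  [cardB_ne : NeZero cardB]
  /-- the codebook of distinct typical `V`-sequences, with its numbering -/
  vWord : Fin cardF ↪ (Fin nf → Fin src.cardV)
  vWord_typical : ∀ f, IsTypical (src.lawV F) ε (vWord f)
  /-- the set of distinct typical information words, with its numbering -/
  wWord : Fin cardB ↪ (Fin nb1 → Fin chn.cardW1)
  wWord_typical : ∀ b, IsTypical chn.lawW1 ε (wWord b)
  /-- the responder's choice of a `V`-sequence, possibly with random choice among several
  candidates -/
  quantize : (Fin nf → Yf) → PMF (Option (Fin cardF))
  /-- a chosen `V`-sequence is jointly typical with the received sequence -/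
  quantize_some : ∀ y f, some f ∈ (quantize y).support →
    IsJointlyTypical (src.lawVY F) ε (vWord f) y
  /-- NULL is returned only if no `V`-sequence is jointly typical with the received sequence -/
  quantize_none : ∀ y, none ∈ (quantize y).support →
    ∀ f, ¬ IsJointlyTypical (src.lawVY F) ε (vWord f) y
  /-- the parity-check word of the systematic encoder -/
  parity : Fin cardF → Fin cardB → (Fin nb2 → Fin chn.cardW1)
  /-- what is sent over the backward channel after NULL -/
  nullWord : Fin (nb1 + nb2) → Xb
  /-- number of key values -/
  cardK : ℕ
  /-- the key function `g` -/
  key : Fin cardF × Fin cardB → Fin cardK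
  /-- the parts of the partition that is defined by `g` have equal sizes -/
  key_equal_parts : ∀ k k', Nat.card {fb // key fb = k} = Nat.card {fb // key fb = k'}

attribute [instance] ICCProtocol.cardB_ne

namespace ICCProtocol

variable {Xf Yf Zf Xb Yb Zb : Type*} [Fintype Xf] [Fintype Yf] [Fintype Zf]
  [Fintype Xb] [Fintype Yb] [Fintype Zb] {F : DMBC Xf Yf Zf} {B : DMBC Xb Yb Zb}

/-- Number of uses of the backward channel. -/
def nb (P : ICCProtocol F B) : ℕ := P.nb1 + P.nb2

/-- The backward part of the systematic codeword: information word, then parity-check word. -/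
def enc (P : ICCProtocol F B) (fb : Fin P.cardF × Fin P.cardB) :
    Fin P.nb → Fin P.chn.cardW1 :=
  Fin.append (P.wWord fb.2) (P.parity fb.1 fb.2)

/-- The initiator's test of a pair `(v, w)`: its codeword is bipartite jointly typical with
what she sent and received. -/
def Matches (P : ICCProtocol F B) (x : Fin P.nf → Xf) (y : Fin P.nb → Yb)
    (fb : Fin P.cardF × Fin P.cardB) : Prop :=
  IsBipartiteJointlyTypical (P.src.lawVX F) (P.chn.lawW1Y B) P.ε (P.vWord fb.1) (P.enc fb) x y

open Classical in
/-- The initiator's decoder: the unique matching pair, or NULL. -/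
def dec (P : ICCProtocol F B) (x : Fin P.nf → Xf) (y : Fin P.nb → Yb) :
    Option (Fin P.cardF × Fin P.cardB) :=
  if h : ∃! fb, P.Matches x y fb then some h.choose else none

/-- What the responder sends, given the chosen `V`-sequence and information word: the codeword
`w₁` is passed through the memoryless channel `P_{X_b | W₁}`. -/
def send (P : ICCProtocol F B) (f : Option (Fin P.cardF)) (b : Fin P.cardB) :
    PMF (Fin P.nb → Xb) :=
  match f with
  | some f => useChannel P.chn.kernelX (P.enc (f, b))
  | none => PMF.pure P.nullWord

/-- The eavesdropper's view: both of her received sequences. -/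
abbrev View (P : ICCProtocol F B) : Type _ := (Fin P.nf → Zf) × (Fin P.nb → Zb)

/-- A run of the protocol: the joint law of the responder's key `S`, the initiator's estimate of
it, and the eavesdropper's view. -/
def outcome (P : ICCProtocol F B) :
    PMF (Option (Fin P.cardK) × Option (Fin P.cardK) × P.View) :=
  (indepSeq fun _ : Fin P.nf => P.src.lawX).bind fun x =>
  (useChannel F x).bind fun yzf =>
  (P.quantize fun i => (yzf i).1).bind fun f =>
  (PMF.uniformOfFintype (Fin P.cardB)).bind fun b =>
  (P.send f b).bind fun xb =>
  (useChannel B xb).map fun yzb =>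
    (f.map fun f => P.key (f, b),
      (P.dec x fun i => (yzb i).1).map P.key,
      (fun i => (yzf i).2, fun i => (yzb i).2))

end ICCProtocol

/-- `(R, δ)`-security of a key agreement with `n` channel uses in total, where `ρ` is the joint law
of the key `S`, its estimate and the eavesdropper's view. A NULL on either side counts as a
failure. The secrecy quotient is required when it is defined, that is for `H(S) ≠ 0`, which
the first condition enforces as soon as `R ≥ δ`. -/
def IsSecure {K E : Type*} [Fintype K] [Fintype E] (ρ : PMF (Option K × Option K × E))
    (n : ℕ) (R δ : ℝ) : Prop :=
  rvEntropy ρ (fun ω => ω.1) / n > R - δ ∧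
  ρ.toOuterMeasure {ω | ¬ ∃ k, ω.1 = some k ∧ ω.2.1 = some k} < ENNReal.ofReal δ ∧
  (rvEntropy ρ (fun ω => ω.1) ≠ 0 →
    condEntropy ρ (fun ω => ω.1) (fun ω => ω.2.2) / rvEntropy ρ (fun ω => ω.1) > 1 - δ)

/-- Some interactive channel coding protocol that is initiated by the sender of `F` is
`(R, δ)`-secure. -/
def HasSecureICC {Xf Yf Zf Xb Yb Zb : Type*} [Fintype Xf] [Fintype Yf] [Fintype Zf]
    [Fintype Xb] [Fintype Yb] [Fintype Zb] (F : DMBC Xf Yf Zf) (B : DMBC Xb Yb Zb)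
    (R δ : ℝ) : Prop :=
  ∃ P : ICCProtocol F B, IsSecure P.outcome (P.nf + P.nb) R δ

end TwoDMBC

end

noncomputable section

set_option linter.unusedSectionVars false

namespace TwoDMBC

section

/-! Finite sums over product laws. -/

/-! After the two rounds the parties share a message (f, b). The index f names a V-word, that is,
common randomness extracted from the forward channel; b is fresh randomness of the responder. The
key is a hash of this message. Take q·nf forward uses and k + q·nb backward uses, with k fixed and q
→ ∞. To first order the number of V-words is 2^(q nf I(V;Y_f)), the number of all messages is 2^(q
(nf I(V;X_f) + nb I(W₁;Y_b))), and the number J of cloud centers is 2^(q nb I(W₂;Y_b)). Since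
I(V;Y_f|X_f) = I(V;Y_f) - I(V;X_f) (`helperRate_eq`), the constraint of the theorem is what leaves
room for b.

Covering. The responder draws f with probability proportional to the likelihood ratio of the V-word
and the received sequence, restricted to jointly typical words. If there are enough V-words, these
weights have average nearly one (`sum_iid_covering`). The run is then close in total variation to an
ideal weight under which the message is uniform and the outputs of both channels are generated from
its codeword (`sum_proportional_sub`, `ICCCode.sum_abs_run_sub_idealWeight_le`). Errors and secrecy
are computed under the ideal weight.

Decoding. A wrong message passes the bipartite test only if a product of two likelihood ratios, one
for each round, exceeds a threshold, so its probability is bounded by the mean of that product. The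
mean is of order one for independent codewords. Wrong messages that share the V-word or the cloud
center with the true one are paid for by a bound on the corresponding ratio of the true sequences
(`sum_superposition_pair`, `CodingProblem.exists_code`).

Secrecy. Under the ideal weight, a view z has probability at most κ σ(z) given any message, where σ
has total mass at most one and does not depend on the message. To first order κ is 2^(q nf I(V;Z_f))
· 2^(q nb I(W₁;Z_b|W₂)) · J; the factor J appears because σ averages over the cloud centers. A fixed
balanced function composed with a random permutation is a good hash (`exists_perm_hash`), so a key
of about log(number of messages) - log κ bits is nearly uniform and nearly independent of the view.
By the Markov chain W₂ - W₁ - Y_b one has I(W₁;Y_b) - I(W₂;Y_b) = I(W₁;Y_b|W₂), and the key length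
becomes q times the numerator of the rate. `condEntropy_ge` turns closeness in variation into
equivocation.

Format of the protocol. Its words must be distinct and typical. Both auxiliary variables are given
independent uniform labels, which make words distinct and affect neither typicality nor the outputs
of the channels. All information words can then be copies of one typical word of fixed length k, and
the parity-check words carry the whole random superposition code. The fixed prefix costs only
constants, which vanish after division by q.

Edge cases. For rates below δ a protocol with a constant key suffices (`hasSecureICC_of_lt_zero`).
Members of the rate set with nf = 0 are reached by adding a single forward use to many backward uses
(`hasSecureICC_of_mem_rateSet`). -/

open Classical in
/-- The indicator of a proposition. -/
def ind (P : Prop) : ℝ := if P then 1 else 0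

lemma ind_true {P : Prop} (h : P) : ind P = 1 := by simp [ind, h]

lemma ind_false {P : Prop} (h : ¬ P) : ind P = 0 := by simp [ind, h]

lemma ind_nonneg (P : Prop) : 0 ≤ ind P := by unfold ind; split_ifs <;> norm_num

lemma ind_le_one (P : Prop) : ind P ≤ 1 := by unfold ind; split_ifs <;> norm_num

lemma ind_mono {P Q : Prop} (h : P → Q) : ind P ≤ ind Q := by
  by_cases hP : P
  · rw [ind_true hP, ind_true (h hP)]
  · rw [ind_false hP]; exact ind_nonneg Q

lemma ind_not (P : Prop) : ind (¬ P) = 1 - ind P := by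
  by_cases hP : P
  · rw [ind_true hP, ind_false (not_not.mpr hP)]; norm_num
  · rw [ind_false hP, ind_true hP]; norm_num

lemma ind_or_le (P Q : Prop) : ind (P ∨ Q) ≤ ind P + ind Q := by
  by_cases hP : P
  · rw [ind_true hP]; linarith [ind_le_one (P ∨ Q), ind_nonneg Q]
  · have : ind (P ∨ Q) ≤ ind Q := ind_mono fun h => h.resolve_left hP
    linarith [ind_nonneg P]

section Product

variable {ι α : Type*} [Fintype ι] [Fintype α]

/-- The product weight of a family. -/
def iid (p : α → ℝ) (c : ι → α) : ℝ := ∏ i, p (c i)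

lemma iid_nonneg {p : α → ℝ} (hp : ∀ a, 0 ≤ p a) (c : ι → α) : 0 ≤ iid p c :=
  Finset.prod_nonneg fun _ _ => hp _

lemma sum_prod_fun [DecidableEq ι] {β : ι → Type*} [∀ i, Fintype (β i)]
    (h : ∀ i, β i → ℝ) : ∑ c : ∀ i, β i, ∏ i, h i (c i) = ∏ i, ∑ a, h i a := by
  rw [Finset.prod_univ_sum, Fintype.piFinset_univ]

lemma sum_iid [DecidableEq ι] {p : α → ℝ} (hp : ∑ a, p a = 1) : ∑ c : ι → α, iid p c = 1 := by
  unfold iid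
  rw [sum_prod_fun (fun (_ : ι) a => p a)]
  simp [hp]

lemma sum_iid_coord [DecidableEq ι] {p : α → ℝ} (hp : ∑ a, p a = 1) (i : ι) (φ : α → ℝ) :
    ∑ c : ι → α, iid p c * φ (c i) = ∑ a, p a * φ a := by
  have h1 : ∀ c : ι → α, iid p c * φ (c i)
      = ∏ k, (fun k a => p a * (if k = i then φ a else 1)) k (c k) := by
    intro c
    simp only [iid, Finset.prod_mul_distrib, Finset.prod_ite_eq', Finset.mem_univ, if_true]
  simp_rw [h1]
  rw [sum_prod_fun (fun k a => p a * (if k = i then φ a else 1))]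
  rw [Finset.prod_eq_single i]
  · simp
  · intro k _ hk; simp [hk, hp]
  · simp

lemma sum_iid_mul [DecidableEq ι] {p : α → ℝ} (hp : ∑ a, p a = 1) {i j : ι} (hij : i ≠ j)
    (φ ψ : α → ℝ) :
    ∑ c : ι → α, iid p c * (φ (c i) * ψ (c j)) = (∑ a, p a * φ a) * ∑ a, p a * ψ a := by
  have h1 : ∀ c : ι → α, iid p c * (φ (c i) * ψ (c j))
      = ∏ k, (fun k a => p a * ((if k = i then φ a else 1) * (if k = j then ψ a else 1))) k
          (c k) := by
    intro c
    simp only [iid, Finset.prod_mul_distrib, Finset.prod_ite_eq', Finset.mem_univ, if_true]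
  simp_rw [h1]
  rw [sum_prod_fun (fun k a => p a * ((if k = i then φ a else 1) * (if k = j then ψ a else 1)))]
  rw [← Finset.mul_prod_erase _ _ (Finset.mem_univ i),
    ← Finset.mul_prod_erase _ _ (Finset.mem_erase.mpr ⟨hij.symm, Finset.mem_univ j⟩),
    Finset.prod_eq_one]
  · simp [hij, hij.symm]
  · intro k hk
    have hkj : k ≠ j := Finset.ne_of_mem_erase hk
    have hki : k ≠ i := Finset.ne_of_mem_erase (Finset.mem_of_mem_erase hk)
    simp [hkj, hki, hp]

lemma sum_iid_pair [DecidableEq ι] {p : α → ℝ} (hp : ∑ a, p a = 1) {i j : ι} (hij : i ≠ j)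
    (Φ : α → α → ℝ) :
    ∑ c : ι → α, iid p c * Φ (c i) (c j) = ∑ a, ∑ b, p a * (p b * Φ a b) := by
  classical
  have h1 : ∀ c : ι → α, iid p c * Φ (c i) (c j)
      = ∑ a, iid p c * ((if c i = a then 1 else 0) * Φ a (c j)) := by
    intro c
    rw [← Finset.mul_sum]; simp
  simp_rw [h1]
  rw [Finset.sum_comm]
  refine Finset.sum_congr rfl fun a _ => ?_
  rw [sum_iid_mul hp hij (fun x => if x = a then 1 else 0) (Φ a)]
  simp [Finset.mul_sum]

/-- Cross terms factor by independence and vanish because φ is centered, so only the diagonal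
survives. -/
lemma sum_iid_sq [DecidableEq ι] {p : α → ℝ} (hp : ∑ a, p a = 1) (φ : α → ℝ)
    (h0 : ∑ a, p a * φ a = 0) :
    ∑ c : ι → α, iid p c * (∑ i, φ (c i)) ^ 2 = Fintype.card ι * ∑ a, p a * φ a ^ 2 := by
  have h1 : ∀ c : ι → α, iid p c * (∑ i, φ (c i)) ^ 2
      = ∑ i, ∑ j, iid p c * (φ (c i) * φ (c j)) := by
    intro c
    rw [sq, Finset.sum_mul_sum, Finset.mul_sum]
    simp_rw [Finset.mul_sum]
  simp_rw [h1]
  rw [Finset.sum_comm]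
  have h2 : ∀ i : ι, ∑ c : ι → α, ∑ j, iid p c * (φ (c i) * φ (c j)) = ∑ a, p a * φ a ^ 2 := by
    intro i
    rw [Finset.sum_comm, Finset.sum_eq_single i]
    · rw [← sum_iid_coord hp i]
      exact Finset.sum_congr rfl fun c _ => by ring
    · intro j _ hj
      rw [sum_iid_mul hp hj.symm, h0, zero_mul]
    · simp
  simp [h2]

/-- Chebyshev's inequality for a product law. -/
lemma sum_iid_deviation [DecidableEq ι] {p : α → ℝ} (h0 : ∀ a, 0 ≤ p a) (hp : ∑ a, p a = 1)
    (φ : α → ℝ) {t : ℝ} (ht : 0 < t) :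
    ∑ c : ι → α, iid p c * ind (t < |∑ i, φ (c i) - Fintype.card ι * ∑ a, p a * φ a|)
      ≤ Fintype.card ι * (∑ a, p a * (φ a - ∑ a, p a * φ a) ^ 2) / t ^ 2 := by
  set m := ∑ a, p a * φ a with hm
  have hc : ∑ a, p a * (φ a - m) = 0 := by
    simp_rw [mul_sub]
    rw [Finset.sum_sub_distrib, ← Finset.sum_mul, hp, ← hm]; ring
  rw [← sum_iid_sq hp (fun a => φ a - m) hc, Finset.sum_div]
  refine Finset.sum_le_sum fun c _ => ?_
  rw [mul_div_assoc]
  refine mul_le_mul_of_nonneg_left ?_ (iid_nonneg h0 c)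
  have he : ∑ i, (φ (c i) - m) = ∑ i, φ (c i) - Fintype.card ι * m := by
    simp [Finset.sum_sub_distrib]
  rw [he]
  by_cases h : t < |∑ i, φ (c i) - Fintype.card ι * m|
  · rw [ind_true h, le_div_iff₀ (by positivity), one_mul, ← sq_abs (_ - _)]
    exact pow_le_pow_left₀ ht.le h.le 2
  · rw [ind_false h]; positivity

end Product

/-- The first-moment method. The positivity of `p a` is kept because the codewords of the chosen
code must lie in the support of the word law, which consists of typical words. -/
lemma exists_of_weighted_sum_le {α : Type*} [Fintype α] {p X : α → ℝ} (h0 : ∀ a, 0 ≤ p a)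
    (hp : ∑ a, p a = 1) {θ : ℝ} (h : ∑ a, p a * X a ≤ θ) : ∃ a, 0 < p a ∧ X a ≤ θ := by
  by_contra hcon
  push Not at hcon
  have h1 : ∑ a, p a * θ < ∑ a, p a * X a := by
    obtain ⟨a, -, ha⟩ : ∃ a ∈ Finset.univ, 0 < p a := by
      by_contra hn
      push Not at hn
      have : ∑ a, p a ≤ 0 := Finset.sum_nonpos hn
      linarith
    refine Finset.sum_lt_sum (fun a _ => ?_) ⟨a, Finset.mem_univ a, ?_⟩
    · rcases (h0 a).eq_or_lt with h | h
      · simp [← h]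
      · exact mul_le_mul_of_nonneg_left (hcon a h).le h.le
    · exact mul_lt_mul_of_pos_left (hcon a ha) ha
  rw [← Finset.sum_mul, hp] at h1
  linarith

lemma sum_mul_abs_le_sqrt {α : Type*} [Fintype α] {p X : α → ℝ} (h0 : ∀ a, 0 ≤ p a)
    (hp : ∑ a, p a = 1) : ∑ a, p a * |X a| ≤ √(∑ a, p a * X a ^ 2) := by
  refine Real.le_sqrt_of_sq_le ?_
  have := Finset.sum_mul_sq_le_sq_mul_sq Finset.univ (fun a => √(p a)) (fun a => √(p a) * |X a|)
  have e1 : ∀ a, √(p a) * (√(p a) * |X a|) = p a * |X a| := fun a => by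
    rw [← mul_assoc, Real.mul_self_sqrt (h0 a)]
  have e2 : ∀ a, (√(p a) * |X a|) ^ 2 = p a * X a ^ 2 := fun a => by
    rw [mul_pow, Real.sq_sqrt (h0 a), sq_abs]
  simp_rw [e1, e2, fun a => Real.sq_sqrt (h0 a)] at this
  rwa [hp, one_mul] at this

end

section

/-! One-shot random coding. -/

/-- The average over a random codebook of the likelihood-based covering defect. -/
lemma sum_iid_covering {S V F : Type*} [Fintype S] [Fintype V] [Fintype F] [DecidableEq F]
    [Nonempty F]
    {PS : S → ℝ} (hPS0 : ∀ s, 0 ≤ PS s) (hPS : ∑ s, PS s = 1)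
    {pv : V → ℝ} (hpv0 : ∀ v, 0 ≤ pv v) (hpv : ∑ v, pv v = 1)
    {φ : V → S → ℝ} (hφ0 : ∀ v s, 0 ≤ φ v s) {Γ : ℝ} (hφΓ : ∀ v s, φ v s ≤ Γ)
    (hφ : ∀ s, ∑ v, pv v * φ v s ≤ 2) :
    ∑ v : F → V, iid pv v * ∑ s, PS s * |1 - (∑ f, φ (v f) s) / Fintype.card F|
      ≤ ∑ s, PS s * |1 - ∑ v, pv v * φ v s| + √(2 * Γ / Fintype.card F) := by
  have hF : (0 : ℝ) < Fintype.card F := by exact_mod_cast Fintype.card_pos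
  simp_rw [Finset.mul_sum]
  rw [Finset.sum_comm]
  have key : ∀ s, ∑ v : F → V, iid pv v * (PS s * |1 - (∑ f, φ (v f) s) / Fintype.card F|)
      ≤ PS s * |1 - ∑ v, pv v * φ v s| + PS s * √(2 * Γ / Fintype.card F) := by
    intro s
    set μ := ∑ v, pv v * φ v s with hμ
    have hdev : ∑ v : F → V, iid pv v * |(∑ f, φ (v f) s) / Fintype.card F - μ|
        ≤ √(2 * Γ / Fintype.card F) := by
      refine (sum_mul_abs_le_sqrt (iid_nonneg hpv0) (sum_iid hpv)).trans (Real.sqrt_le_sqrt ?_)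
      have hc : ∑ v, pv v * (φ v s - μ) = 0 := by
        simp_rw [mul_sub]
        rw [Finset.sum_sub_distrib, ← Finset.sum_mul, hpv, ← hμ]; ring
      have e : ∀ v : F → V, iid pv v * ((∑ f, φ (v f) s) / Fintype.card F - μ) ^ 2
          = iid pv v * (∑ f, (φ (v f) s - μ)) ^ 2 / (Fintype.card F : ℝ) ^ 2 := by
        intro v
        rw [Finset.sum_sub_distrib]
        simp only [Finset.sum_const, Finset.card_univ, nsmul_eq_mul]
        field_simp
      simp_rw [e]
      rw [← Finset.sum_div, sum_iid_sq hpv _ hc]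
      have hvar : ∑ v, pv v * (φ v s - μ) ^ 2 ≤ 2 * Γ := by
        have e2 : ∑ v, pv v * (φ v s - μ) ^ 2 = ∑ v, pv v * φ v s ^ 2 - μ ^ 2 := by
          have : ∀ v, pv v * (φ v s - μ) ^ 2
              = pv v * φ v s ^ 2 - 2 * μ * (pv v * φ v s) + μ ^ 2 * pv v := fun v => by ring
          simp_rw [this]
          rw [Finset.sum_add_distrib, Finset.sum_sub_distrib, ← Finset.mul_sum, ← Finset.mul_sum,
            hpv, ← hμ]; ring
        have hΓ : 0 ≤ Γ := by
          obtain ⟨v, -⟩ : ∃ v : V, True := by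
            by_contra hn
            push Not at hn
            have : ∑ v, pv v = 0 := Finset.sum_eq_zero fun v _ => absurd (hn v) (by simp)
            linarith
          exact (hφ0 v s).trans (hφΓ v s)
        have e3 : ∑ v, pv v * φ v s ^ 2 ≤ Γ * μ := by
          rw [hμ, Finset.mul_sum]
          refine Finset.sum_le_sum fun v _ => ?_
          have := mul_le_mul_of_nonneg_left (hφΓ v s) (mul_nonneg (hpv0 v) (hφ0 v s))
          nlinarith
        have := mul_le_mul_of_nonneg_left (hφ s) hΓ
        nlinarith [sq_nonneg μ]
      rw [div_le_div_iff₀ (by positivity) hF]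
      have := mul_le_mul_of_nonneg_left hvar (by positivity : (0:ℝ) ≤ (Fintype.card F : ℝ) ^ 2)
      nlinarith
    have hb : ∀ v : F → V, iid pv v * (PS s * |1 - (∑ f, φ (v f) s) / Fintype.card F|)
        ≤ iid pv v * (PS s * |1 - μ|)
          + PS s * (iid pv v * |(∑ f, φ (v f) s) / Fintype.card F - μ|) := by
      intro v
      have h1 : |1 - (∑ f, φ (v f) s) / Fintype.card F|
          ≤ |1 - μ| + |(∑ f, φ (v f) s) / Fintype.card F - μ| := by
        rw [abs_sub_comm (_ / _) μ]; exact abs_sub_le _ _ _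
      have := mul_le_mul_of_nonneg_left h1 (mul_nonneg (iid_nonneg hpv0 v) (hPS0 s))
      nlinarith
    refine (Finset.sum_le_sum fun v _ => hb v).trans ?_
    rw [Finset.sum_add_distrib, ← Finset.sum_mul, ← Finset.mul_sum, sum_iid hpv, one_mul]
    have := mul_le_mul_of_nonneg_left hdev (hPS0 s)
    linarith
  refine (Finset.sum_le_sum fun s _ => key s).trans ?_
  rw [Finset.sum_add_distrib, ← Finset.sum_mul, hPS, one_mul]

/-! ### Superposition codebooks: a uniform cloud index and a satellite word for each message. -/

section Superposition

variable {W₂ W₁ J ι : Type*} [Fintype W₂] [Fintype W₁] [Fintype J] [Fintype ι]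

/-- The law of a cloud index and of a satellite codeword, for given cloud centers. -/
def cloudLaw (r₁ : W₂ → W₁ → ℝ) (w : J → W₂) (x : J × W₁) : ℝ := r₁ (w x.1) x.2 / Fintype.card J

lemma cloudLaw_nonneg {r₁ : W₂ → W₁ → ℝ} (h : ∀ w p, 0 ≤ r₁ w p) (w : J → W₂) (x : J × W₁) :
    0 ≤ cloudLaw r₁ w x := div_nonneg (h _ _) (by positivity)

lemma sum_cloudLaw_mul (r₁ : W₂ → W₁ → ℝ) (w : J → W₂) (G : J → W₁ → ℝ) :
    ∑ x : J × W₁, cloudLaw r₁ w x * G x.1 x.2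
      = (∑ j, ∑ p, r₁ (w j) p * G j p) / Fintype.card J := by
  rw [Fintype.sum_prod_type, Finset.sum_div]
  refine Finset.sum_congr rfl fun j _ => ?_
  rw [Finset.sum_div]
  exact Finset.sum_congr rfl fun p _ => by simp only [cloudLaw]; ring

lemma sum_cloudLaw [Nonempty J] {r₁ : W₂ → W₁ → ℝ} (h : ∀ w, ∑ p, r₁ w p = 1) (w : J → W₂) :
    ∑ x, cloudLaw r₁ w x = 1 := by
  have := sum_cloudLaw_mul r₁ w (fun _ _ => 1)
  simp only [mul_one] at this
  rw [this]
  simp [h]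

variable [DecidableEq J] [DecidableEq ι] [Nonempty J]
  {r₂ : W₂ → ℝ} {r₁ : W₂ → W₁ → ℝ}

/-- A single message sees a uniformly chosen cloud center of law r₂, hence a pair of law r₂ r₁. -/
lemma sum_superposition_single (hr₂ : ∑ w, r₂ w = 1) (hr₁ : ∀ w, ∑ p, r₁ w p = 1) (i : ι)
    (G : W₂ → W₁ → ℝ) :
    ∑ w : J → W₂, iid r₂ w * ∑ c : ι → J × W₁, iid (cloudLaw r₁ w) c * G (w (c i).1) (c i).2
      = ∑ w, r₂ w * ∑ p, r₁ w p * G w p := by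
  have hJ : (0 : ℝ) < Fintype.card J := by exact_mod_cast Fintype.card_pos
  have h1 : ∀ w : J → W₂,
      ∑ c : ι → J × W₁, iid (cloudLaw r₁ w) c * G (w (c i).1) (c i).2
        = ∑ j, (∑ p, r₁ (w j) p * G (w j) p) / Fintype.card J := by
    intro w
    rw [sum_iid_coord (sum_cloudLaw hr₁ w) i (fun x => G (w x.1) x.2),
      sum_cloudLaw_mul r₁ w (fun j p => G (w j) p), Finset.sum_div]
  simp_rw [h1, Finset.mul_sum]
  rw [Finset.sum_comm]
  have h2 : ∀ j : J, ∑ w : J → W₂, iid r₂ w * ((∑ p, r₁ (w j) p * G (w j) p) / Fintype.card J)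
      = (∑ w, r₂ w * ∑ p, r₁ w p * G w p) / Fintype.card J := by
    intro j
    rw [sum_iid_coord hr₂ j (fun w => (∑ p, r₁ w p * G w p) / Fintype.card J), Finset.sum_div]
    exact Finset.sum_congr rfl fun w _ => by ring
  simp_rw [h2]
  simp only [Finset.sum_const, Finset.card_univ, nsmul_eq_mul]
  rw [mul_div_cancel₀ _ hJ.ne']
  simp_rw [Finset.mul_sum]

/-- Given the cloud centers, distinct messages have independent codewords. Averaging the tested
satellite over its own cloud leaves h. If the two clouds differ, the mean of h is at most 1; if they
coincide, which has probability 1/|J|, then h is evaluated at the true center and is bounded by Λ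
wherever G does not vanish. -/
lemma sum_superposition_pair (hr₂0 : ∀ w, 0 ≤ r₂ w) (hr₂ : ∑ w, r₂ w = 1)
    (hr₁0 : ∀ w p, 0 ≤ r₁ w p) (hr₁ : ∀ w, ∑ p, r₁ w p = 1) {i i' : ι} (hi : i ≠ i')
    {G : W₂ → W₁ → ℝ} (hG : ∀ w p, 0 ≤ G w p) {H : W₁ → ℝ} {h : W₂ → ℝ}
    (hH : ∀ w, ∑ p, r₁ w p * H p ≤ h w) (hh : ∑ w, r₂ w * h w ≤ 1) {Λ : ℝ}
    (hΛ : ∀ w p, G w p ≠ 0 → h w ≤ Λ) :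
    ∑ w : J → W₂, iid r₂ w *
        ∑ c : ι → J × W₁, iid (cloudLaw r₁ w) c * (G (w (c i).1) (c i).2 * H (c i').2)
      ≤ (1 + Λ / Fintype.card J) * ∑ w, r₂ w * ∑ p, r₁ w p * G w p := by
  have hJ : (0 : ℝ) < Fintype.card J := by exact_mod_cast Fintype.card_pos
  set g : W₂ → ℝ := fun w => ∑ p, r₁ w p * G w p with hg
  have hg0 : ∀ w, 0 ≤ g w := fun w => Finset.sum_nonneg fun p _ => mul_nonneg (hr₁0 w p) (hG w p)
  have hgh : ∀ w, g w * h w ≤ g w * Λ := by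
    intro w
    by_cases hw : g w = 0
    · simp [hw]
    · obtain ⟨p, -, hp⟩ := Finset.exists_ne_zero_of_sum_ne_zero hw
      exact mul_le_mul_of_nonneg_left (hΛ w p (right_ne_zero_of_mul hp)) (hg0 w)
  set Gm := ∑ w, r₂ w * g w with hGm
  have hGm0 : 0 ≤ Gm := Finset.sum_nonneg fun w _ => mul_nonneg (hr₂0 w) (hg0 w)
  have h1 : ∀ w : J → W₂,
      ∑ c : ι → J × W₁, iid (cloudLaw r₁ w) c * (G (w (c i).1) (c i).2 * H (c i').2)
        ≤ (∑ j, ∑ j', g (w j) * h (w j')) / (Fintype.card J : ℝ) ^ 2 := by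
    intro w
    rw [sum_iid_mul (sum_cloudLaw hr₁ w) hi (fun x => G (w x.1) x.2) (fun x => H x.2),
      sum_cloudLaw_mul r₁ w (fun j p => G (w j) p), sum_cloudLaw_mul r₁ w (fun _ p => H p),
      div_mul_div_comm, ← sq, Finset.sum_mul_sum]
    refine div_le_div_of_nonneg_right ?_ (by positivity)
    exact Finset.sum_le_sum fun j _ => Finset.sum_le_sum fun j' _ =>
      mul_le_mul_of_nonneg_left (hH _) (hg0 _)
  have h2 : ∀ j j' : J, ∑ w : J → W₂, iid r₂ w * (g (w j) * h (w j'))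
      ≤ (if j = j' then Gm * Λ else 0) + Gm := by
    intro j j'
    by_cases hjj : j = j'
    · subst hjj
      rw [sum_iid_coord hr₂ j (fun w => g w * h w), if_pos rfl]
      have : ∑ w, r₂ w * (g w * h w) ≤ Gm * Λ := by
        rw [hGm, Finset.sum_mul]
        refine Finset.sum_le_sum fun w _ => ?_
        have := mul_le_mul_of_nonneg_left (hgh w) (hr₂0 w)
        linarith
      linarith
    · rw [sum_iid_mul hr₂ hjj g h, if_neg hjj, zero_add]
      exact mul_le_of_le_one_right hGm0 hh
  calc _ ≤ ∑ w : J → W₂, iid r₂ w *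
          ((∑ j, ∑ j', g (w j) * h (w j')) / (Fintype.card J : ℝ) ^ 2) :=
        Finset.sum_le_sum fun w _ => mul_le_mul_of_nonneg_left (h1 w) (iid_nonneg hr₂0 w)
    _ = (∑ j, ∑ j', ∑ w : J → W₂, iid r₂ w * (g (w j) * h (w j')))
          / (Fintype.card J : ℝ) ^ 2 := by
        simp_rw [← mul_div_assoc]
        rw [← Finset.sum_div]
        congr 1
        simp_rw [Finset.mul_sum]
        rw [Finset.sum_comm]
        exact Finset.sum_congr rfl fun j _ => Finset.sum_comm
    _ ≤ (∑ j : J, ∑ j' : J, ((if j = j' then Gm * Λ else 0) + Gm))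
          / (Fintype.card J : ℝ) ^ 2 :=
        div_le_div_of_nonneg_right
          (Finset.sum_le_sum fun j _ => Finset.sum_le_sum fun j' _ => h2 j j') (by positivity)
    _ = _ := by
        simp only [Finset.sum_add_distrib, Finset.sum_ite_eq, Finset.mem_univ, if_true,
          Finset.sum_const, Finset.card_univ, nsmul_eq_mul]
        field_simp
        ring

end Superposition

/-- The data of a one-shot two-round coding problem and the bounds on its likelihood ratios. -/
structure CodingProblem (S V W₂ W₁ T : Type*) [Fintype S] [Fintype V] [Fintype W₂] [Fintype W₁]
    [Fintype T] where
  /-- law of the first-round channel inputs and outputs -/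
  PS : S → ℝ
  /-- law of the words of the first codebook -/
  pv : V → ℝ
  /-- law of the cloud centers -/
  r₂ : W₂ → ℝ
  /-- law of the satellite codewords -/
  r₁ : W₂ → W₁ → ℝ
  /-- second-round channel -/
  C : W₁ → T → ℝ
  /-- likelihood ratio of a first-round word -/
  ℓ : V → S → ℝ
  /-- admissible quantizations -/
  jt : V → S → Prop
  /-- the likelihood ratios of the true words are as expected -/
  good : V → S → W₂ → W₁ → T → Prop
  /-- the decoding test -/
  mat : V → W₁ → S → T → Prop
  /-- first factor of the likelihood ratio of the decoding test -/
  L₁ : V → S → ℝ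
  /-- second factor of the likelihood ratio of the decoding test -/
  L₂ : W₁ → T → ℝ
  /-- likelihood ratio of a cloud center -/
  L₃ : W₂ → T → ℝ
  (Γ τ Λ₁ Λ₃ : ℝ)
  PS_nonneg : ∀ s, 0 ≤ PS s
  PS_sum : ∑ s, PS s = 1
  pv_nonneg : ∀ v, 0 ≤ pv v
  pv_sum : ∑ v, pv v = 1
  r₂_nonneg : ∀ w, 0 ≤ r₂ w
  r₂_sum : ∑ w, r₂ w = 1
  r₁_nonneg : ∀ w p, 0 ≤ r₁ w p
  r₁_sum : ∀ w, ∑ p, r₁ w p = 1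
  C_nonneg : ∀ p t, 0 ≤ C p t
  C_sum : ∀ p, ∑ t, C p t = 1
  ℓ_nonneg : ∀ v s, 0 ≤ ℓ v s
  ℓ_sum : ∀ s, ∑ v, pv v * ℓ v s ≤ 2
  L₁_nonneg : ∀ v s, 0 ≤ L₁ v s
  L₁_sum : ∀ s, ∑ v, pv v * L₁ v s ≤ 2
  L₂_nonneg : ∀ p t, 0 ≤ L₂ p t
  L₂_sum : ∀ w t, ∑ p, r₁ w p * L₂ p t ≤ L₃ w t
  L₃_sum : ∀ t, ∑ w, r₂ w * L₃ w t ≤ 1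
  τ_nonneg : 0 ≤ τ
  Γ_nonneg : 0 ≤ Γ
  Λ₁_nonneg : 0 ≤ Λ₁
  Λ₃_nonneg : 0 ≤ Λ₃
  jt_le : ∀ v s, jt v s → ℓ v s ≤ Γ
  mat_le : ∀ v s w p t v' p', good v s w p t → mat v' p' s t → 1 ≤ τ * (L₁ v' s * L₂ p' t)
  good_L₁ : ∀ v s w p t, good v s w p t → L₁ v s ≤ Λ₁
  good_L₃ : ∀ v s w p t, good v s w p t → L₃ w t ≤ Λ₃

/-! ### The average failure probability of the random code. -/

namespace CodingProblem

variable {S V W₂ W₁ T : Type*} [Fintype S] [Fintype V] [Fintype W₂] [Fintype W₁] [Fintype T]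
  (D : CodingProblem S V W₂ W₁ T)

/-- Failure probability of the covering of the first-round outputs. -/
def coveringDefect : ℝ := ∑ s, D.PS s * |1 - ∑ v, D.pv v * (D.ℓ v s * ind (D.jt v s))|

/-- Probability of an atypical run. -/
def atypicality : ℝ :=
  ∑ v, D.pv v * ∑ w, D.r₂ w * ∑ p, D.r₁ w p *
    ∑ s, ∑ t, D.PS s * D.ℓ v s * D.C p t * ind (¬ D.good v s w p t)

variable {F B J : Type*} [Fintype F] [Fintype B] [Fintype J] [DecidableEq F] [DecidableEq B]
  [DecidableEq J] [Nonempty F] [Nonempty B] [Nonempty J]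

/-- Codebooks: first-round words, cloud centers, and a cloud index and a satellite codeword for
each message. -/
abbrev Code (V W₂ W₁ F B J : Type*) := (F → V) × (J → W₂) × (F × B → J × W₁)

/-- The law of the random code. -/
def codeLaw (x : Code V W₂ W₁ F B J) : ℝ :=
  iid D.pv x.1 * (iid D.r₂ x.2.1 * iid (cloudLaw D.r₁ x.2.1) x.2.2)

lemma codeLaw_nonneg (x : Code V W₂ W₁ F B J) : 0 ≤ D.codeLaw x :=
  mul_nonneg (iid_nonneg D.pv_nonneg _)
    (mul_nonneg (iid_nonneg D.r₂_nonneg _) (iid_nonneg (cloudLaw_nonneg D.r₁_nonneg _) _))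

lemma sum_codeLaw_mul (X : Code V W₂ W₁ F B J → ℝ) :
    ∑ x, D.codeLaw x * X x = ∑ v : F → V, iid D.pv v * ∑ w : J → W₂, iid D.r₂ w *
      ∑ c : F × B → J × W₁, iid (cloudLaw D.r₁ w) c * X (v, w, c) := by
  rw [Fintype.sum_prod_type]
  refine Finset.sum_congr rfl fun v _ => ?_
  rw [Fintype.sum_prod_type, Finset.mul_sum]
  refine Finset.sum_congr rfl fun w _ => ?_
  rw [Finset.mul_sum, Finset.mul_sum]
  exact Finset.sum_congr rfl fun c _ => by simp only [codeLaw]; ring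

lemma sum_codeLaw_first (φ : (F → V) → ℝ) :
    ∑ x : Code V W₂ W₁ F B J, D.codeLaw x * φ x.1 = ∑ v, iid D.pv v * φ v := by
  rw [sum_codeLaw_mul]
  refine Finset.sum_congr rfl fun v _ => ?_
  simp_rw [← Finset.sum_mul, sum_iid (sum_cloudLaw D.r₁_sum _), one_mul]
  rw [← Finset.sum_mul, sum_iid D.r₂_sum, one_mul]

lemma sum_codeLaw : ∑ x : Code V W₂ W₁ F B J, D.codeLaw x = 1 := by
  have := D.sum_codeLaw_first (F := F) (B := B) (J := J) (fun _ => 1)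
  simp only [mul_one] at this
  rw [this, sum_iid D.pv_sum]

/-- The covering defect of a codebook. -/
def codeCovering (v : F → V) : ℝ :=
  ∑ s, D.PS s * |1 - (∑ f, D.ℓ (v f) s * ind (D.jt (v f) s)) / Fintype.card F|

/-- The failure probability for one message. -/
def messageError (x : Code V W₂ W₁ F B J) (m : F × B) : ℝ :=
  ∑ s, ∑ t, D.PS s * D.ℓ (x.1 m.1) s * D.C (x.2.2 m).2 t *
    ind (¬ D.good (x.1 m.1) s (x.2.1 (x.2.2 m).1) (x.2.2 m).2 t ∨
      ∃ m', m' ≠ m ∧ D.mat (x.1 m'.1) (x.2.2 m').2 s t)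

lemma sum_codeLaw_atypical (m : F × B) :
    ∑ x : Code V W₂ W₁ F B J, D.codeLaw x *
      ∑ s, ∑ t, D.PS s * D.ℓ (x.1 m.1) s * D.C (x.2.2 m).2 t *
        ind (¬ D.good (x.1 m.1) s (x.2.1 (x.2.2 m).1) (x.2.2 m).2 t) = D.atypicality := by
  rw [sum_codeLaw_mul]
  simp_rw [fun v : F → V => sum_superposition_single (J := J) D.r₂_sum D.r₁_sum m
    (fun w p => ∑ s, ∑ t, D.PS s * D.ℓ (v m.1) s * D.C p t * ind (¬ D.good (v m.1) s w p t))]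
  exact sum_iid_coord D.pv_sum m.1 (fun v => ∑ w, D.r₂ w * ∑ p, D.r₁ w p *
    ∑ s, ∑ t, D.PS s * D.ℓ v s * D.C p t * ind (¬ D.good v s w p t))

/-- The confusion of a true first-round word `v` with a tested word `v'`, summed over the laws
of the second round. -/
def confusion (v v' : V) : ℝ :=
  ∑ s, ∑ t, D.PS s * D.ℓ v s * D.L₁ v' s *
    ∑ w, D.r₂ w * ∑ p, D.r₁ w p * (D.C p t * ind (D.good v s w p t))

/-- On good runs `mat_le` replaces the indicator of the test by τ L₁ L₂. The factor L₁ depends only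
on the first round and comes out, and L₂ is averaged over the superposition code by
`sum_superposition_pair`. -/
lemma sum_superposition_confusion {m m' : F × B} (hm : m ≠ m') (v v' : V) :
    ∑ w : J → W₂, iid D.r₂ w * ∑ c : F × B → J × W₁, iid (cloudLaw D.r₁ w) c *
      ∑ s, ∑ t, D.PS s * D.ℓ v s * D.C (c m).2 t *
        (ind (D.good v s (w (c m).1) (c m).2 t) * ind (D.mat v' (c m').2 s t))
      ≤ D.τ * (1 + D.Λ₃ / Fintype.card J) * D.confusion v v' := by
  have hst : ∀ s t, ∑ w : J → W₂, iid D.r₂ w * ∑ c : F × B → J × W₁, iid (cloudLaw D.r₁ w) c *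
      (D.PS s * D.ℓ v s * D.C (c m).2 t *
        (ind (D.good v s (w (c m).1) (c m).2 t) * ind (D.mat v' (c m').2 s t)))
      ≤ D.τ * (1 + D.Λ₃ / Fintype.card J) * (D.PS s * D.ℓ v s * D.L₁ v' s *
        ∑ w, D.r₂ w * ∑ p, D.r₁ w p * (D.C p t * ind (D.good v s w p t))) := by
    intro s t
    have hpair := sum_superposition_pair (J := J) D.r₂_nonneg D.r₂_sum D.r₁_nonneg D.r₁_sum hm
      (G := fun w p => D.C p t * ind (D.good v s w p t))
      (fun w p => mul_nonneg (D.C_nonneg p t) (ind_nonneg _))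
      (H := fun p => D.L₂ p t) (h := fun w => D.L₃ w t) (fun w => D.L₂_sum w t) (D.L₃_sum t)
      (Λ := D.Λ₃) (fun w p h => by
        by_cases hg : D.good v s w p t
        · exact D.good_L₃ v s w p t hg
        · simp [ind_false hg] at h)
    have hk : 0 ≤ D.PS s * D.ℓ v s * D.L₁ v' s * D.τ :=
      mul_nonneg (mul_nonneg (mul_nonneg (D.PS_nonneg s) (D.ℓ_nonneg v s)) (D.L₁_nonneg v' s))
        D.τ_nonneg
    have hle := mul_le_mul_of_nonneg_left hpair hk
    refine le_trans ?_ (hle.trans_eq (by ring))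
    rw [Finset.mul_sum]
    refine Finset.sum_le_sum fun w _ => ?_
    rw [mul_left_comm]
    refine mul_le_mul_of_nonneg_left ?_ (iid_nonneg D.r₂_nonneg w)
    rw [Finset.mul_sum]
    refine Finset.sum_le_sum fun c _ => ?_
    rw [mul_left_comm (D.PS s * D.ℓ v s * D.L₁ v' s * D.τ)]
    refine mul_le_mul_of_nonneg_left ?_ (iid_nonneg (cloudLaw_nonneg D.r₁_nonneg w) c)
    by_cases hg : D.good v s (w (c m).1) (c m).2 t
    · have hm : ind (D.mat v' (c m').2 s t) ≤ D.τ * (D.L₁ v' s * D.L₂ (c m').2 t) := by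
        by_cases h : D.mat v' (c m').2 s t
        · rw [ind_true h]; exact D.mat_le _ _ _ _ _ _ _ hg h
        · rw [ind_false h]
          exact mul_nonneg D.τ_nonneg (mul_nonneg (D.L₁_nonneg _ _) (D.L₂_nonneg _ _))
      rw [ind_true hg]
      have := mul_le_mul_of_nonneg_left hm (mul_nonneg (mul_nonneg (D.PS_nonneg s)
        (D.ℓ_nonneg v s)) (D.C_nonneg (c m).2 t))
      nlinarith
    · simp [ind_false hg]
  have hex : ∀ (X : S → T → (J → W₂) → (F × B → J × W₁) → ℝ),
      ∑ w : J → W₂, iid D.r₂ w * ∑ c : F × B → J × W₁, iid (cloudLaw D.r₁ w) c *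
        ∑ s, ∑ t, X s t w c
      = ∑ s, ∑ t, ∑ w : J → W₂, iid D.r₂ w * ∑ c : F × B → J × W₁, iid (cloudLaw D.r₁ w) c *
        X s t w c := by
    intro X
    simp_rw [Finset.mul_sum]
    simp_rw [← Fintype.sum_prod_type']
    exact Fintype.sum_equiv ⟨fun x => (x.2.2.1, x.2.2.2, x.1, x.2.1),
      fun x => (x.2.2.1, x.2.2.2, x.1, x.2.1), fun _ => rfl, fun _ => rfl⟩ _ _ fun _ => rfl
  rw [hex, confusion, Finset.mul_sum]
  refine Finset.sum_le_sum fun s _ => ?_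
  rw [Finset.mul_sum]
  exact Finset.sum_le_sum fun t _ => hst s t

lemma sum_good_le_one (v : V) (s : S) :
    ∑ t, ∑ w, D.r₂ w * ∑ p, D.r₁ w p * (D.C p t * ind (D.good v s w p t)) ≤ 1 := by
  calc _ ≤ ∑ t, ∑ w, D.r₂ w * ∑ p, D.r₁ w p * D.C p t :=
        Finset.sum_le_sum fun t _ => Finset.sum_le_sum fun w _ =>
          mul_le_mul_of_nonneg_left (Finset.sum_le_sum fun p _ =>
            mul_le_mul_of_nonneg_left
              (mul_le_of_le_one_right (D.C_nonneg p t) (ind_le_one _)) (D.r₁_nonneg w p))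
            (D.r₂_nonneg w)
    _ = 1 := by
        rw [Finset.sum_comm]
        simp_rw [← Finset.mul_sum]
        have : ∀ w, ∑ t, ∑ p, D.r₁ w p * D.C p t = 1 := fun w => by
          rw [Finset.sum_comm]
          simp_rw [← Finset.mul_sum, D.C_sum, mul_one, D.r₁_sum]
        simp_rw [this, mul_one, D.r₂_sum]

lemma confusion_le (v v' : V) : D.confusion v v' ≤ ∑ s, D.PS s * D.ℓ v s * D.L₁ v' s := by
  refine Finset.sum_le_sum fun s _ => ?_
  rw [← Finset.mul_sum]
  exact mul_le_of_le_one_right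
    (mul_nonneg (mul_nonneg (D.PS_nonneg s) (D.ℓ_nonneg v s)) (D.L₁_nonneg v' s))
    (D.sum_good_le_one v s)

/-- For independent V-words v and v' the ratios ℓ and L₁ average separately at fixed s, each to at
most 2. -/
lemma sum_confusion_le : ∑ v, ∑ v', D.pv v * (D.pv v' * D.confusion v v') ≤ 4 := by
  calc _ ≤ ∑ v, ∑ v', ∑ s, D.PS s * ((D.pv v * D.ℓ v s) * (D.pv v' * D.L₁ v' s)) := by
        refine Finset.sum_le_sum fun v _ => Finset.sum_le_sum fun v' _ => ?_
        have := mul_le_mul_of_nonneg_left (D.confusion_le v v')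
          (mul_nonneg (D.pv_nonneg v) (D.pv_nonneg v'))
        rw [← mul_assoc]
        refine this.trans_eq ?_
        rw [Finset.mul_sum]
        exact Finset.sum_congr rfl fun s _ => by ring
    _ = ∑ s, D.PS s * ((∑ v, D.pv v * D.ℓ v s) * ∑ v', D.pv v' * D.L₁ v' s) := by
        simp_rw [Finset.sum_mul_sum, Finset.mul_sum]
        rw [Finset.sum_comm' (t' := Finset.univ) (s' := fun _ => Finset.univ) (by simp)]
        simp_rw [← Fintype.sum_prod_type']
        exact Fintype.sum_equiv ⟨fun x => (x.2.2, x.2.1, x.1), fun x => (x.2.2, x.2.1, x.1),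
          fun _ => rfl, fun _ => rfl⟩ _ _ fun _ => rfl
    _ ≤ ∑ s, D.PS s * 4 := by
        refine Finset.sum_le_sum fun s _ => mul_le_mul_of_nonneg_left ?_ (D.PS_nonneg s)
        have h0 : 0 ≤ ∑ v', D.pv v' * D.L₁ v' s :=
          Finset.sum_nonneg fun v _ => mul_nonneg (D.pv_nonneg v) (D.L₁_nonneg v s)
        nlinarith [D.ℓ_sum s, D.L₁_sum s]
    _ = 4 := by rw [← Finset.sum_mul, D.PS_sum, one_mul]

/-- When the tested message has the true V-word, its ratio L₁ is not averaged; on good runs it is at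
most Λ₁, and the average of ℓ gives the factor 2. -/
lemma sum_confusion_self_le : ∑ v, D.pv v * D.confusion v v ≤ 2 * D.Λ₁ := by
  have h1 : ∀ v, D.confusion v v ≤ ∑ s, D.PS s * D.ℓ v s * D.Λ₁ := by
    intro v
    refine Finset.sum_le_sum fun s _ => ?_
    have hpl := mul_nonneg (D.PS_nonneg s) (D.ℓ_nonneg v s)
    rw [← Finset.mul_sum]
    by_cases h : D.L₁ v s ≤ D.Λ₁
    · exact (mul_le_of_le_one_right (mul_nonneg hpl (D.L₁_nonneg v s))
        (D.sum_good_le_one v s)).trans (mul_le_mul_of_nonneg_left h hpl)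
    · have : ∀ w p t, ind (D.good v s w p t) = 0 :=
        fun w p t => ind_false fun hg => h (D.good_L₁ v s w p t hg)
      simp only [this, mul_zero, Finset.sum_const_zero]
      exact mul_nonneg hpl D.Λ₁_nonneg
  calc _ ≤ ∑ v, D.pv v * ∑ s, D.PS s * D.ℓ v s * D.Λ₁ :=
        Finset.sum_le_sum fun v _ => mul_le_mul_of_nonneg_left (h1 v) (D.pv_nonneg v)
    _ = (∑ s, D.PS s * ∑ v, D.pv v * D.ℓ v s) * D.Λ₁ := by
        simp_rw [Finset.mul_sum, Finset.sum_mul]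
        rw [Finset.sum_comm]
        exact Finset.sum_congr rfl fun s _ => Finset.sum_congr rfl fun v _ => by ring
    _ ≤ (∑ s, D.PS s * 2) * D.Λ₁ :=
        mul_le_mul_of_nonneg_right (Finset.sum_le_sum fun s _ =>
          mul_le_mul_of_nonneg_left (D.ℓ_sum s) (D.PS_nonneg s)) D.Λ₁_nonneg
    _ = 2 * D.Λ₁ := by rw [← Finset.sum_mul, D.PS_sum, one_mul]

/-- The bound on the average failure probability of a random code. -/
def failureBound (F B J : Type*) [Fintype F] [Fintype B] [Fintype J] : ℝ :=
  D.coveringDefect + √(2 * D.Γ / Fintype.card F) + D.atypicality +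
    D.τ * (1 + D.Λ₃ / Fintype.card J) *
      (4 * (Fintype.card F * Fintype.card B) + 2 * D.Λ₁ * Fintype.card B)

lemma sum_codeLaw_confusion {m m' : F × B} (hm : m' ≠ m) :
    ∑ x : Code V W₂ W₁ F B J, D.codeLaw x * ∑ s, ∑ t, D.PS s * D.ℓ (x.1 m.1) s *
      D.C (x.2.2 m).2 t * (ind (D.good (x.1 m.1) s (x.2.1 (x.2.2 m).1) (x.2.2 m).2 t) *
        ind (D.mat (x.1 m'.1) (x.2.2 m').2 s t))
      ≤ D.τ * (1 + D.Λ₃ / Fintype.card J) * (4 + if m'.1 = m.1 then 2 * D.Λ₁ else 0) := by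
  rw [sum_codeLaw_mul]
  have hk : 0 ≤ D.τ * (1 + D.Λ₃ / Fintype.card J) :=
    mul_nonneg D.τ_nonneg (add_nonneg zero_le_one (div_nonneg D.Λ₃_nonneg (by positivity)))
  calc _ ≤ ∑ v : F → V, iid D.pv v *
        (D.τ * (1 + D.Λ₃ / Fintype.card J) * D.confusion (v m.1) (v m'.1)) :=
        Finset.sum_le_sum fun v _ => mul_le_mul_of_nonneg_left
          (D.sum_superposition_confusion hm.symm _ _) (iid_nonneg D.pv_nonneg v)
    _ = D.τ * (1 + D.Λ₃ / Fintype.card J) *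
          ∑ v : F → V, iid D.pv v * D.confusion (v m.1) (v m'.1) := by
        rw [Finset.mul_sum]
        exact Finset.sum_congr rfl fun v _ => by ring
    _ ≤ _ := by
        refine mul_le_mul_of_nonneg_left ?_ hk
        by_cases h : m'.1 = m.1
        · rw [h, sum_iid_coord D.pv_sum m.1 (fun v => D.confusion v v), if_pos rfl]
          linarith [D.sum_confusion_self_le]
        · rw [sum_iid_pair D.pv_sum (Ne.symm h) D.confusion, if_neg h, add_zero]
          exact D.sum_confusion_le

/-- Union bound over the wrong messages, which counts confusions only on good runs so that the
likelihood bounds apply. -/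
lemma messageError_le (x : Code V W₂ W₁ F B J) (m : F × B) :
    D.messageError x m ≤
      ∑ s, ∑ t, D.PS s * D.ℓ (x.1 m.1) s * D.C (x.2.2 m).2 t *
        ind (¬ D.good (x.1 m.1) s (x.2.1 (x.2.2 m).1) (x.2.2 m).2 t) +
      ∑ m' ∈ Finset.univ.erase m, ∑ s, ∑ t, D.PS s * D.ℓ (x.1 m.1) s *
        D.C (x.2.2 m).2 t * (ind (D.good (x.1 m.1) s (x.2.1 (x.2.2 m).1) (x.2.2 m).2 t) *
          ind (D.mat (x.1 m'.1) (x.2.2 m').2 s t)) := by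
  rw [Finset.sum_comm (s := Finset.univ.erase m), ← Finset.sum_add_distrib]
  refine Finset.sum_le_sum fun s _ => ?_
  rw [Finset.sum_comm (s := Finset.univ.erase m), ← Finset.sum_add_distrib]
  refine Finset.sum_le_sum fun t _ => ?_
  rw [← Finset.mul_sum, ← mul_add]
  refine mul_le_mul_of_nonneg_left ?_
    (mul_nonneg (mul_nonneg (D.PS_nonneg s) (D.ℓ_nonneg _ s)) (D.C_nonneg _ t))
  set g := D.good (x.1 m.1) s (x.2.1 (x.2.2 m).1) (x.2.2 m).2 t
  by_cases hg : g
  · rw [ind_true hg, ind_false (not_not.mpr hg), zero_add]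
    by_cases he : ∃ m', m' ≠ m ∧ D.mat (x.1 m'.1) (x.2.2 m').2 s t
    · obtain ⟨m', hm', hmat⟩ := he
      refine (ind_le_one _).trans ?_
      have := Finset.single_le_sum (f := fun m' => 1 * ind (D.mat (x.1 m'.1) (x.2.2 m').2 s t))
        (fun m' _ => by rw [one_mul]; exact ind_nonneg _)
        (Finset.mem_erase.mpr ⟨hm', Finset.mem_univ m'⟩)
      simpa [ind_true hmat] using this
    · rw [ind_false (not_or.mpr ⟨not_not.mpr hg, he⟩)]
      exact Finset.sum_nonneg fun m' _ => by rw [one_mul]; exact ind_nonneg _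
  · rw [ind_true hg]
    have : 0 ≤ ∑ m' ∈ Finset.univ.erase m, ind g * ind (D.mat (x.1 m'.1) (x.2.2 m').2 s t) :=
      Finset.sum_nonneg fun m' _ => mul_nonneg (ind_nonneg _) (ind_nonneg _)
    linarith [ind_le_one (¬ g ∨ ∃ m', m' ≠ m ∧ D.mat (x.1 m'.1) (x.2.2 m').2 s t)]

/-- All |F||B| messages contribute the constant 4; only the |B| messages with the true V-word
contribute the extra 2Λ₁. -/
lemma sum_codeLaw_messageError (m : F × B) :
    ∑ x : Code V W₂ W₁ F B J, D.codeLaw x * D.messageError x m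
      ≤ D.atypicality + D.τ * (1 + D.Λ₃ / Fintype.card J) *
      (4 * (Fintype.card F * Fintype.card B) + 2 * D.Λ₁ * Fintype.card B) := by
  have hk : 0 ≤ D.τ * (1 + D.Λ₃ / Fintype.card J) :=
    mul_nonneg D.τ_nonneg (add_nonneg zero_le_one (div_nonneg D.Λ₃_nonneg (by positivity)))
  refine (Finset.sum_le_sum fun x _ =>
    mul_le_mul_of_nonneg_left (D.messageError_le x m) (D.codeLaw_nonneg x)).trans ?_
  simp_rw [mul_add (D.codeLaw _)]
  rw [Finset.sum_add_distrib, sum_codeLaw_atypical]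
  refine add_le_add le_rfl ?_
  simp_rw [Finset.mul_sum (Finset.univ.erase m)]
  rw [Finset.sum_comm]
  calc _ ≤ ∑ m' ∈ Finset.univ.erase m, D.τ * (1 + D.Λ₃ / Fintype.card J) *
        (4 + if m'.1 = m.1 then 2 * D.Λ₁ else 0) :=
        Finset.sum_le_sum fun m' hm' => D.sum_codeLaw_confusion (Finset.ne_of_mem_erase hm')
    _ ≤ ∑ m' : F × B, D.τ * (1 + D.Λ₃ / Fintype.card J) *
        (4 + if m'.1 = m.1 then 2 * D.Λ₁ else 0) := by
        refine Finset.sum_le_sum_of_subset_of_nonneg (Finset.erase_subset _ _) fun m' _ _ => ?_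
        refine mul_nonneg hk ?_
        have := D.Λ₁_nonneg
        split_ifs <;> linarith
    _ = _ := by
        rw [← Finset.mul_sum, Fintype.sum_prod_type, Finset.sum_comm]
        congr 1
        simp only [Finset.sum_const, Finset.card_univ, nsmul_eq_mul,
          Finset.sum_add_distrib, Finset.sum_ite_eq', Finset.mem_univ, if_true]
        ring

/-- Random coding: some code has a small covering defect and a small average error. -/
theorem exists_code : ∃ x : Code V W₂ W₁ F B J, (∀ f, 0 < D.pv (x.1 f)) ∧
    D.codeCovering x.1 + (∑ m, D.messageError x m) / (Fintype.card F * Fintype.card B)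
      ≤ D.failureBound F B J := by
  have hF : (0 : ℝ) < Fintype.card F := by exact_mod_cast Fintype.card_pos
  have hB : (0 : ℝ) < Fintype.card B := by exact_mod_cast Fintype.card_pos
  obtain ⟨x, hx, hle⟩ := exists_of_weighted_sum_le (p := D.codeLaw (F := F) (B := B) (J := J))
    (X := fun x => D.codeCovering x.1 +
      (∑ m, D.messageError x m) / (Fintype.card F * Fintype.card B))
    D.codeLaw_nonneg D.sum_codeLaw (θ := D.failureBound F B J) (by
      simp_rw [mul_add]
      rw [Finset.sum_add_distrib, D.sum_codeLaw_first D.codeCovering, failureBound, add_assoc]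
      refine add_le_add ?_ ?_
      · refine sum_iid_covering (φ := fun v s => D.ℓ v s * ind (D.jt v s)) D.PS_nonneg D.PS_sum
          D.pv_nonneg D.pv_sum (fun v s => mul_nonneg (D.ℓ_nonneg v s) (ind_nonneg _)) ?_ ?_
        · intro v s
          by_cases h : D.jt v s
          · rw [ind_true h, mul_one]; exact D.jt_le v s h
          · rw [ind_false h, mul_zero]; exact D.Γ_nonneg
        · intro s
          refine le_trans (Finset.sum_le_sum fun v _ => ?_) (D.ℓ_sum s)
          exact mul_le_mul_of_nonneg_left
            (mul_le_of_le_one_right (D.ℓ_nonneg v s) (ind_le_one _)) (D.pv_nonneg v)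
      · simp_rw [← mul_div_assoc]
        rw [← Finset.sum_div, div_le_iff₀ (by positivity)]
        simp_rw [Finset.mul_sum]
        rw [Finset.sum_comm]
        refine (Finset.sum_le_sum fun m _ => D.sum_codeLaw_messageError m).trans_eq ?_
        simp only [Finset.sum_const, Finset.card_univ, Fintype.card_prod, nsmul_eq_mul]
        push_cast
        ring)
  refine ⟨x, fun f => ?_, hle⟩
  have h1 : iid D.pv x.1 ≠ 0 := left_ne_zero_of_mul hx.ne'
  have h2 : D.pv (x.1 f) ≠ 0 := fun h => h1 (Finset.prod_eq_zero (Finset.mem_univ f) h)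
  exact lt_of_le_of_ne (D.pv_nonneg _) h2.symm

end CodingProblem

end

section

/-! Probability mass functions on finite types, in real numbers. -/

section RealPMF

variable {Ω α β γ : Type*}

lemma pmf_sum_toReal [Fintype Ω] (μ : PMF Ω) : ∑ ω, (μ ω).toReal = 1 := by
  rw [← ENNReal.toReal_sum fun ω _ => μ.apply_ne_top ω, ← tsum_fintype (L := .unconditional _),
    μ.tsum_coe, ENNReal.toReal_one]

lemma toReal_map [Fintype Ω] (μ : PMF Ω) (A : Ω → α) (a : α) :
    ((μ.map A) a).toReal = ∑ ω, (μ ω).toReal * ind (A ω = a) := by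
  classical
  rw [PMF.map_apply, tsum_fintype, ENNReal.toReal_sum]
  · refine Finset.sum_congr rfl fun ω _ => ?_
    by_cases h : A ω = a
    · rw [if_pos h.symm, ind_true h, mul_one]
    · rw [if_neg (Ne.symm h), ind_false h]; simp
  · intro ω _
    split_ifs
    · exact μ.apply_ne_top ω
    · simp

lemma sum_ind_eq_mul [Fintype α] (a : α) (φ : α → ℝ) : ∑ b, ind (a = b) * φ b = φ a := by
  rw [Finset.sum_eq_single a]
  · rw [ind_true rfl, one_mul]
  · intro b _ hb; rw [ind_false (Ne.symm hb), zero_mul]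
  · simp

lemma sum_map_mul [Fintype Ω] [Fintype α] (μ : PMF Ω) (A : Ω → α) (φ : α → ℝ) :
    ∑ a, ((μ.map A) a).toReal * φ a = ∑ ω, (μ ω).toReal * φ (A ω) := by
  simp_rw [toReal_map, Finset.sum_mul]
  rw [Finset.sum_comm]
  refine Finset.sum_congr rfl fun ω _ => ?_
  simp_rw [mul_assoc]
  rw [← Finset.mul_sum, sum_ind_eq_mul]

lemma toReal_le_map [Fintype Ω] (μ : PMF Ω) (A : Ω → α) (ω : Ω) :
    (μ ω).toReal ≤ ((μ.map A) (A ω)).toReal := by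
  rw [toReal_map]
  have := Finset.single_le_sum (f := fun ω' => (μ ω').toReal * ind (A ω' = A ω))
    (fun ω' _ => mul_nonneg ENNReal.toReal_nonneg (ind_nonneg _)) (Finset.mem_univ ω)
  simpa [ind_true] using this

lemma map_pos_of_pos [Fintype Ω] (μ : PMF Ω) (A : Ω → α) {ω : Ω} (h : 0 < (μ ω).toReal) :
    0 < ((μ.map A) (A ω)).toReal := h.trans_le (toReal_le_map μ A ω)

lemma toReal_map_le_map [Fintype Ω] (μ : PMF Ω) (A : Ω → α) (f : α → β) (a : α) :
    ((μ.map A) a).toReal ≤ ((μ.map (fun ω => f (A ω))) (f a)).toReal := by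
  rw [toReal_map, toReal_map]
  exact Finset.sum_le_sum fun ω _ =>
    mul_le_mul_of_nonneg_left (ind_mono fun h => by rw [h]) ENNReal.toReal_nonneg

lemma toReal_map_of_injective [Fintype Ω] (μ : PMF Ω) (A : Ω → α) {f : α → β}
    (hf : Function.Injective f) (a : α) :
    ((μ.map (fun ω => f (A ω))) (f a)).toReal = ((μ.map A) a).toReal := by
  rw [toReal_map, toReal_map]
  refine Finset.sum_congr rfl fun ω _ => ?_
  congr 1
  by_cases h : A ω = a
  · rw [ind_true h, ind_true (by rw [h])]
  · rw [ind_false h, ind_false fun e => h (hf e)]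

lemma sum_map_pair_left [Fintype Ω] [Fintype α] (μ : PMF Ω) (A : Ω → α) (B : Ω → β) (b : β) :
    ∑ a, ((μ.map fun ω => (A ω, B ω)) (a, b)).toReal = ((μ.map B) b).toReal := by
  simp_rw [toReal_map]
  rw [Finset.sum_comm]
  refine Finset.sum_congr rfl fun ω _ => ?_
  rw [← Finset.mul_sum]
  congr 1
  have : ∀ a, ind ((A ω, B ω) = (a, b)) = ind (A ω = a) * ind (B ω = b) := by
    intro a
    by_cases h1 : A ω = a <;> by_cases h2 : B ω = b <;> simp [ind, h1, h2]
  simp_rw [this]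
  rw [sum_ind_eq_mul (A ω) (fun _ => ind (B ω = b))]

end RealPMF

/-! Entropies as expectations. -/

section Entropy

variable {Ω α β γ : Type*} [Fintype Ω] [Fintype α] [Fintype β] [Fintype γ]

lemma entropy_eq (p : PMF α) :
    entropy p = ∑ a, (p a).toReal * -Real.logb 2 (p a).toReal := by
  refine Finset.sum_congr rfl fun a _ => ?_
  rw [Real.negMulLog, Real.logb]; ring

lemma rvEntropy_eq (μ : PMF Ω) (A : Ω → α) :
    rvEntropy μ A = ∑ ω, (μ ω).toReal * -Real.logb 2 ((μ.map A) (A ω)).toReal := by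
  rw [rvEntropy, entropy_eq, sum_map_mul μ A (fun a => -Real.logb 2 ((μ.map A) a).toReal)]

lemma rvEntropy_map {Ω' : Type*} (μ : PMF Ω') (g : Ω' → Ω) (A : Ω → α) :
    rvEntropy (μ.map g) A = rvEntropy μ (fun ω => A (g ω)) := by
  rw [rvEntropy, rvEntropy, PMF.map_comp]; rfl

lemma rvEntropy_of_injective (μ : PMF Ω) (A : Ω → α) {f : α → β} (hf : Function.Injective f) :
    rvEntropy μ (fun ω => f (A ω)) = rvEntropy μ A := by
  rw [rvEntropy_eq, rvEntropy_eq]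
  simp_rw [toReal_map_of_injective μ A hf]

/-- Jensen's inequality for the logarithm. -/
lemma sum_mul_logb_nonpos {w r : Ω → ℝ} (hw0 : ∀ ω, 0 ≤ w ω) (hw : ∑ ω, w ω = 1)
    (hr : ∀ ω, 0 < w ω → 0 < r ω) (hs : ∑ ω, w ω * r ω ≤ 1) :
    ∑ ω, w ω * Real.logb 2 (r ω) ≤ 0 := by
  have h2 : 0 < Real.log 2 := Real.log_pos (by norm_num)
  have h : ∀ ω, w ω * Real.logb 2 (r ω) ≤ (w ω * r ω - w ω) / Real.log 2 := by
    intro ω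
    rcases (hw0 ω).eq_or_lt with h0 | h0
    · simp [← h0]
    · rw [Real.logb, ← mul_div_assoc]
      refine div_le_div_of_nonneg_right ?_ h2.le
      nlinarith [Real.log_le_sub_one_of_pos (hr ω h0)]
  refine (Finset.sum_le_sum fun ω _ => h ω).trans ?_
  rw [← Finset.sum_div, Finset.sum_sub_distrib, hw]
  exact div_nonpos_of_nonpos_of_nonneg (by linarith) h2.le

/-- Jensen's inequality for the ratio p(a,c) p(b,c) / (p(c) p(a,b,c)), whose mean is at most one. -/
lemma condMutualInfo_nonneg (μ : PMF Ω) (A : Ω → α) (B : Ω → β) (C : Ω → γ) :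
    0 ≤ condMutualInfo μ A B C := by
  set pAC : Ω → ℝ := fun ω => ((μ.map fun ω => (A ω, C ω)) (A ω, C ω)).toReal with hAC
  set pC : Ω → ℝ := fun ω => ((μ.map C) (C ω)).toReal with hC
  set pABC : Ω → ℝ := fun ω => ((μ.map fun ω => (A ω, B ω, C ω)) (A ω, B ω, C ω)).toReal with hABC
  set pBC : Ω → ℝ := fun ω => ((μ.map fun ω => (B ω, C ω)) (B ω, C ω)).toReal with hBC
  have pos : ∀ ω, 0 < (μ ω).toReal → 0 < pAC ω ∧ 0 < pC ω ∧ 0 < pABC ω ∧ 0 < pBC ω := fun ω h =>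
    ⟨map_pos_of_pos μ (fun ω => (A ω, C ω)) h, map_pos_of_pos μ C h,
      map_pos_of_pos μ (fun ω => (A ω, B ω, C ω)) h, map_pos_of_pos μ (fun ω => (B ω, C ω)) h⟩
  have hsum : ∑ ω, (μ ω).toReal * (pAC ω * pBC ω / (pC ω * pABC ω)) ≤ 1 := by
    rw [← sum_map_mul μ (fun ω => (A ω, B ω, C ω)) (fun x =>
      ((μ.map fun ω => (A ω, C ω)) (x.1, x.2.2)).toReal *
        ((μ.map fun ω => (B ω, C ω)) (x.2.1, x.2.2)).toReal /
          (((μ.map C) x.2.2).toReal * ((μ.map fun ω => (A ω, B ω, C ω)) (x.1, x.2.1, x.2.2)).toReal))]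
    have hle : ∀ x : α × β × γ, ((μ.map fun ω => (A ω, B ω, C ω)) x).toReal *
        (((μ.map fun ω => (A ω, C ω)) (x.1, x.2.2)).toReal *
        ((μ.map fun ω => (B ω, C ω)) (x.2.1, x.2.2)).toReal /
          (((μ.map C) x.2.2).toReal *
            ((μ.map fun ω => (A ω, B ω, C ω)) (x.1, x.2.1, x.2.2)).toReal))
        ≤ ((μ.map fun ω => (A ω, C ω)) (x.1, x.2.2)).toReal *
        ((μ.map fun ω => (B ω, C ω)) (x.2.1, x.2.2)).toReal / ((μ.map C) x.2.2).toReal := by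
      intro x
      set q := ((μ.map fun ω => (A ω, B ω, C ω)) x).toReal
      by_cases hq : q = 0
      · rw [hq, zero_mul]; positivity
      · refine le_of_eq ?_
        field_simp
    refine (Finset.sum_le_sum fun x _ => hle x).trans ?_
    simp_rw [Fintype.sum_prod_type]
    rw [Finset.sum_comm]
    have h1 : ∀ b, ∑ a, ∑ c, ((μ.map fun ω => (A ω, C ω)) (a, c)).toReal *
        ((μ.map fun ω => (B ω, C ω)) (b, c)).toReal / ((μ.map C) c).toReal
        = ∑ c, ((μ.map fun ω => (B ω, C ω)) (b, c)).toReal *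
          (((μ.map C) c).toReal / ((μ.map C) c).toReal) := by
      intro b
      rw [Finset.sum_comm]
      refine Finset.sum_congr rfl fun c _ => ?_
      rw [← sum_map_pair_left μ A C c, Finset.sum_div, Finset.mul_sum]
      exact Finset.sum_congr rfl fun a _ => by ring
    simp_rw [h1]
    -- Only an inequality, because p(c)/p(c) is 0 where p(c) = 0.
    calc _ ≤ ∑ b, ∑ c, ((μ.map fun ω => (B ω, C ω)) (b, c)).toReal :=
          Finset.sum_le_sum fun b _ => Finset.sum_le_sum fun c _ =>
            mul_le_of_le_one_right ENNReal.toReal_nonneg (div_self_le_one _)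
      _ = 1 := by
          rw [← Fintype.sum_prod_type' (f := fun b c =>
            ((μ.map fun ω => (B ω, C ω)) (b, c)).toReal)]
          exact pmf_sum_toReal _
  have := sum_mul_logb_nonpos (fun ω => ENNReal.toReal_nonneg) (pmf_sum_toReal μ)
    (fun ω h => by obtain ⟨h1, h2, h3, h4⟩ := pos ω h; positivity) hsum
  have e : condMutualInfo μ A B C
      = -∑ ω, (μ ω).toReal * Real.logb 2 (pAC ω * pBC ω / (pC ω * pABC ω)) := by
    simp only [condMutualInfo, condEntropy, rvEntropy_eq]
    rw [← Finset.sum_sub_distrib, ← Finset.sum_sub_distrib, ← Finset.sum_sub_distrib,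
      ← Finset.sum_neg_distrib]
    refine Finset.sum_congr rfl fun ω _ => ?_
    rcases (ENNReal.toReal_nonneg (a := μ ω)).eq_or_lt with h0 | h0
    · simp [← h0]
    · obtain ⟨h1, h2, h3, h4⟩ := pos ω h0
      rw [Real.logb_div (by positivity) (by positivity), Real.logb_mul h1.ne' h4.ne',
        Real.logb_mul h2.ne' h3.ne']
      ring
  rw [e]; linarith

lemma mutualInfo_nonneg (μ : PMF Ω) (A : Ω → α) (B : Ω → β) : 0 ≤ mutualInfo μ A B := by
  have h := condMutualInfo_nonneg μ A B (fun _ => ())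
  have h0 : rvEntropy μ (fun _ => ()) = 0 := by
    rw [rvEntropy_eq]
    refine Finset.sum_eq_zero fun ω _ => ?_
    have : ((μ.map fun _ => ()) ()).toReal = 1 := by
      have := pmf_sum_toReal (μ.map fun _ => ())
      simpa using this
    rw [this]; simp
  have h1 : rvEntropy μ (fun ω => (A ω, ())) = rvEntropy μ A :=
    rvEntropy_of_injective μ A (f := fun a => (a, ())) fun _ _ h => (Prod.ext_iff.mp h).1
  have h2 : rvEntropy μ (fun ω => (B ω, ())) = rvEntropy μ B :=
    rvEntropy_of_injective μ B (f := fun a => (a, ())) fun _ _ h => (Prod.ext_iff.mp h).1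
  have h3 : rvEntropy μ (fun ω => (A ω, B ω, ())) = rvEntropy μ (fun ω => (A ω, B ω)) :=
    rvEntropy_of_injective μ (fun ω => (A ω, B ω)) (f := fun x => (x.1, x.2, ()))
      fun x y h => by
        simp only [Prod.mk.injEq, and_true] at h
        exact Prod.ext h.1 h.2
  simp only [condMutualInfo, condEntropy, h0, h1, h2, h3] at h
  simp only [mutualInfo, condEntropy]
  linarith

lemma rvEntropy_le_of_comp (μ : PMF Ω) (A : Ω → α) (f : α → β) :
    rvEntropy μ (fun ω => f (A ω)) ≤ rvEntropy μ A := by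
  rw [rvEntropy_eq, rvEntropy_eq]
  refine Finset.sum_le_sum fun ω _ => ?_
  rcases (ENNReal.toReal_nonneg (a := μ ω)).eq_or_lt with h0 | h0
  · simp [← h0]
  · refine mul_le_mul_of_nonneg_left (neg_le_neg ?_) h0.le
    exact Real.logb_le_logb_of_le (by norm_num) (map_pos_of_pos μ A h0) (toReal_map_le_map μ A f _)

/-- Jensen's inequality for the ratio of the uniform law to the law of A. -/
lemma rvEntropy_le_logb_card (μ : PMF Ω) (A : Ω → α) :
    rvEntropy μ A ≤ Real.logb 2 (Fintype.card α) := by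
  have hne : Nonempty α := by
    obtain ⟨ω, -⟩ := μ.support_nonempty
    exact ⟨A ω⟩
  have hc : (0 : ℝ) < Fintype.card α := by exact_mod_cast Fintype.card_pos
  have hsum : ∑ ω, (μ ω).toReal * (1 / (Fintype.card α * ((μ.map A) (A ω)).toReal)) ≤ 1 := by
    rw [← sum_map_mul μ A (fun a => 1 / (Fintype.card α * ((μ.map A) a).toReal))]
    calc _ ≤ ∑ a : α, 1 / (Fintype.card α : ℝ) := by
          refine Finset.sum_le_sum fun a _ => ?_
          by_cases h : ((μ.map A) a).toReal = 0
          · rw [h]; simp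
          · exact le_of_eq (by field_simp)
      _ = 1 := by simp [hc.ne']
  have := sum_mul_logb_nonpos (fun ω => ENNReal.toReal_nonneg) (pmf_sum_toReal μ)
    (fun ω h => by have := map_pos_of_pos μ A h; positivity) hsum
  have e : ∑ ω, (μ ω).toReal * Real.logb 2 (1 / (Fintype.card α * ((μ.map A) (A ω)).toReal))
      = rvEntropy μ A - Real.logb 2 (Fintype.card α) := by
    have hl : Real.logb 2 (Fintype.card α : ℝ)
        = ∑ ω, (μ ω).toReal * Real.logb 2 (Fintype.card α : ℝ) := by
      rw [← Finset.sum_mul, pmf_sum_toReal, one_mul]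
    rw [rvEntropy_eq, hl, ← Finset.sum_sub_distrib]
    refine Finset.sum_congr rfl fun ω _ => ?_
    rcases (ENNReal.toReal_nonneg (a := μ ω)).eq_or_lt with h0 | h0
    · simp [← h0]
    · rw [one_div, Real.logb_inv, Real.logb_mul hc.ne' (map_pos_of_pos μ A h0).ne']; ring
  linarith

/-- The Markov property in product form: taking logarithms of the factorization on the support and
averaging yields I(A;C|B) = 0 as an identity of entropies. -/
lemma rvEntropy_markov (μ : PMF Ω) (A : Ω → α) (B : Ω → β) (C : Ω → γ)
    (h : ∀ ω, 0 < (μ ω).toReal →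
      ((μ.map fun ω => (A ω, B ω, C ω)) (A ω, B ω, C ω)).toReal * ((μ.map B) (B ω)).toReal
        = ((μ.map fun ω => (A ω, B ω)) (A ω, B ω)).toReal *
          ((μ.map fun ω => (B ω, C ω)) (B ω, C ω)).toReal) :
    rvEntropy μ (fun ω => (A ω, B ω, C ω)) + rvEntropy μ B
      = rvEntropy μ (fun ω => (A ω, B ω)) + rvEntropy μ (fun ω => (B ω, C ω)) := by
  simp only [rvEntropy_eq]
  rw [← Finset.sum_add_distrib, ← Finset.sum_add_distrib]
  refine Finset.sum_congr rfl fun ω _ => ?_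
  rcases (ENNReal.toReal_nonneg (a := μ ω)).eq_or_lt with h0 | h0
  · simp [← h0]
  · have h1 := map_pos_of_pos μ (fun ω => (A ω, B ω, C ω)) h0
    have h2 := map_pos_of_pos μ B h0
    have h3 := map_pos_of_pos μ (fun ω => (A ω, B ω)) h0
    have h4 := map_pos_of_pos μ (fun ω => (B ω, C ω)) h0
    have := congrArg (Real.logb 2) (h ω h0)
    rw [Real.logb_mul h1.ne' h2.ne', Real.logb_mul h3.ne' h4.ne'] at this
    rw [← mul_add, ← mul_add]
    congr 1
    linarith

end Entropy

end

section

/-! Privacy amplification by a random balanced function. -/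

section Hash

variable {M : Type*} [Fintype M] [DecidableEq M] {K : ℕ}

/-- By symmetry under transpositions every a ≠ m collides with m for equally many permutations.
Since g is balanced, the total over a ≠ m is |M|/K - 1 for each permutation, so the collision
probability is (|M|/K - 1)/(|M| - 1) ≤ 1/K. Random permutations of a balanced function are therefore
universal and keep the parts of equal size. -/
lemma sum_perm_collision_le (g : M → Fin K)
    (hg : ∀ k, ∑ a, ind (g a = k) = (Fintype.card M : ℝ) / K) {m m' : M} (hm : m ≠ m') :
    ∑ π : Equiv.Perm M, ind (g (π m) = g (π m')) ≤ (Fintype.card (Equiv.Perm M) : ℝ) / K := by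
  have hK : 0 < K := (g m).pos
  have hK' : (1 : ℝ) ≤ K := by exact_mod_cast hK
  have hconst : ∀ a ∈ Finset.univ.erase m, ∑ π : Equiv.Perm M, ind (g (π m) = g (π a))
      = ∑ π : Equiv.Perm M, ind (g (π m) = g (π m')) := by
    intro a ha
    refine Fintype.sum_equiv (Equiv.mulRight (Equiv.swap a m')) _ _ fun π => ?_
    have h1 : (Equiv.swap a m') m = m :=
      Equiv.swap_apply_of_ne_of_ne (Finset.ne_of_mem_erase ha).symm hm
    simp [Equiv.Perm.mul_apply, h1]
  have hsum : ∑ a ∈ Finset.univ.erase m, ∑ π : Equiv.Perm M, ind (g (π m) = g (π a))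
      = (Fintype.card (Equiv.Perm M) : ℝ) * ((Fintype.card M : ℝ) / K - 1) := by
    rw [Finset.sum_comm]
    have : ∀ π : Equiv.Perm M, ∑ a ∈ Finset.univ.erase m, ind (g (π m) = g (π a))
        = (Fintype.card M : ℝ) / K - 1 := by
      intro π
      have h2 := Finset.add_sum_erase Finset.univ (fun a => ind (g (π m) = g (π a)))
        (Finset.mem_univ m)
      have h3 : ∑ a, ind (g (π m) = g (π a)) = (Fintype.card M : ℝ) / K := by
        rw [← hg (g (π m)), ← Equiv.sum_comp π fun a => ind (g a = g (π m))]
        exact Finset.sum_congr rfl fun a _ => by congr 1; exact propext eq_comm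
      rw [h3] at h2
      simp only [ind_true] at h2
      linarith
    simp only [this, Finset.sum_const, Finset.card_univ, nsmul_eq_mul]
  rw [Finset.sum_congr rfl hconst, Finset.sum_const, nsmul_eq_mul,
    Finset.card_erase_of_mem (Finset.mem_univ m), Finset.card_univ] at hsum
  have hM : 1 < Fintype.card M := Fintype.one_lt_card_iff.mpr ⟨m, m', hm⟩
  rw [Nat.cast_sub hM.le, Nat.cast_one] at hsum
  have hM' : (0 : ℝ) < (Fintype.card M : ℝ) - 1 := by
    have : (1 : ℝ) < Fintype.card M := by exact_mod_cast hM
    linarith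
  refine le_of_mul_le_mul_left ?_ hM'
  rw [hsum, mul_div_left_comm]
  refine mul_le_mul_of_nonneg_left ?_ (by positivity)
  rw [sub_div]
  have : (1 : ℝ) / K ≤ 1 := by rw [div_le_one (by linarith)]; exact hK'
  linarith

lemma sum_centered_ind (a b : Fin K) :
    ∑ k, (ind (a = k) - 1 / K) * (ind (b = k) - 1 / K) = ind (a = b) - 1 / (K : ℝ) := by
  have hK : (K : ℝ) ≠ 0 := by exact_mod_cast a.pos.ne'
  have h1 := sum_ind_eq_mul a (fun k => ind (b = k))
  have h2 := sum_ind_eq_mul a (fun _ => (1 : ℝ))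
  have h3 := sum_ind_eq_mul b (fun _ => (1 : ℝ))
  simp only [mul_one] at h2 h3
  have e : ∀ k : Fin K, (ind (a = k) - 1 / (K : ℝ)) * (ind (b = k) - 1 / K)
      = ind (a = k) * ind (b = k) - 1 / K * ind (a = k) - 1 / K * ind (b = k)
        + 1 / K * (1 / K) := fun k => by ring
  simp_rw [e]
  rw [Finset.sum_add_distrib, Finset.sum_sub_distrib, Finset.sum_sub_distrib, ← Finset.mul_sum,
    ← Finset.mul_sum, h1, h2, h3, Finset.sum_const, Finset.card_univ, Fintype.card_fin,
    nsmul_eq_mul, show ind (b = a) = ind (a = b) from congrArg ind (propext eq_comm)]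
  field_simp
  ring

/-- Expanding the square, the off-diagonal terms are nonpositive on average because collisions have
probability at most 1/K; the diagonal is at most ∑ R². -/
lemma sum_perm_hash_sq_le (g : M → Fin K)
    (hg : ∀ k, ∑ a, ind (g a = k) = (Fintype.card M : ℝ) / K) {R : M → ℝ} (hR : ∀ m, 0 ≤ R m) :
    ∑ π : Equiv.Perm M, ∑ k, (∑ m, (ind (g (π m) = k) - 1 / K) * R m) ^ 2
      ≤ Fintype.card (Equiv.Perm M) * ∑ m, R m ^ 2 := by
  have h1 : ∀ π : Equiv.Perm M, ∑ k, (∑ m, (ind (g (π m) = k) - 1 / K) * R m) ^ 2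
      = ∑ m, ∑ m', R m * R m' * (ind (g (π m) = g (π m')) - 1 / K) := by
    intro π
    simp_rw [sq, Finset.sum_mul_sum]
    rw [Finset.sum_comm]
    refine Finset.sum_congr rfl fun m _ => ?_
    rw [Finset.sum_comm]
    refine Finset.sum_congr rfl fun m' _ => ?_
    rw [← sum_centered_ind, Finset.mul_sum]
    exact Finset.sum_congr rfl fun k _ => by ring
  simp_rw [h1]
  rw [Finset.sum_comm, Finset.mul_sum]
  refine Finset.sum_le_sum fun m _ => ?_
  rw [Finset.sum_comm]
  have hK : (0 : ℝ) ≤ 1 / K := by positivity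
  have h2 : ∀ m', ∑ π : Equiv.Perm M, R m * R m' * (ind (g (π m) = g (π m')) - 1 / K)
      ≤ if m = m' then Fintype.card (Equiv.Perm M) * R m ^ 2 else 0 := by
    intro m'
    rw [← Finset.mul_sum, Finset.sum_sub_distrib, Finset.sum_const, Finset.card_univ,
      nsmul_eq_mul]
    split_ifs with h
    · subst h
      simp only [ind_true, Finset.sum_const, Finset.card_univ, nsmul_eq_mul, mul_one]
      have : (Fintype.card (Equiv.Perm M) : ℝ) - Fintype.card (Equiv.Perm M) * (1 / K)
          ≤ Fintype.card (Equiv.Perm M) := by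
        have : (0 : ℝ) ≤ Fintype.card (Equiv.Perm M) * (1 / K) := by positivity
        linarith
      have h3 := mul_le_mul_of_nonneg_left this (mul_nonneg (hR m) (hR m))
      nlinarith
    · refine mul_nonpos_of_nonneg_of_nonpos (mul_nonneg (hR m) (hR m')) ?_
      have := sum_perm_collision_le g hg h
      rw [mul_one_div]; linarith
  refine (Finset.sum_le_sum fun m' _ => h2 m').trans_eq ?_
  simp

/-- The leftover hash lemma for balanced functions. -/
lemma exists_perm_hash {E : Type*} [Fintype E] (g : M → Fin K)
    (hg : ∀ k, ∑ a, ind (g a = k) = (Fintype.card M : ℝ) / K)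
    {R : M → E → ℝ} (hR : ∀ m z, 0 ≤ R m z) {σ : E → ℝ} (hσ0 : ∀ z, 0 ≤ σ z)
    (hσ : ∑ z, σ z ≤ 1) {κ : ℝ} (hκ0 : 0 ≤ κ) (hκ : ∀ m z, R m z ≤ κ * σ z)
    (hmass : ∑ m, ∑ z, R m z ≤ 2) :
    ∃ π : Equiv.Perm M,
      ∑ k, ∑ z, |∑ m, ind (g (π m) = k) * R m z - (∑ m, R m z) / K| ≤ √(2 * K * κ) := by
  set D : Equiv.Perm M → Fin K → E → ℝ := fun π k z => ∑ m, (ind (g (π m) = k) - 1 / K) * R m z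
    with hD
  have hDe : ∀ π k z, ∑ m, ind (g (π m) = k) * R m z - (∑ m, R m z) / K = D π k z := by
    intro π k z
    simp only [hD, sub_mul]
    rw [Finset.sum_sub_distrib, Finset.sum_div]
    simp_rw [one_div, inv_mul_eq_div]
  have hσR : ∀ z, σ z = 0 → ∀ m, R m z = 0 := fun z hz m =>
    le_antisymm (by simpa [hz] using hκ m z) (hR m z)
  -- The bound R ≤ κσ turns R²/σ into κR. Where σ vanishes the quotient is 0 and so are R and D.
  have hz : ∀ z, ∑ π : Equiv.Perm M, (∑ k, D π k z ^ 2) / σ z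
      ≤ Fintype.card (Equiv.Perm M) * (κ * ∑ m, R m z) := by
    intro z
    rcases (hσ0 z).eq_or_lt with h0 | h0
    · rw [← h0]; simp only [div_zero, Finset.sum_const_zero]
      exact mul_nonneg (by positivity) (mul_nonneg hκ0 (Finset.sum_nonneg fun m _ => hR m z))
    · rw [← Finset.sum_div, div_le_iff₀ h0]
      refine (sum_perm_hash_sq_le g hg (fun m => hR m z)).trans ?_
      rw [mul_assoc]
      refine mul_le_mul_of_nonneg_left ?_ (by positivity)
      rw [Finset.mul_sum, Finset.sum_mul]
      refine Finset.sum_le_sum fun m _ => ?_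
      nlinarith [hκ m z, hR m z]
  have hcard : (0 : ℝ) < Fintype.card (Equiv.Perm M) := by exact_mod_cast Fintype.card_pos
  obtain ⟨π, -, hπ⟩ := exists_of_weighted_sum_le
    (p := fun _ : Equiv.Perm M => 1 / (Fintype.card (Equiv.Perm M) : ℝ))
    (X := fun π => ∑ z, (∑ k, D π k z ^ 2) / σ z) (fun _ => by positivity)
    (by simp [hcard.ne']) (θ := 2 * κ) (by
      rw [← Finset.mul_sum, Finset.sum_comm, one_div, inv_mul_le_iff₀ hcard]
      refine (Finset.sum_le_sum fun z _ => hz z).trans ?_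
      rw [← Finset.mul_sum, ← Finset.mul_sum, Finset.sum_comm]
      refine mul_le_mul_of_nonneg_left ?_ hcard.le
      nlinarith)
  refine ⟨π, ?_⟩
  simp_rw [hDe]
  refine Real.le_sqrt_of_sq_le ?_
  rw [← Fintype.sum_prod_type' (f := fun k z => |D π k z|)]
  -- Cauchy–Schwarz with weight σ: the weights sum to at most K over pairs (k, z), and the weighted
  -- squares to at most 2κ for the chosen permutation.
  have cs := Finset.sum_mul_sq_le_sq_mul_sq (Finset.univ : Finset (Fin K × E))
    (fun x => √(σ x.2)) (fun x => |D π x.1 x.2| / √(σ x.2))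
  have e1 : ∀ x : Fin K × E, √(σ x.2) * (|D π x.1 x.2| / √(σ x.2)) = |D π x.1 x.2| := by
    intro x
    rcases (hσ0 x.2).eq_or_lt with h0 | h0
    · have : D π x.1 x.2 = 0 :=
        Finset.sum_eq_zero fun m _ => by rw [hσR x.2 h0.symm m, mul_zero]
      rw [this]; simp
    · exact mul_div_cancel₀ _ (Real.sqrt_pos.mpr h0).ne'
  have e2 : ∀ x : Fin K × E, (|D π x.1 x.2| / √(σ x.2)) ^ 2 = D π x.1 x.2 ^ 2 / σ x.2 := by
    intro x; rw [div_pow, sq_abs, Real.sq_sqrt (hσ0 _)]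
  simp_rw [e1, e2, fun x : Fin K × E => Real.sq_sqrt (hσ0 x.2)] at cs
  refine cs.trans ?_
  have e3 : ∑ x : Fin K × E, σ x.2 ≤ K := by
    rw [Fintype.sum_prod_type]
    simp only [Finset.sum_const, Finset.card_univ, Fintype.card_fin, nsmul_eq_mul]
    exact mul_le_of_le_one_right (by positivity) hσ
  have e4 : ∑ x : Fin K × E, D π x.1 x.2 ^ 2 / σ x.2 ≤ 2 * κ := by
    rw [Fintype.sum_prod_type, Finset.sum_comm]
    simp_rw [← Finset.sum_div]
    exact hπ
  have e5 : 0 ≤ ∑ x : Fin K × E, D π x.1 x.2 ^ 2 / σ x.2 :=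
    Finset.sum_nonneg fun x _ => div_nonneg (sq_nonneg _) (hσ0 _)
  calc _ ≤ (K : ℝ) * (2 * κ) := mul_le_mul e3 e4 e5 (by positivity)
    _ = _ := by ring

end Hash

/-! Equivocation of a nearly uniform and nearly independent key. -/

/-- Where P(a,z) ≤ 4 P(z)/K, the conditional surprisal of a given z is at least log K - 2; elsewhere
it is still nonnegative. It remains to see that the exceptional pairs have mass at most 5θ: NULL
accounts for θ and the key values for 4θ. -/
lemma condEntropy_ge {Ω E : Type*} [Fintype Ω] [Fintype E] {K : ℕ} (hK : 4 ≤ K) (ρ : PMF Ω)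
    (A : Ω → Option (Fin K)) (Z : Ω → E) (ν : E → ℝ) {θ : ℝ}
    (h1 : ∑ k, ∑ z, |((ρ.map fun ω => (A ω, Z ω)) (some k, z)).toReal - ν z / K| ≤ θ)
    (h2 : ∑ z, ((ρ.map fun ω => (A ω, Z ω)) (none, z)).toReal ≤ θ) :
    (1 - 5 * θ) * (Real.logb 2 K - 2) ≤ condEntropy ρ A Z := by
  have hK0 : (0 : ℝ) < K := by have : (4 : ℝ) ≤ K := by exact_mod_cast hK
                               linarith
  set P : Option (Fin K) → E → ℝ := fun a z => ((ρ.map fun ω => (A ω, Z ω)) (a, z)).toReal with hP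
  set PZ : E → ℝ := fun z => ((ρ.map Z) z).toReal with hPZ
  have hP0 : ∀ a z, 0 ≤ P a z := fun _ _ => ENNReal.toReal_nonneg
  have hPZs : ∀ z, PZ z = P none z + ∑ k, P (some k) z := fun z => by
    rw [← Fintype.sum_option (f := fun a => P a z)]
    exact (sum_map_pair_left ρ A Z z).symm
  have hPle : ∀ a z, P a z ≤ PZ z := fun a z => by
    change P a z ≤ ((ρ.map Z) z).toReal
    rw [← sum_map_pair_left ρ A Z z]
    exact Finset.single_le_sum (f := fun a => P a z) (fun a _ => hP0 a z) (Finset.mem_univ a)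
  have hPsum : ∑ a, ∑ z, P a z = 1 := by
    rw [← Fintype.sum_prod_type' (f := P)]
    exact pmf_sum_toReal (ρ.map fun ω => (A ω, Z ω))
  have hce : condEntropy ρ A Z
      = ∑ a, ∑ z, P a z * (Real.logb 2 (PZ z) - Real.logb 2 (P a z)) := by
    rw [condEntropy, rvEntropy_eq, rvEntropy_eq, ← Finset.sum_sub_distrib,
      ← Fintype.sum_prod_type' (f := fun a z => P a z * (Real.logb 2 (PZ z) - Real.logb 2 (P a z))),
      sum_map_mul ρ (fun ω => (A ω, Z ω))
        (fun x => Real.logb 2 (PZ x.2) - Real.logb 2 (P x.1 x.2))]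
    exact Finset.sum_congr rfl fun ω _ => by simp only [hP, hPZ]; ring
  have hlog : 0 ≤ Real.logb 2 K - 2 := by
    have : Real.logb 2 4 ≤ Real.logb 2 K :=
      Real.logb_le_logb_of_le (by norm_num) (by norm_num) (by exact_mod_cast hK)
    have h4 : Real.logb 2 4 = 2 := by
      rw [show (4 : ℝ) = 2 ^ (2 : ℝ) by norm_num]
      exact Real.logb_rpow (by norm_num) (by norm_num)
    linarith
  have hlow : ∀ a z, P a z * ind (P a z ≤ 4 * PZ z / K) * (Real.logb 2 K - 2)
      ≤ P a z * (Real.logb 2 (PZ z) - Real.logb 2 (P a z)) := by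
    intro a z
    rcases (hP0 a z).eq_or_lt with h0 | h0
    · simp [← h0]
    · have hz : 0 < PZ z := h0.trans_le (hPle a z)
      rw [mul_assoc]
      refine mul_le_mul_of_nonneg_left ?_ h0.le
      by_cases h : P a z ≤ 4 * PZ z / K
      · rw [ind_true h, one_mul]
        have := Real.logb_le_logb_of_le (b := 2) (by norm_num) h0 h
        have h4 : Real.logb 2 4 = 2 := by
          rw [show (4 : ℝ) = 2 ^ (2 : ℝ) by norm_num]
          exact Real.logb_rpow (by norm_num) (by norm_num)
        rw [Real.logb_div (by positivity) hK0.ne', Real.logb_mul (by norm_num) hz.ne', h4] at this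
        linarith
      · rw [ind_false h, zero_mul]
        have := Real.logb_le_logb_of_le (b := 2) (by norm_num) h0 (hPle a z)
        linarith
  have hν : ∑ z, |ν z - PZ z| ≤ 2 * θ := by
    have : ∀ z, |ν z - PZ z| ≤ ∑ k, |P (some k) z - ν z / K| + P none z := by
      intro z
      have e : ν z - PZ z = -(∑ k, (P (some k) z - ν z / K) + P none z) := by
        rw [hPZs, Finset.sum_sub_distrib, Finset.sum_const, Finset.card_univ, Fintype.card_fin,
          nsmul_eq_mul, mul_div_cancel₀ _ hK0.ne']
        ring
      rw [e, abs_neg]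
      refine (abs_add_le _ _).trans (add_le_add (Finset.abs_sum_le_sum_abs _ _) ?_)
      rw [abs_of_nonneg (hP0 _ _)]
    refine (Finset.sum_le_sum fun z _ => this z).trans ?_
    rw [Finset.sum_add_distrib, Finset.sum_comm]
    linarith
  -- If P > 4 P(z)/K, then P - P(z)/K exceeds 3P/4. The deviations from P(z)/K sum to at most 3θ: θ
  -- from ν/K and 2θ from replacing ν by the law of Z. Multiplying by 4/3 gives 4θ.
  have hbad : ∀ k z, P (some k) z * (1 - ind (P (some k) z ≤ 4 * PZ z / K))
      ≤ 4 / 3 * (|P (some k) z - ν z / K| + |ν z - PZ z| / K) := by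
    intro k z
    have habs : |P (some k) z - PZ z / K| ≤ |P (some k) z - ν z / K| + |ν z - PZ z| / K := by
      have := abs_sub_le (P (some k) z) (ν z / K) (PZ z / K)
      rw [← sub_div, abs_div, abs_of_pos hK0] at this
      exact this
    by_cases h : P (some k) z ≤ 4 * PZ z / K
    · rw [ind_true h, sub_self, mul_zero]; positivity
    · rw [ind_false h, sub_zero, mul_one]
      have h3 := le_abs_self (P (some k) z - PZ z / K)
      have h4 : 4 * (PZ z / K) < P (some k) z := by rw [← mul_div_assoc]; exact not_le.mp h
      linarith
  have hmass : 1 - 5 * θ ≤ ∑ a, ∑ z, P a z * ind (P a z ≤ 4 * PZ z / K) := by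
    have : ∑ a, ∑ z, P a z * (1 - ind (P a z ≤ 4 * PZ z / K)) ≤ 5 * θ := by
      rw [Fintype.sum_option]
      have hn : ∑ z, P none z * (1 - ind (P none z ≤ 4 * PZ z / K)) ≤ θ :=
        (Finset.sum_le_sum fun z _ => mul_le_of_le_one_right (hP0 _ _)
          (by linarith [ind_nonneg (P none z ≤ 4 * PZ z / K)])).trans h2
      have hs : ∑ k, ∑ z, P (some k) z * (1 - ind (P (some k) z ≤ 4 * PZ z / K)) ≤ 4 * θ := by
        refine (Finset.sum_le_sum fun k _ => Finset.sum_le_sum fun z _ => hbad k z).trans ?_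
        simp_rw [← Finset.mul_sum, Finset.sum_add_distrib]
        rw [Finset.sum_const, Finset.card_univ, Fintype.card_fin, nsmul_eq_mul, ← Finset.sum_div,
          mul_div_cancel₀ _ hK0.ne']
        linarith
      linarith
    simp_rw [mul_sub, mul_one, Finset.sum_sub_distrib] at this
    rw [hPsum] at this
    linarith
  rw [hce]
  calc (1 - 5 * θ) * (Real.logb 2 K - 2)
      ≤ (∑ a, ∑ z, P a z * ind (P a z ≤ 4 * PZ z / K)) * (Real.logb 2 K - 2) :=
        mul_le_mul_of_nonneg_right hmass hlog
    _ = ∑ a, ∑ z, P a z * ind (P a z ≤ 4 * PZ z / K) * (Real.logb 2 K - 2) := by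
        rw [Finset.sum_mul]; simp_rw [Finset.sum_mul]
    _ ≤ _ := Finset.sum_le_sum fun a _ => Finset.sum_le_sum fun z _ => hlow a z

lemma toOuterMeasure_le_ofReal {Ω : Type*} [Fintype Ω] (μ : PMF Ω) (S : Set Ω) {θ : ℝ}
    (h : ∑ ω, (μ ω).toReal * ind (ω ∈ S) ≤ θ) : μ.toOuterMeasure S ≤ ENNReal.ofReal θ := by
  classical
  rw [PMF.toOuterMeasure_apply_fintype]
  have hne : ∀ ω ∈ Finset.univ, S.indicator μ ω ≠ ∞ := fun ω _ => by
    by_cases hω : ω ∈ S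
    · rw [Set.indicator_of_mem hω]; exact μ.apply_ne_top ω
    · rw [Set.indicator_of_notMem hω]; simp
  rw [← ENNReal.ofReal_toReal (ENNReal.sum_ne_top.mpr hne), ENNReal.toReal_sum hne]
  refine ENNReal.ofReal_le_ofReal (le_trans (le_of_eq ?_) h)
  refine Finset.sum_congr rfl fun ω _ => ?_
  by_cases hω : ω ∈ S
  · rw [Set.indicator_of_mem hω, ind_true hω, mul_one]
  · rw [Set.indicator_of_notMem hω, ind_false hω]; simp

/-- If the law `Λ` of a run is close to a weight `Q` that lives on agreeing messages, and the
eavesdropper's likelihoods under `Q` are bounded, then some balanced function of the message is a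
good key. -/
theorem exists_secure_key {Ω E M : Type*} [Fintype Ω] [Fintype E] [Fintype M] [DecidableEq M]
    {K : ℕ} (hK : 4 ≤ K) (Λ : PMF Ω) (m m' : Ω → Option M) (Z : Ω → E) {Q : Ω → ℝ}
    (hQ0 : ∀ ω, 0 ≤ Q ω) (hQ : ∀ ω, Q ω ≠ 0 → ∃ a, m ω = some a ∧ m' ω = some a)
    {θ : ℝ} (hθ1 : θ ≤ 1) (hθ : ∑ ω, |(Λ ω).toReal - Q ω| ≤ θ)
    {σ : E → ℝ} (hσ0 : ∀ z, 0 ≤ σ z) (hσ : ∑ z, σ z ≤ 1) {κ : ℝ} (hκ0 : 0 ≤ κ)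
    (hκ : ∀ a z, ∑ ω, Q ω * ind (m ω = some a ∧ Z ω = z) ≤ κ * σ z)
    (g : M → Fin K) (hg : ∀ k, ∑ a, ind (g a = k) = (Fintype.card M : ℝ) / K) :
    ∃ π : Equiv.Perm M,
      (Λ.map fun ω => ((m ω).map fun a => g (π a), (m' ω).map fun a => g (π a), Z ω)).toOuterMeasure
        {ω | ¬ ∃ k, ω.1 = some k ∧ ω.2.1 = some k} ≤ ENNReal.ofReal θ ∧
      (1 - 5 * (θ + √(2 * K * κ))) * (Real.logb 2 K - 2) ≤
        condEntropy
          (Λ.map fun ω => ((m ω).map fun a => g (π a), (m' ω).map fun a => g (π a), Z ω))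
          (fun ω => ω.1) (fun ω => ω.2.2) := by
  set R : M → E → ℝ := fun a z => ∑ ω, Q ω * ind (m ω = some a ∧ Z ω = z) with hR
  have hR0 : ∀ a z, 0 ≤ R a z := fun a z =>
    Finset.sum_nonneg fun ω _ => mul_nonneg (hQ0 ω) (ind_nonneg _)
  have hmR : ∀ (ω : Ω) (φ : M → ℝ) (z : E), (∀ a, 0 ≤ φ a) →
      ∑ a, φ a * ind (m ω = some a ∧ Z ω = z)
        = (match m ω with | some a => φ a | none => 0) * ind (Z ω = z) := by
    intro ω φ z _
    cases hm : m ω with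
    | none => simp [ind]
    | some b =>
      have : ∀ a, φ a * ind (some b = some a ∧ Z ω = z) = ind (b = a) * (φ a * ind (Z ω = z)) := by
        intro a
        by_cases h1 : b = a <;> by_cases h2 : Z ω = z <;> simp [ind, h1, h2]
      simp_rw [this]
      rw [sum_ind_eq_mul b fun a => φ a * ind (Z ω = z)]
  -- Q differs from a probability law by at most θ ≤ 1 in total.
  have hmass : ∑ a, ∑ z, R a z ≤ 2 := by
    have h1 : ∑ a, ∑ z, R a z ≤ ∑ ω, Q ω := by
      simp only [hR]
      have : ∀ a, ∑ z, ∑ ω, Q ω * ind (m ω = some a ∧ Z ω = z)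
          = ∑ ω, Q ω * ind (m ω = some a) := by
        intro a
        rw [Finset.sum_comm]
        refine Finset.sum_congr rfl fun ω _ => ?_
        rw [← Finset.mul_sum]
        congr 1
        have e : ∀ z, ind (m ω = some a ∧ Z ω = z) = ind (Z ω = z) * ind (m ω = some a) := by
          intro z
          by_cases h1 : m ω = some a <;> by_cases h2 : Z ω = z <;> simp [ind, h1, h2]
        simp_rw [e]
        rw [sum_ind_eq_mul (Z ω) fun _ => ind (m ω = some a)]
      simp_rw [this]
      rw [Finset.sum_comm]
      refine Finset.sum_le_sum fun ω _ => ?_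
      rw [← Finset.mul_sum]
      refine mul_le_of_le_one_right (hQ0 ω) ?_
      cases hm : m ω with
      | none => simp [ind]
      | some b =>
        have : ∀ a, ind (some b = some a) = ind (b = a) * 1 := fun a => by simp [ind]
        simp_rw [this]
        rw [sum_ind_eq_mul b fun _ => (1 : ℝ)]
    have h2 : ∑ ω, Q ω ≤ ∑ ω, ((Λ ω).toReal + |(Λ ω).toReal - Q ω|) :=
      Finset.sum_le_sum fun ω _ => by linarith [neg_le_abs ((Λ ω).toReal - Q ω)]
    rw [Finset.sum_add_distrib, pmf_sum_toReal] at h2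
    linarith
  obtain ⟨π, hπ⟩ := exists_perm_hash g hg hR0 hσ0 hσ hκ0 hκ hmass
  refine ⟨π, ?_, ?_⟩
  · rw [PMF.toOuterMeasure_map_apply]
    -- Q vanishes on failing runs, so there the probability of a run equals its deviation |Λ - Q|.
    refine toOuterMeasure_le_ofReal _ _ ((Finset.sum_le_sum fun ω _ => ?_).trans hθ)
    by_cases h : Q ω = 0
    · rw [h, sub_zero, abs_of_nonneg ENNReal.toReal_nonneg]
      exact mul_le_of_le_one_right ENNReal.toReal_nonneg (ind_le_one _)
    · obtain ⟨a, h1, h2⟩ := hQ ω h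
      rw [ind_false, mul_zero]
      · exact abs_nonneg _
      · simp only [Set.mem_preimage, Set.mem_ofPred_eq, not_not]
        exact ⟨g (π a), by rw [h1]; rfl, by rw [h2]; rfl⟩
  · set A : Ω → Option (Fin K) := fun ω => (m ω).map fun a => g (π a) with hA
    have e : condEntropy
          (Λ.map fun ω => ((m ω).map fun a => g (π a), (m' ω).map fun a => g (π a), Z ω))
          (fun ω => ω.1) (fun ω => ω.2.2) = condEntropy Λ A Z := by
      simp only [condEntropy, rvEntropy, PMF.map_comp]
      rfl
    rw [e]
    have hsplit : ∀ (a : Option (Fin K)) (z : E) (ω : Ω),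
        ind ((A ω, Z ω) = (a, z)) = ind (A ω = a) * ind (Z ω = z) := by
      intro a z ω
      by_cases h1 : A ω = a <;> by_cases h2 : Z ω = z <;> simp [ind, h1, h2]
    -- The reference ν is the marginal of Q on views. Passing from Λ to Q costs θ, and hashing Q
    -- costs the square root.
    refine condEntropy_ge hK Λ A Z (fun z => ∑ a, R a z) ?_ ?_
    · have hgR : ∀ k z, ∑ a, ind (g (π a) = k) * R a z
          = ∑ ω, Q ω * (ind (A ω = some k) * ind (Z ω = z)) := by
        intro k z
        simp only [hR, Finset.mul_sum]
        rw [Finset.sum_comm]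
        refine Finset.sum_congr rfl fun ω _ => ?_
        simp_rw [mul_left_comm _ (Q ω)]
        rw [← Finset.mul_sum, hmR ω (fun a => ind (g (π a) = k)) z fun a => ind_nonneg _]
        congr 2
        cases hm : m ω with
        | none => simp [ind, hA, hm]
        | some b => simp [ind, hA, hm]
      have hkz : ∀ k z, |((Λ.map fun ω => (A ω, Z ω)) (some k, z)).toReal - (∑ a, R a z) / K|
          ≤ ∑ ω, |(Λ ω).toReal - Q ω| * (ind (A ω = some k) * ind (Z ω = z))
            + |∑ a, ind (g (π a) = k) * R a z - (∑ a, R a z) / K| := by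
        intro k z
        refine (abs_sub_le _ (∑ a, ind (g (π a) = k) * R a z) _).trans (add_le_add ?_ le_rfl)
        rw [toReal_map, hgR, ← Finset.sum_sub_distrib]
        refine (Finset.abs_sum_le_sum_abs _ _).trans_eq ?_
        refine Finset.sum_congr rfl fun ω _ => ?_
        rw [hsplit, ← sub_mul, abs_mul,
          abs_of_nonneg (mul_nonneg (ind_nonneg (A ω = some k)) (ind_nonneg (Z ω = z)))]
      refine (Finset.sum_le_sum fun k _ => Finset.sum_le_sum fun z _ => hkz k z).trans ?_
      simp_rw [Finset.sum_add_distrib]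
      refine add_le_add ?_ hπ
      refine le_trans ?_ hθ
      have : ∀ k, ∑ z, ∑ ω, |(Λ ω).toReal - Q ω| * (ind (A ω = some k) * ind (Z ω = z))
          = ∑ ω, |(Λ ω).toReal - Q ω| * ind (A ω = some k) := by
        intro k
        rw [Finset.sum_comm]
        refine Finset.sum_congr rfl fun ω _ => ?_
        rw [← Finset.mul_sum, ← Finset.mul_sum]
        have := sum_ind_eq_mul (Z ω) (fun _ => (1 : ℝ))
        simp only [mul_one] at this
        rw [this, mul_one]
      simp_rw [this]
      rw [Finset.sum_comm]
      refine Finset.sum_le_sum fun ω _ => ?_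
      rw [← Finset.mul_sum]
      refine mul_le_of_le_one_right (abs_nonneg _) ?_
      cases hm : A ω with
      | none => simp [ind]
      | some b =>
        have : ∀ a, ind (some b = some a) = ind (b = a) * 1 := fun a => by simp [ind]
        simp_rw [this]
        rw [sum_ind_eq_mul b fun _ => (1 : ℝ)]
    · refine le_trans ?_ (le_add_of_nonneg_right (Real.sqrt_nonneg _))
      refine le_trans ?_ hθ
      simp_rw [toReal_map]
      rw [Finset.sum_comm]
      refine Finset.sum_le_sum fun ω _ => ?_
      simp_rw [hsplit]
      rw [← Finset.mul_sum, ← Finset.mul_sum]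
      have := sum_ind_eq_mul (Z ω) (fun _ => (1 : ℝ))
      simp only [mul_one] at this
      rw [this, mul_one]
      by_cases h : Q ω = 0
      · rw [h, sub_zero, abs_of_nonneg ENNReal.toReal_nonneg]
        exact mul_le_of_le_one_right ENNReal.toReal_nonneg (ind_le_one _)
      · obtain ⟨a, h1, -⟩ := hQ ω h
        rw [ind_false (by simp [hA, h1]), mul_zero]
        exact abs_nonneg _

/-- One lower bound h on H(S|E) serves both conditions: H(S) ≥ H(S|E) ≥ h gives the rate, and H(S) ≤
log(|K| + 1) bounds the denominator of the secrecy quotient. The extra 1 counts NULL as a value of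
S. -/
lemma isSecure_of_condEntropy_ge {K E : Type*} [Fintype K] [Fintype E]
    {ρ : PMF (Option K × Option K × E)} {n : ℕ} {R δ h c : ℝ} (hn : 0 < n)
    (herr : ρ.toOuterMeasure {ω | ¬ ∃ k, ω.1 = some k ∧ ω.2.1 = some k} < ENNReal.ofReal δ)
    (hcond : h ≤ condEntropy ρ (fun ω => ω.1) (fun ω => ω.2.2))
    (hcard : Real.logb 2 (Fintype.card K + 1) ≤ c) (hh : 0 < h) (hrate : n * (R - δ) < h)
    (hsec : (1 - δ) * c < h) : IsSecure ρ n R δ := by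
  have hI := mutualInfo_nonneg ρ (fun ω => ω.1) (fun ω => ω.2.2)
  have hH := rvEntropy_le_logb_card ρ (fun ω => ω.1)
  rw [Fintype.card_option, Nat.cast_add, Nat.cast_one] at hH
  rw [mutualInfo] at hI
  have hn' : (0 : ℝ) < n := by exact_mod_cast hn
  refine ⟨?_, herr, fun _ => ?_⟩
  · rw [gt_iff_lt, lt_div_iff₀ hn']
    linarith
  · have hpos : 0 < rvEntropy ρ (fun ω => ω.1) := by linarith
    rw [gt_iff_lt, lt_div_iff₀ hpos]
    rcases le_or_gt (1 - δ) 0 with hd | hd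
    · nlinarith
    · nlinarith

end

section

/-! Uniform labels. Adding an independent uniform label to an auxiliary variable makes codewords
distinct and changes neither typicality nor the information quantities. -/

section Label

variable {α α' β : Type*} {L : ℕ} [NeZero L]

/-- A symbol of law `p` together with a uniform label. -/
def labelPMF (p : PMF α) (e : α × Fin L ≃ α') : PMF α' :=
  p.bind fun a => (PMF.uniformOfFintype (Fin L)).map fun l => e (a, l)

lemma labelPMF_apply (p : PMF α) (e : α × Fin L ≃ α') (a : α') :
    labelPMF p e a = p (e.symm a).1 * (L : ℝ≥0∞)⁻¹ := by
  classical
  rw [labelPMF, PMF.bind_apply, tsum_eq_single (e.symm a).1]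
  · congr 1
    rw [PMF.map_apply, tsum_eq_single (e.symm a).2]
    · simp
    · intro l hl
      rw [if_neg]
      intro h
      exact hl (by rw [h]; simp)
  · intro b hb
    rw [PMF.map_apply, ENNReal.tsum_eq_zero.mpr, mul_zero]
    intro l
    rw [if_neg]
    intro h
    exact hb (by rw [h]; simp)

lemma toReal_labelPMF (p : PMF α) (e : α × Fin L ≃ α') (a : α') :
    (labelPMF p e a).toReal = (p (e.symm a).1).toReal / L := by
  rw [labelPMF_apply, ENNReal.toReal_mul, ENNReal.toReal_inv, ENNReal.toReal_natCast,
    div_eq_mul_inv]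

/-- Labels on the first component of a pair. -/
def labelFst (e : α × Fin L ≃ α') : (α × β) × Fin L ≃ α' × β where
  toFun x := (e (x.1.1, x.2), x.1.2)
  invFun y := (((e.symm y.1).1, y.2), (e.symm y.1).2)
  left_inv x := by simp
  right_inv y := by simp

lemma labelPMF_map_fst (p : PMF (α × β)) (e : α × Fin L ≃ α') :
    (labelPMF p (labelFst e)).map Prod.fst = labelPMF (p.map Prod.fst) e := by
  simp only [labelPMF, PMF.map_bind, PMF.map_comp, PMF.bind_map]
  rfl

lemma labelPMF_map_snd (p : PMF (α × β)) (e : α × Fin L ≃ α') :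
    (labelPMF p (labelFst e)).map Prod.snd = p.map Prod.snd := by
  simp only [labelPMF, PMF.map_bind, PMF.map_comp]
  have : ∀ a : α × β, ((PMF.uniformOfFintype (Fin L)).map
      (Prod.snd ∘ fun l => labelFst e (a, l))) = PMF.pure a.2 := fun a => by
    have : (Prod.snd ∘ fun l => labelFst e (a, l)) = Function.const (Fin L) a.2 := rfl
    rw [this, PMF.map_const]
  simp_rw [this]
  rfl

variable [Fintype α] [Fintype α']

lemma sum_label (e : α × Fin L ≃ α') (φ : α → ℝ) :
    ∑ a, φ (e.symm a).1 = L * ∑ a, φ a := by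
  rw [Equiv.sum_comp e.symm (fun x => φ x.1), Fintype.sum_prod_type, Finset.mul_sum]
  simp

lemma entropy_label (p : PMF α) (e : α × Fin L ≃ α') :
    entropy (labelPMF p e) = entropy p + Real.logb 2 L := by
  have hL : (0 : ℝ) < L := by exact_mod_cast Nat.pos_of_ne_zero (NeZero.ne L)
  rw [entropy_eq, entropy_eq]
  simp_rw [toReal_labelPMF]
  rw [sum_label e fun a => (p a).toReal / L * -Real.logb 2 ((p a).toReal / L), Finset.mul_sum]
  have : ∀ a, (L : ℝ) * ((p a).toReal / L * -Real.logb 2 ((p a).toReal / L))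
      = (p a).toReal * -Real.logb 2 (p a).toReal + (p a).toReal * Real.logb 2 L := by
    intro a
    by_cases h : (p a).toReal = 0
    · simp [h]
    · rw [Real.logb_div h hL.ne']; field_simp; ring
  simp_rw [this]
  rw [Finset.sum_add_distrib, ← Finset.sum_mul, pmf_sum_toReal, one_mul]

omit [Fintype α] [Fintype α'] in
lemma seqProb_label (p : PMF α) (e : α × Fin L ≃ α') {n : ℕ} (u : Fin n → α') :
    seqProb (labelPMF p e) u = seqProb p (fun i => (e.symm (u i)).1) / (L : ℝ) ^ n := by
  simp only [seqProb, toReal_labelPMF, Finset.prod_div_distrib, Finset.prod_const,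
    Finset.card_univ, Fintype.card_fin]

/-- A label adds log L to the entropy and log L per symbol to the negative log-likelihood, and the
two cancel. For n = 0 the empirical term is 0 and nothing cancels, hence `hn`. -/
lemma isTypical_label (p : PMF α) (e : α × Fin L ≃ α') (ε : ℝ) {n : ℕ} (hn : 0 < n)
    (u : Fin n → α') :
    IsTypical (labelPMF p e) ε u ↔ IsTypical p ε (fun i => (e.symm (u i)).1) := by
  have hL : (0 : ℝ) < L := by exact_mod_cast Nat.pos_of_ne_zero (NeZero.ne L)
  have hn' : (0 : ℝ) < n := by exact_mod_cast hn
  unfold IsTypical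
  rw [seqProb_label, entropy_label]
  set q := seqProb p (fun i => (e.symm (u i)).1)
  have h1 : q / (L : ℝ) ^ n ≠ 0 ↔ q ≠ 0 := by
    rw [div_ne_zero_iff]; exact and_iff_left (by positivity)
  rw [h1]
  refine and_congr_right fun hq => ?_
  have h2 : -(1 / (n : ℝ)) * Real.logb 2 (q / (L : ℝ) ^ n) - (entropy p + Real.logb 2 L)
      = -(1 / (n : ℝ)) * Real.logb 2 q - entropy p := by
    rw [Real.logb_div hq (by positivity), Real.logb_pow]
    field_simp
    ring
  rw [h2]

/-- The same cancellation in each of the two blocks. Positive n keeps the normalization by n + d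
meaningful even when d = 0. -/
lemma isBipartiteTypical_label [Fintype β] {β' : Type*} [Fintype β'] {L' : ℕ} [NeZero L']
    (p : PMF α) (e : α × Fin L ≃ α') (q : PMF β) (e' : β × Fin L' ≃ β') (ε : ℝ) {n d : ℕ}
    (hn : 0 < n) (u : Fin n → α') (t : Fin d → β') :
    IsBipartiteTypical (labelPMF p e) (labelPMF q e') ε u t ↔
      IsBipartiteTypical p q ε (fun i => (e.symm (u i)).1) (fun i => (e'.symm (t i)).1) := by
  have hL : (0 : ℝ) < L := by exact_mod_cast Nat.pos_of_ne_zero (NeZero.ne L)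
  have hL' : (0 : ℝ) < L' := by exact_mod_cast Nat.pos_of_ne_zero (NeZero.ne L')
  have hn' : (0 : ℝ) < n := by exact_mod_cast hn
  have hd : (0 : ℝ) ≤ d := by positivity
  unfold IsBipartiteTypical
  rw [seqProb_label, entropy_label, seqProb_label, entropy_label, div_mul_div_comm]
  set r := seqProb p (fun i => (e.symm (u i)).1) * seqProb q (fun i => (e'.symm (t i)).1)
  have h1 : r / ((L : ℝ) ^ n * (L' : ℝ) ^ d) ≠ 0 ↔ r ≠ 0 := by
    rw [div_ne_zero_iff]; exact and_iff_left (by positivity)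
  rw [h1]
  refine and_congr_right fun hr => ?_
  have h2 : -(1 / ((n : ℝ) + d)) * Real.logb 2 (r / ((L : ℝ) ^ n * (L' : ℝ) ^ d))
      - (n * (entropy p + Real.logb 2 L) + d * (entropy q + Real.logb 2 L')) / ((n : ℝ) + d)
      = -(1 / ((n : ℝ) + d)) * Real.logb 2 r - (n * entropy p + d * entropy q) / ((n : ℝ) + d) := by
    clear_value r
    rw [Real.logb_div hr (by positivity), Real.logb_mul (by positivity) (by positivity),
      Real.logb_pow, Real.logb_pow]
    field_simp
    ring
  rw [h2]

end Label

/-- `W` with a uniform label. -/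
def ChannelAux.label {Xb : Type*} (c : ChannelAux Xb) (L : ℕ) [NeZero L] : ChannelAux Xb where
  cardW1 := c.cardW1 * L
  cardW2 := c.cardW2
  lawW2 := c.lawW2
  kernelW1 w := labelPMF (c.kernelW1 w) finProdFinEquiv
  kernelX w := c.kernelX (finProdFinEquiv.symm w).1

/-- `V` with a uniform label. -/
def SourceAux.label {Xf Yf : Type*} (a : SourceAux Xf Yf) (L : ℕ) [NeZero L] :
    SourceAux Xf Yf where
  cardV := a.cardV * L
  lawX := a.lawX
  kernelV y := labelPMF (a.kernelV y) finProdFinEquiv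

section LabelLaws

variable {Xf Yf Zf Xb Yb Zb : Type*} [Fintype Xf] [Fintype Yf] [Fintype Zf] [Fintype Xb]
  [Fintype Yb] [Fintype Zb] {L : ℕ} [NeZero L]

lemma lawV_label (a : SourceAux Xf Yf) (F : DMBC Xf Yf Zf) :
    (a.label L).lawV F = labelPMF (a.lawV F) finProdFinEquiv := by
  simp only [SourceAux.lawV, SourceAux.law, SourceAux.label, labelPMF, PMF.map, PMF.bind_bind,
    PMF.pure_bind, Function.comp_def]

lemma lawVY_label (a : SourceAux Xf Yf) (F : DMBC Xf Yf Zf) :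
    (a.label L).lawVY F = labelPMF (a.lawVY F) (labelFst finProdFinEquiv) := by
  simp only [SourceAux.lawVY, SourceAux.law, SourceAux.label, labelPMF, PMF.map, PMF.bind_bind,
    PMF.pure_bind, Function.comp_def, labelFst, Equiv.coe_fn_mk]

lemma lawVX_label (a : SourceAux Xf Yf) (F : DMBC Xf Yf Zf) :
    (a.label L).lawVX F = labelPMF (a.lawVX F) (labelFst finProdFinEquiv) := by
  simp only [SourceAux.lawVX, SourceAux.law, SourceAux.label, labelPMF, PMF.map, PMF.bind_bind,
    PMF.pure_bind, Function.comp_def, labelFst, Equiv.coe_fn_mk]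

lemma lawW1_label (c : ChannelAux Xb) :
    (c.label L).lawW1 = labelPMF c.lawW1 finProdFinEquiv := by
  simp only [ChannelAux.lawW1, ChannelAux.label, labelPMF, PMF.bind_bind]

lemma lawW1Y_label (c : ChannelAux Xb) (B : DMBC Xb Yb Zb) :
    (c.label L).lawW1Y B = labelPMF (c.lawW1Y B) (labelFst finProdFinEquiv) := by
  -- The label is drawn before the channel is used; since the channel ignores it, the draws commute.
  have h : ∀ (w : Fin c.cardW1) , (c.kernelX w).bind (fun x => (B x).bind fun yz =>
      (PMF.uniformOfFintype (Fin L)).bind fun l => PMF.pure (finProdFinEquiv (w, l), yz.1))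
      = (PMF.uniformOfFintype (Fin L)).bind fun l => (c.kernelX w).bind fun x => (B x).bind
        fun yz => PMF.pure (finProdFinEquiv (w, l), yz.1) := by
    intro w
    rw [PMF.bind_comm (PMF.uniformOfFintype (Fin L))]
    congr 1
    funext x
    rw [PMF.bind_comm (PMF.uniformOfFintype (Fin L))]
  simp only [ChannelAux.lawW1Y, ChannelAux.law, ChannelAux.label, labelPMF, PMF.map,
    PMF.bind_bind, PMF.pure_bind, Function.comp_def, labelFst, Equiv.coe_fn_mk,
    Equiv.symm_apply_apply, h]

end LabelLaws

section LabelTypicality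

variable {α α' β γ γ' δ : Type*} [Fintype α] [Fintype α'] [Fintype β] [Fintype γ] [Fintype γ']
  [Fintype δ] {L L' : ℕ} [NeZero L] [NeZero L']

lemma isJointlyTypical_label (p : PMF (α × β)) (e : α × Fin L ≃ α') (ε : ℝ) {n : ℕ} (hn : 0 < n)
    (u : Fin n → α) (l : Fin n → Fin L) (y : Fin n → β) :
    IsJointlyTypical (labelPMF p (labelFst e)) ε (fun i => e (u i, l i)) y ↔
      IsJointlyTypical p ε u y := by
  unfold IsJointlyTypical
  rw [labelPMF_map_fst, labelPMF_map_snd, isTypical_label _ _ _ hn, isTypical_label _ _ _ hn]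
  simp [labelFst]

lemma isBipartiteJointlyTypical_label (p : PMF (α × β)) (e : α × Fin L ≃ α') (q : PMF (γ × δ))
    (e' : γ × Fin L' ≃ γ') (ε : ℝ) {n d : ℕ} (hn : 0 < n) (u : Fin n → α) (l : Fin n → Fin L)
    (t : Fin d → γ) (l' : Fin d → Fin L') (x : Fin n → β) (y : Fin d → δ) :
    IsBipartiteJointlyTypical (labelPMF p (labelFst e)) (labelPMF q (labelFst e')) ε
        (fun i => e (u i, l i)) (fun i => e' (t i, l' i)) x y ↔
      IsBipartiteJointlyTypical p q ε u t x y := by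
  unfold IsBipartiteJointlyTypical
  rw [labelPMF_map_fst, labelPMF_map_fst, labelPMF_map_snd, labelPMF_map_snd,
    isBipartiteTypical_label _ _ _ _ _ hn, isBipartiteTypical_label _ _ _ _ _ hn]
  simp [labelFst]

variable {Xf Yf Zf Xb Yb Zb : Type*} [Fintype Xf] [Fintype Yf] [Fintype Zf] [Fintype Xb]
  [Fintype Yb] [Fintype Zb]

/-- A word with labels. -/
def labelWord {m n : ℕ} (u : Fin n → Fin m) (l : Fin n → Fin L) : Fin n → Fin (m * L) :=
  fun i => finProdFinEquiv (u i, l i)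

lemma isTypical_lawV_label (a : SourceAux Xf Yf) (F : DMBC Xf Yf Zf) (ε : ℝ) {n : ℕ} (hn : 0 < n)
    (u : Fin n → Fin a.cardV) (l : Fin n → Fin L) :
    IsTypical ((a.label L).lawV F) ε (labelWord u l) ↔ IsTypical (a.lawV F) ε u := by
  rw [lawV_label]
  refine (isTypical_label (a.lawV F) finProdFinEquiv ε hn (labelWord u l)).trans ?_
  simp [labelWord]

lemma isTypical_lawW1_label (c : ChannelAux Xb) (ε : ℝ) {n : ℕ} (hn : 0 < n)
    (u : Fin n → Fin c.cardW1) (l : Fin n → Fin L) :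
    IsTypical ((c.label L).lawW1) ε (labelWord u l) ↔ IsTypical c.lawW1 ε u := by
  rw [lawW1_label]
  refine (isTypical_label c.lawW1 finProdFinEquiv ε hn (labelWord u l)).trans ?_
  simp [labelWord]

lemma isJointlyTypical_lawVY_label (a : SourceAux Xf Yf) (F : DMBC Xf Yf Zf) (ε : ℝ) {n : ℕ}
    (hn : 0 < n) (u : Fin n → Fin a.cardV) (l : Fin n → Fin L) (y : Fin n → Yf) :
    IsJointlyTypical ((a.label L).lawVY F) ε (labelWord u l) y ↔
      IsJointlyTypical (a.lawVY F) ε u y := by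
  rw [lawVY_label]
  exact isJointlyTypical_label (a.lawVY F) finProdFinEquiv ε hn u l y

lemma isBipartiteJointlyTypical_law_label (a : SourceAux Xf Yf) (F : DMBC Xf Yf Zf)
    (c : ChannelAux Xb) (B : DMBC Xb Yb Zb) (ε : ℝ) {n d : ℕ} (hn : 0 < n)
    (u : Fin n → Fin a.cardV) (l : Fin n → Fin L) (t : Fin d → Fin c.cardW1) (l' : Fin d → Fin L')
    (x : Fin n → Xf) (y : Fin d → Yb) :
    IsBipartiteJointlyTypical ((a.label L).lawVX F) ((c.label L').lawW1Y B) ε (labelWord u l)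
        (labelWord t l') x y ↔
      IsBipartiteJointlyTypical (a.lawVX F) (c.lawW1Y B) ε u t x y := by
  rw [lawVX_label, lawW1Y_label]
  exact isBipartiteJointlyTypical_label (a.lawVX F) finProdFinEquiv (c.lawW1Y B) finProdFinEquiv ε
    hn u l t l' x y

lemma append_labelWord {m k d : ℕ} (u : Fin k → Fin m) (t : Fin d → Fin m) (l : Fin k → Fin L)
    (l' : Fin d → Fin L) :
    Fin.append (labelWord u l) (labelWord t l')
      = labelWord (Fin.append u t) (Fin.append l l') := by
  funext i
  refine Fin.addCases (fun i => ?_) (fun i => ?_) i <;> simp [labelWord]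

end LabelTypicality

/-! Memoryless channels. -/

lemma toReal_indepSeq {α : Type*} [Fintype α] {n : ℕ} (p : Fin n → PMF α) (u : Fin n → α) :
    (indepSeq p u).toReal = ∏ i, (p i (u i)).toReal := by
  rw [indepSeq, PMF.ofFintype_apply, ENNReal.toReal_prod]

/-- The sum over intermediate sequences of a product over positions is the product of the
one-position sums. -/
lemma useChannel_bind {α β γ : Type*} [Fintype β] [Fintype γ] (κ : α → PMF β) (B : β → PMF γ)
    {n : ℕ} (u : Fin n → α) :
    (useChannel κ u).bind (useChannel B) = useChannel (fun w => (κ w).bind B) u := by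
  ext t
  simp only [useChannel, indepSeq, PMF.bind_apply, PMF.ofFintype_apply]
  rw [tsum_fintype]
  simp_rw [← Finset.prod_mul_distrib, tsum_fintype]
  rw [Finset.prod_univ_sum, Fintype.piFinset_univ]

/-- The joint law of `a` with law `p` and `b` with conditional law `q a`. -/
def jointPMF {α β : Type*} (p : PMF α) (q : α → PMF β) : PMF (α × β) :=
  p.bind fun a => (q a).map (Prod.mk a)

lemma jointPMF_apply {α β : Type*} (p : PMF α) (q : α → PMF β) (a : α) (b : β) :
    jointPMF p q (a, b) = p a * q a b := by
  classical
  rw [jointPMF, PMF.bind_apply, tsum_eq_single a]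
  · congr 1
    rw [PMF.map_apply, tsum_eq_single b]
    · simp
    · intro b' hb'; rw [if_neg]; simpa using hb'.symm
  · intro a' ha'
    rw [PMF.map_apply, ENNReal.tsum_eq_zero.mpr, mul_zero]
    intro b'
    rw [if_neg]
    simp [ha'.symm]

lemma jointPMF_map {α β γ : Type*} (p : PMF α) (q : α → PMF β) (f : α × β → γ) :
    (jointPMF p q).map f = p.bind fun a => (q a).map fun b => f (a, b) := by
  simp only [jointPMF, PMF.map_bind, PMF.map_comp]
  rfl

/-! A choice with probabilities proportional to given weights. -/

/-- The choice of an index with probability proportional to `w`, or of nothing if all weights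
vanish. -/
def proportional {ι : Type*} [Fintype ι] (w : ι → ℝ) (hw : ∀ i, 0 ≤ w i) : PMF (Option ι) :=
  PMF.ofFintype
    (fun o => ENNReal.ofReal
      (o.elim (ind (∑ i, w i = 0)) fun i => w i / ∑ i, w i)) (by
    rw [← ENNReal.ofReal_sum_of_nonneg]
    · rw [Fintype.sum_option]
      simp only [Option.elim_none, Option.elim_some]
      rw [← Finset.sum_div]
      by_cases h : ∑ i, w i = 0
      · rw [ind_true h, h]; simp
      · rw [ind_false h, div_self h]; simp
    · intro o _
      cases o with
      | none => exact ind_nonneg _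
      | some i => exact div_nonneg (hw i) (Finset.sum_nonneg fun i _ => hw i))

lemma proportional_none {ι : Type*} [Fintype ι] (w : ι → ℝ) (hw : ∀ i, 0 ≤ w i) :
    (proportional w hw none).toReal = ind (∑ i, w i = 0) := by
  rw [proportional, PMF.ofFintype_apply, ENNReal.toReal_ofReal]
  · rfl
  · exact ind_nonneg _

lemma proportional_some {ι : Type*} [Fintype ι] (w : ι → ℝ) (hw : ∀ i, 0 ≤ w i) (i : ι) :
    (proportional w hw (some i)).toReal = w i / ∑ i, w i := by
  rw [proportional, PMF.ofFintype_apply, ENNReal.toReal_ofReal]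
  · rfl
  · exact div_nonneg (hw i) (Finset.sum_nonneg fun i _ => hw i)

/-- Both families are multiples of w, so their distance is the difference of the total masses, 1
against (∑ w)/|ι|. If all weights vanish, NULL carries mass one and the identity still holds. -/
lemma sum_proportional_sub {ι : Type*} [Fintype ι] [Nonempty ι] (w : ι → ℝ)
    (hw : ∀ i, 0 ≤ w i) :
    (proportional w hw none).toReal +
      ∑ i, |(proportional w hw (some i)).toReal - w i / Fintype.card ι|
      = |1 - (∑ i, w i) / Fintype.card ι| := by
  simp_rw [proportional_none, proportional_some]
  by_cases h : ∑ i, w i = 0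
  · have h0 : ∀ i, w i = 0 := fun i =>
      (Finset.sum_eq_zero_iff_of_nonneg fun i _ => hw i).mp h i (Finset.mem_univ i)
    rw [ind_true h]
    simp [h0]
  · have hs : 0 < ∑ i, w i := lt_of_le_of_ne (Finset.sum_nonneg fun i _ => hw i) (Ne.symm h)
    rw [ind_false h, zero_add]
    have e : ∀ i, |w i / ∑ i, w i - w i / Fintype.card ι|
        = w i * |1 / ∑ i, w i - 1 / Fintype.card ι| := by
      intro i
      rw [← abs_of_nonneg (hw i), ← abs_mul, abs_of_nonneg (hw i)]
      congr 1
      ring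
    simp_rw [e]
    rw [← Finset.sum_mul, ← abs_of_nonneg hs.le, ← abs_mul, abs_of_nonneg hs.le]
    congr 1
    field_simp

end

/-! ### Interactive channel codes, their runs, and the key obtained from a good code. -/

section

variable {Xf Yf Zf Xb Yb Zb : Type*} [Fintype Xf] [Fintype Yf] [Fintype Zf]
  [Fintype Xb] [Fintype Yb] [Fintype Zb]

open Classical in
/-- The element that satisfies `P`, if there is exactly one. -/
def theUnique {α : Type*} (P : α → Prop) : Option α :=
  if h : ∃! a, P a then some h.choose else none

lemma theUnique_eq_some {α : Type*} {P : α → Prop} {a : α} (ha : P a) (hu : ∀ b, P b → b = a) :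
    theUnique P = some a := by
  have h : ∃! a, P a := ⟨a, ha, hu⟩
  rw [theUnique, dif_pos h, hu _ h.choose_spec.1]

/-- The data of an interactive channel code, up to the labels that make the words distinct and up
to the key function. All information words share the typical word `prefixWord`. -/
structure ICCCode (F : DMBC Xf Yf Zf) (B : DMBC Xb Yb Zb) where
  /-- auxiliary variables of the first round -/
  src : SourceAux Xf Yf
  /-- auxiliary variables of the second round -/
  chn : ChannelAux Xb
  /-- number of uses of the forward channel -/
  n : ℕ
  /-- length of the information words -/
  k : ℕ
  /-- length of the parity-check words -/
  d : ℕ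
  n_pos : 0 < n
  k_pos : 0 < k
  /-- typicality parameter -/
  ε : ℝ
  ε_pos : 0 < ε
  /-- number of `V`-words -/
  cardF : ℕ
  /-- number of information words -/
  cardB : ℕ
  [cardF_ne : NeZero cardF]
  [cardB_ne : NeZero cardB]
  /-- unlabelled `V`-words -/
  vWord : Fin cardF → Fin n → Fin src.cardV
  vWord_typical : ∀ f, IsTypical (src.lawV F) ε (vWord f)
  /-- unlabelled information word -/
  prefixWord : Fin k → Fin chn.cardW1
  prefixWord_typical : IsTypical chn.lawW1 ε prefixWord
  /-- unlabelled parity-check words -/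
  parity : Fin cardF × Fin cardB → Fin d → Fin chn.cardW1
  /-- channel input after NULL -/
  nullWord : Fin (k + d) → Xb

attribute [instance] ICCCode.cardF_ne ICCCode.cardB_ne

namespace ICCCode

variable {F : DMBC Xf Yf Zf} {B : DMBC Xb Yb Zb} (D : ICCCode F B)

/-- Likelihood ratio of a `V`-word and a received word. -/
def likelihood (a : SourceAux Xf Yf) (F : DMBC Xf Yf Zf) {n : ℕ} (v : Fin n → Fin a.cardV)
    (y : Fin n → Yf) : ℝ :=
  ∏ i, (a.kernelV (y i) (v i)).toReal / (a.lawV F (v i)).toReal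

lemma likelihood_nonneg (a : SourceAux Xf Yf) (F : DMBC Xf Yf Zf) {n : ℕ}
    (v : Fin n → Fin a.cardV) (y : Fin n → Yf) : 0 ≤ likelihood a F v y :=
  Finset.prod_nonneg fun _ _ => div_nonneg ENNReal.toReal_nonneg ENNReal.toReal_nonneg

/-- The weight of a `V`-word in the choice of the responder. -/
def quantWeight (y : Fin D.n → Yf) (f : Fin D.cardF) : ℝ :=
  likelihood D.src F (D.vWord f) y * ind (IsJointlyTypical (D.src.lawVY F) D.ε (D.vWord f) y)

lemma quantWeight_nonneg (y : Fin D.n → Yf) (f : Fin D.cardF) : 0 ≤ D.quantWeight y f :=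
  mul_nonneg (likelihood_nonneg _ _ _ _) (ind_nonneg _)

/-- The responder's choice of a `V`-word. -/
def quantize (y : Fin D.n → Yf) : PMF (Option (Fin D.cardF)) :=
  proportional (D.quantWeight y) (D.quantWeight_nonneg y)

lemma lawVY_eq (a : SourceAux Xf Yf) (F : DMBC Xf Yf Zf) (v : Fin a.cardV) (y : Yf) :
    (a.lawVY F (v, y)).toReal
      = ((a.lawX.bind F).map Prod.fst y).toReal * (a.kernelV y v).toReal := by
  have h : a.lawVY F
      = (jointPMF ((a.lawX.bind F).map Prod.fst) a.kernelV).map Prod.swap := by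
    simp only [SourceAux.lawVY, SourceAux.law, jointPMF, PMF.map, PMF.bind_bind, PMF.pure_bind,
      Function.comp_def, Prod.swap_prod_mk]
  have h2 : a.lawVY F (v, y) = jointPMF ((a.lawX.bind F).map Prod.fst) a.kernelV (y, v) := by
    classical
    rw [h, PMF.map_apply, tsum_eq_single (y, v)]
    · simp
    · rintro ⟨y', v'⟩ hne
      rw [if_neg]
      intro h
      rw [Prod.swap_prod_mk, Prod.mk.injEq] at h
      exact hne (by rw [h.1, h.2])
  rw [h2, jointPMF_apply, ENNReal.toReal_mul]

/-- A jointly typical word therefore has positive weight, so the responder's proportional choice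
returns NULL only when no word is jointly typical, as the protocol demands. -/
lemma likelihood_pos_of_typical (a : SourceAux Xf Yf) (F : DMBC Xf Yf Zf) {n : ℕ} {ε : ℝ}
    {v : Fin n → Fin a.cardV} {y : Fin n → Yf}
    (h : IsJointlyTypical (a.lawVY F) ε v y) : 0 < likelihood a F v y := by
  have h1 : (a.lawVY F).map Prod.fst = a.lawV F := by
    rw [SourceAux.lawVY, PMF.map_comp]; rfl
  refine Finset.prod_pos fun i _ => div_pos ?_ ?_
  · have := Finset.prod_ne_zero_iff.mp h.2.2.1 i (Finset.mem_univ i)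
    rw [lawVY_eq] at this
    exact lt_of_le_of_ne ENNReal.toReal_nonneg (right_ne_zero_of_mul this).symm
  · have := Finset.prod_ne_zero_iff.mp h.1.1 i (Finset.mem_univ i)
    rw [h1] at this
    exact lt_of_le_of_ne ENNReal.toReal_nonneg this.symm

/-- The backward codeword. -/
def enc (m : Fin D.cardF × Fin D.cardB) : Fin (D.k + D.d) → Fin D.chn.cardW1 :=
  Fin.append D.prefixWord (D.parity m)

/-- The channel from `W₁` to the outputs of the backward channel. -/
def backChannel (c : ChannelAux Xb) (B : DMBC Xb Yb Zb) (w : Fin c.cardW1) : PMF (Yb × Zb) :=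
  (c.kernelX w).bind B

/-- The law of the backward outputs. -/
def back (f : Option (Fin D.cardF)) (b : Fin D.cardB) : PMF (Fin (D.k + D.d) → Yb × Zb) :=
  match f with
  | some f => useChannel (backChannel D.chn B) (D.enc (f, b))
  | none => useChannel B D.nullWord

/-- The decoding test. -/
def Matches (x : Fin D.n → Xf) (y : Fin (D.k + D.d) → Yb) (m : Fin D.cardF × Fin D.cardB) :
    Prop :=
  IsBipartiteJointlyTypical (D.src.lawVX F) (D.chn.lawW1Y B) D.ε (D.vWord m.1) (D.enc m) x y

/-- The decoder. -/
def dec (x : Fin D.n → Xf) (y : Fin (D.k + D.d) → Yb) : Option (Fin D.cardF × Fin D.cardB) :=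
  theUnique (D.Matches x y)

/-- The runs of the protocol: forward inputs and outputs, choices of the responder, and backward
outputs. -/
abbrev Run : Type _ :=
  (Fin D.n → Xf) × (Fin D.n → Yf × Zf) × Option (Fin D.cardF) × Fin D.cardB ×
    (Fin (D.k + D.d) → Yb × Zb)

/-- The law of a run. -/
def run : PMF D.Run :=
  jointPMF (indepSeq fun _ : Fin D.n => D.src.lawX) fun x =>
    jointPMF (useChannel F x) fun yz => jointPMF (D.quantize fun i => (yz i).1) fun f =>
      jointPMF (PMF.uniformOfFintype (Fin D.cardB)) fun b => D.back f b

/-- The eavesdropper's view of a run. -/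
def view (ω : D.Run) : (Fin D.n → Zf) × (Fin (D.k + D.d) → Zb) :=
  (fun i => (ω.2.1 i).2, fun i => (ω.2.2.2.2 i).2)

/-- The responder's message. -/
def message (ω : D.Run) : Option (Fin D.cardF × Fin D.cardB) :=
  ω.2.2.1.map fun f => (f, ω.2.2.2.1)

/-- The initiator's estimate of the message. -/
def estimate (ω : D.Run) : Option (Fin D.cardF × Fin D.cardB) :=
  D.dec ω.1 fun i => (ω.2.2.2.2 i).1

/-- The protocol with labelled words and key function `g`. -/
def toProtocol {K : ℕ} (g : Fin D.cardF × Fin D.cardB → Fin K)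
    (hg : ∀ k k', Nat.card {m // g m = k} = Nat.card {m // g m = k'}) : ICCProtocol F B where
  src := D.src.label D.cardF
  chn := D.chn.label D.cardB
  nf := D.n
  nb1 := D.k
  nb2 := D.d
  nf_pos := D.n_pos
  nb_pos := Nat.add_pos_left D.k_pos _
  ε := D.ε
  ε_pos := D.ε_pos
  cardF := D.cardF
  cardB := D.cardB
  -- Every symbol carries the index f as its label, so words that coincide before labelling become
  -- distinct; position 0 exists and reveals f.
  vWord := ⟨fun f => labelWord (D.vWord f) fun _ => f, fun f f' h => by
    have := congrFun h ⟨0, D.n_pos⟩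
    exact (Prod.ext_iff.mp (finProdFinEquiv.injective this)).2⟩
  vWord_typical f := (isTypical_lawV_label _ _ _ D.n_pos _ _).mpr (D.vWord_typical f)
  wWord := ⟨fun b => labelWord D.prefixWord fun _ => b, fun b b' h => by
    have := congrFun h ⟨0, D.k_pos⟩
    exact (Prod.ext_iff.mp (finProdFinEquiv.injective this)).2⟩
  wWord_typical b := (isTypical_lawW1_label _ _ D.k_pos _ _).mpr D.prefixWord_typical
  quantize := D.quantize
  quantize_some y f hf := by
    refine (isJointlyTypical_lawVY_label _ _ _ D.n_pos _ _ _).mpr ?_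
    by_contra h
    have h0 : ((D.quantize y) (some f)).toReal = 0 := by
      rw [quantize, proportional_some, quantWeight, ind_false h, mul_zero, zero_div]
    exact (PMF.mem_support_iff _ _).mp hf
      ((ENNReal.toReal_eq_zero_iff _).mp h0 |>.resolve_right (PMF.apply_ne_top _ _))
  quantize_none y hy f := by
    refine fun h => ?_
    have h := (isJointlyTypical_lawVY_label _ _ _ D.n_pos _ _ _).mp h
    have h0 : ((D.quantize y) none).toReal = 0 := by
      rw [quantize, proportional_none, ind_false]
      intro hs
      have := (Finset.sum_eq_zero_iff_of_nonneg fun i _ => D.quantWeight_nonneg y i).mp hs f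
        (Finset.mem_univ f)
      rw [quantWeight, ind_true h, mul_one] at this
      exact (likelihood_pos_of_typical _ _ h).ne' this
    exact (PMF.mem_support_iff _ _).mp hy
      ((ENNReal.toReal_eq_zero_iff _).mp h0 |>.resolve_right (PMF.apply_ne_top _ _))
  -- Parity-check words need not be distinct, so one constant label suffices.
  parity f b := labelWord (D.parity (f, b)) fun _ => 0
  nullWord := D.nullWord
  cardK := K
  key := g
  key_equal_parts := hg

/-! ### Labels do not change the outcome of the protocol. -/

section Outcome

variable {K : ℕ} (g : Fin D.cardF × Fin D.cardB → Fin K)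
    (hg : ∀ k k', Nat.card {m // g m = k} = Nat.card {m // g m = k'})

lemma toProtocol_enc (m : Fin D.cardF × Fin D.cardB) :
    (D.toProtocol g hg).enc m
      = labelWord (D.enc m) (Fin.append (fun _ => m.2) fun _ => 0) :=
  append_labelWord _ _ _ _

lemma toProtocol_matches (x : Fin D.n → Xf) (y : Fin (D.k + D.d) → Yb)
    (m : Fin D.cardF × Fin D.cardB) :
    (D.toProtocol g hg).Matches x y m ↔ D.Matches x y m := by
  unfold ICCProtocol.Matches
  rw [toProtocol_enc]
  exact isBipartiteJointlyTypical_law_label _ _ _ _ _ D.n_pos _ _ _ _ _ _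

lemma toProtocol_dec (x : Fin D.n → Xf) (y : Fin (D.k + D.d) → Yb) :
    (D.toProtocol g hg).dec x y = D.dec x y := by
  have h : (D.toProtocol g hg).Matches x y = D.Matches x y :=
    funext fun m => propext (D.toProtocol_matches g hg x y m)
  exact congrArg theUnique h

/-- The labelled law of X_b given W₁ ignores the label, and composing it with the backward channel
gives the memoryless channel from W₁ to the outputs. -/
lemma toProtocol_send (f : Option (Fin D.cardF)) (b : Fin D.cardB) :
    ((D.toProtocol g hg).send f b).bind (useChannel B) = D.back f b := by
  cases f with
  | none => exact PMF.pure_bind _ _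
  | some f =>
    have h : (D.toProtocol g hg).send (some f) b
        = useChannel D.chn.kernelX (D.enc (f, b)) := by
      change useChannel (fun w => D.chn.kernelX (finProdFinEquiv.symm w).1)
        ((D.toProtocol g hg).enc (f, b)) = _
      refine (congrArg (useChannel _) (toProtocol_enc D g hg (f, b))).trans ?_
      unfold useChannel
      congr 1
      funext i
      exact congrArg (fun z : Fin D.chn.cardW1 × Fin D.cardB => D.chn.kernelX z.1)
        (Equiv.symm_apply_apply finProdFinEquiv _)
    exact (congrArg (PMF.bind · (useChannel B)) h).trans (useChannel_bind _ _ _)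

/-- Quantization, decoding and transmission do not see the labels, so the labelled protocol can be
analyzed through the unlabelled run. -/
lemma toProtocol_outcome :
    (D.toProtocol g hg).outcome
      = D.run.map fun ω => ((D.message ω).map g, (D.estimate ω).map g, D.view ω) := by
  rw [run, jointPMF_map]
  unfold ICCProtocol.outcome
  refine congrArg (PMF.bind _) (funext fun x => ?_)
  rw [jointPMF_map]
  refine congrArg (PMF.bind _) (funext fun yz => ?_)
  rw [jointPMF_map]
  refine congrArg (PMF.bind _) (funext fun f => ?_)
  rw [jointPMF_map]
  refine congrArg (PMF.bind _) (funext fun b => ?_)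
  have hmap : ∀ φ : (Fin (D.k + D.d) → Yb × Zb) → Option (Fin K) × Option (Fin K) ×
      (Fin D.n → Zf) × (Fin (D.k + D.d) → Zb),
      ((D.toProtocol g hg).send f b).bind (fun xb => (useChannel B xb).map φ)
        = (D.back f b).map φ := fun φ => by
    rw [← toProtocol_send D g hg f b]
    exact (PMF.map_bind _ _ _).symm
  refine (hmap _).trans (congrArg (fun φ => PMF.map φ (D.back f b)) (funext fun t => ?_))
  refine congrArg₂ Prod.mk (by cases f <;> rfl) (congrArg₂ Prod.mk ?_ rfl)
  exact congrArg (Option.map g) (toProtocol_dec D g hg x fun i => (t i).1)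

end Outcome

/-- The law of the first-round inputs and outputs. -/
def firstLaw (a : SourceAux Xf Yf) (F : DMBC Xf Yf Zf) {n : ℕ}
    (s : (Fin n → Xf) × (Fin n → Yf × Zf)) : ℝ :=
  (indepSeq (fun _ => a.lawX) s.1).toReal * (useChannel F s.1 s.2).toReal

lemma firstLaw_nonneg (a : SourceAux Xf Yf) (F : DMBC Xf Yf Zf) {n : ℕ}
    (s : (Fin n → Xf) × (Fin n → Yf × Zf)) : 0 ≤ firstLaw a F s :=
  mul_nonneg ENNReal.toReal_nonneg ENNReal.toReal_nonneg

/-- The received sequence of the responder. -/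
def received {n : ℕ} (s : (Fin n → Xf) × (Fin n → Yf × Zf)) : Fin n → Yf := fun i => (s.2 i).1

lemma toReal_run (x : Fin D.n → Xf) (yz : Fin D.n → Yf × Zf) (f : Option (Fin D.cardF))
    (b : Fin D.cardB) (t : Fin (D.k + D.d) → Yb × Zb) :
    (D.run (x, yz, f, b, t)).toReal = firstLaw D.src F (x, yz) *
      ((D.quantize (received (x, yz)) f).toReal * (1 / D.cardB * (D.back f b t).toReal)) := by
  rw [run, jointPMF_apply, jointPMF_apply, jointPMF_apply, jointPMF_apply,
    PMF.uniformOfFintype_apply]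
  simp only [ENNReal.toReal_mul, ENNReal.toReal_inv, ENNReal.toReal_natCast, Fintype.card_fin,
    firstLaw, show received (x, yz) = fun i => (yz i).1 from rfl]
  ring

/-- The idealized weight of a run: the message is uniform, the outputs of both channels are
produced from the codewords, and decoding succeeds. -/
def idealWeight
    (good : Fin D.cardF × Fin D.cardB → (Fin D.n → Xf) × (Fin D.n → Yf × Zf) →
      (Fin (D.k + D.d) → Yb × Zb) → Prop) (ω : D.Run) : ℝ :=
  match ω with
  | (_, _, none, _, _) => 0
  | (x, yz, some f, b, t) => firstLaw D.src F (x, yz) *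
      ((D.quantWeight (received (x, yz)) f / D.cardF) * (1 / D.cardB * (D.back (some f) b t).toReal))
        * ind (good (f, b) (x, yz) t)

section Ideal

variable (good : Fin D.cardF × Fin D.cardB → (Fin D.n → Xf) × (Fin D.n → Yf × Zf) →
      (Fin (D.k + D.d) → Yb × Zb) → Prop)

lemma idealWeight_nonneg (ω : D.Run) : 0 ≤ D.idealWeight good ω := by
  obtain ⟨x, yz, f, b, t⟩ := ω
  cases f with
  | none => exact le_rfl
  | some f =>
    have := firstLaw_nonneg D.src F (x, yz)
    have := D.quantWeight_nonneg (received (x, yz)) f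
    have := ind_nonneg (good (f, b) (x, yz) t)
    simp only [idealWeight]
    positivity

/-- The probability of atypical behaviour for a given message. -/
def badMass (m : Fin D.cardF × Fin D.cardB) : ℝ :=
  ∑ s, ∑ t, firstLaw D.src F s * likelihood D.src F (D.vWord m.1) (received s) *
    (D.back (some m.1) m.2 t).toReal * ind (¬ good m s t)

lemma quantWeight_le (y : Fin D.n → Yf) (f : Fin D.cardF) :
    D.quantWeight y f ≤ likelihood D.src F (D.vWord f) y :=
  mul_le_of_le_one_right (likelihood_nonneg _ _ _ _) (ind_le_one _)

lemma sum_run (φ : D.Run → ℝ) :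
    ∑ ω, φ ω = ∑ s : (Fin D.n → Xf) × (Fin D.n → Yf × Zf),
      (∑ b, ∑ t, φ (s.1, s.2, none, b, t) + ∑ f, ∑ b, ∑ t, φ (s.1, s.2, some f, b, t)) := by
  rw [Fintype.sum_prod_type, Fintype.sum_prod_type]
  refine Finset.sum_congr rfl fun x _ => ?_
  rw [Fintype.sum_prod_type]
  refine Finset.sum_congr rfl fun yz _ => ?_
  rw [Fintype.sum_prod_type, Fintype.sum_option]
  simp_rw [Fintype.sum_prod_type]

/-- The run and the ideal weight differ in two ways. The weights of f are normalized by their sum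
instead of by |F|, at a cost given exactly by `sum_proportional_sub`, NULL included. The ideal
weight also drops runs that are not good; since a quantization weight is at most the likelihood
ratio, this costs at most the average of `badMass`. -/
lemma sum_abs_run_sub_idealWeight_le :
    ∑ ω, |(D.run ω).toReal - D.idealWeight good ω| ≤
      ∑ s, firstLaw D.src F s * |1 - (∑ f, D.quantWeight (received s) f) / D.cardF| +
        (∑ m, D.badMass good m) / (D.cardF * D.cardB) := by
  have hF : (0 : ℝ) < D.cardF := by exact_mod_cast Nat.pos_of_ne_zero (NeZero.ne D.cardF)
  have hB : (0 : ℝ) < D.cardB := by exact_mod_cast Nat.pos_of_ne_zero (NeZero.ne D.cardB)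
  rw [sum_run]
  have hbad : (∑ m, D.badMass good m) / (D.cardF * D.cardB)
      = ∑ s, ∑ f, ∑ b, ∑ t, firstLaw D.src F s * likelihood D.src F (D.vWord f) (received s) *
          (D.back (some f) b t).toReal * ind (¬ good (f, b) s t) / (D.cardF * D.cardB) := by
    simp only [badMass, Finset.sum_div]
    rw [Finset.sum_comm]
    refine Finset.sum_congr rfl fun s _ => ?_
    rw [Fintype.sum_prod_type]
  rw [hbad, ← Finset.sum_add_distrib]
  refine Finset.sum_le_sum fun s _ => ?_
  have hP := firstLaw_nonneg D.src F s
  have ht : ∀ f b, ∑ t, (D.back f b t).toReal = 1 := fun f b => pmf_sum_toReal _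
  have hsb : ∀ f, ∑ b : Fin D.cardB, ∑ t, 1 / (D.cardB : ℝ) * (D.back f b t).toReal = 1 := by
    intro f
    simp_rw [← Finset.mul_sum, ht]
    simp [hB.ne']
  have hcov := sum_proportional_sub (D.quantWeight (received s))
    (D.quantWeight_nonneg (received s))
  rw [Fintype.card_fin] at hcov
  rw [← hcov, mul_add, add_assoc]
  refine add_le_add (le_of_eq ?_) ?_
  · have : ∀ b t, |(D.run (s.1, s.2, none, b, t)).toReal
        - D.idealWeight good (s.1, s.2, none, b, t)|
        = firstLaw D.src F s * (D.quantize (received s) none).toReal *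
          (1 / D.cardB * (D.back none b t).toReal) := by
      intro b t
      rw [toReal_run]
      simp only [idealWeight, sub_zero, Prod.mk.eta]
      rw [abs_of_nonneg (by positivity)]
      ring
    simp_rw [this, ← Finset.mul_sum]
    have := hsb none
    simp_rw [← Finset.mul_sum] at this
    rw [this, mul_one]
    rfl
  · rw [Finset.mul_sum, ← Finset.sum_add_distrib]
    refine Finset.sum_le_sum fun f _ => ?_
    have hle : ∀ b t, |(D.run (s.1, s.2, some f, b, t)).toReal
        - D.idealWeight good (s.1, s.2, some f, b, t)|
        ≤ firstLaw D.src F s * |(D.quantize (received s) (some f)).toReal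
            - D.quantWeight (received s) f / D.cardF| * (1 / D.cardB * (D.back (some f) b t).toReal)
          + firstLaw D.src F s * likelihood D.src F (D.vWord f) (received s) *
          (D.back (some f) b t).toReal * ind (¬ good (f, b) s t) / (D.cardF * D.cardB) := by
      intro b t
      rw [toReal_run]
      simp only [idealWeight, Prod.mk.eta]
      set q := (D.quantize (received s) (some f)).toReal
      set w := D.quantWeight (received s) f with hw
      set c := 1 / (D.cardB : ℝ) * (D.back (some f) b t).toReal with hc
      have hc0 : 0 ≤ c := by positivity
      have hw0 : 0 ≤ w := D.quantWeight_nonneg _ _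
      have e : firstLaw D.src F s * (q * c) -
          firstLaw D.src F s * (w / D.cardF * c) * ind (good (f, b) s t)
          = firstLaw D.src F s * (q - w / D.cardF) * c +
            firstLaw D.src F s * (w / D.cardF * c) * ind (¬ good (f, b) s t) := by
        rw [ind_not]; ring
      rw [e]
      refine (abs_add_le _ _).trans (add_le_add (le_of_eq ?_) ?_)
      · rw [abs_mul, abs_mul, abs_of_nonneg hP, abs_of_nonneg hc0]
      · have hi := ind_nonneg (¬ good (f, b) s t)
        rw [abs_of_nonneg (by positivity)]
        have hwl := D.quantWeight_le (received s) f
        have : firstLaw D.src F s * (w / D.cardF * c) * ind (¬ good (f, b) s t)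
            = w * (firstLaw D.src F s * (D.back (some f) b t).toReal *
              ind (¬ good (f, b) s t) / (D.cardF * D.cardB)) := by
          rw [hc]; field_simp
        rw [this]
        refine (mul_le_mul_of_nonneg_right hwl (by positivity)).trans_eq ?_
        ring
    refine (Finset.sum_le_sum fun b _ => Finset.sum_le_sum fun t _ => hle b t).trans ?_
    simp_rw [Finset.sum_add_distrib]
    refine add_le_add (le_of_eq ?_) le_rfl
    have := hsb (some f)
    simp_rw [← Finset.mul_sum] at this ⊢
    rw [this, mul_one]
    rfl

/-- A code that is good on average has a secure key function. -/
theorem exists_secure_key {K : ℕ} (hK : 4 ≤ K)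
    (hgood : ∀ m s t, good m s t → D.dec s.1 (fun i => (t i).1) = some m)
    {θ : ℝ} (hθ1 : θ ≤ 1)
    (hθ : ∑ s, firstLaw D.src F s * |1 - (∑ f, D.quantWeight (received s) f) / D.cardF| +
        (∑ m, D.badMass good m) / (D.cardF * D.cardB) ≤ θ)
    {σ : (Fin D.n → Zf) × (Fin (D.k + D.d) → Zb) → ℝ} (hσ0 : ∀ z, 0 ≤ σ z)
    (hσ : ∑ z, σ z ≤ 1) {κ : ℝ} (hκ0 : 0 ≤ κ)
    (hκ : ∀ m (z : (Fin D.n → Zf) × (Fin (D.k + D.d) → Zb)),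
      ∑ s : (Fin D.n → Xf) × (Fin D.n → Yf × Zf), ∑ t, firstLaw D.src F s *
      likelihood D.src F (D.vWord m.1) (received s) * (D.back (some m.1) m.2 t).toReal *
      ind (good m s t) * ind (((fun i => (s.2 i).2), fun i => (t i).2) = z) ≤ κ * σ z)
    (g : Fin D.cardF × Fin D.cardB → Fin K)
    (hg : ∀ k, ∑ a, ind (g a = k) = (D.cardF * D.cardB : ℝ) / K) :
    ∃ P : ICCProtocol F B, P.nf = D.n ∧ P.nb = D.k + D.d ∧ P.cardK = K ∧
      P.outcome.toOuterMeasure {ω | ¬ ∃ k, ω.1 = some k ∧ ω.2.1 = some k} ≤ ENNReal.ofReal θ ∧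
      (1 - 5 * (θ + √(2 * K * (κ / (D.cardF * D.cardB))))) * (Real.logb 2 K - 2) ≤
        condEntropy P.outcome (fun ω => ω.1) (fun ω => ω.2.2) := by
  have hF : (0 : ℝ) < D.cardF := by exact_mod_cast Nat.pos_of_ne_zero (NeZero.ne D.cardF)
  have hB : (0 : ℝ) < D.cardB := by exact_mod_cast Nat.pos_of_ne_zero (NeZero.ne D.cardB)
  obtain ⟨π, h1, h2⟩ := TwoDMBC.exists_secure_key hK D.run D.message D.estimate D.view
    (D.idealWeight_nonneg good) (fun ω hω => by
      obtain ⟨x, yz, f, b, t⟩ := ω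
      cases f with
      | none => exact absurd rfl hω
      | some f =>
        refine ⟨(f, b), rfl, hgood (f, b) (x, yz) t ?_⟩
        by_contra h
        simp only [idealWeight] at hω
        rw [ind_false h, mul_zero] at hω
        exact hω rfl)
    hθ1 ((D.sum_abs_run_sub_idealWeight_le good).trans hθ) hσ0 hσ
    (κ := κ / (D.cardF * D.cardB)) (by positivity) (by
      rintro ⟨f, b⟩ z
      rw [sum_run]
      have hn : ∀ (x : Fin D.n → Xf) (yz : Fin D.n → Yf × Zf) (b' : Fin D.cardB)
          (t : Fin (D.k + D.d) → Yb × Zb), D.idealWeight good (x, yz, none, b', t) *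
          ind (D.message (x, yz, none, b', t) = some (f, b) ∧ D.view (x, yz, none, b', t) = z)
          = 0 := fun x yz b' t => zero_mul _
      have hs : ∀ (s : (Fin D.n → Xf) × (Fin D.n → Yf × Zf)) (f' : Fin D.cardF)
          (b' : Fin D.cardB) (t : Fin (D.k + D.d) → Yb × Zb),
          D.idealWeight good (s.1, s.2, some f', b', t) * ind (D.message (s.1, s.2, some f', b', t)
            = some (f, b) ∧ D.view (s.1, s.2, some f', b', t) = z)
          = ind (b = b') * (ind (f = f') * (D.idealWeight good (s.1, s.2, some f', b', t) *
              ind (((fun i => (s.2 i).2), fun i => (t i).2) = z))) := by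
        intro s f' b' t
        by_cases hf : f = f'
        · by_cases hb : b = b'
          · subst hf hb
            rw [ind_true rfl, ind_true rfl, one_mul, one_mul]
            congr 1
            simp [message, view]
          · rw [ind_false hb, zero_mul, ind_false, mul_zero]
            rintro ⟨h, -⟩
            simp only [message, Option.map_some, Option.some.injEq, Prod.mk.injEq] at h
            exact hb h.2.symm
        · rw [ind_false hf, zero_mul, mul_zero, ind_false, mul_zero]
          rintro ⟨h, -⟩
          simp only [message, Option.map_some, Option.some.injEq, Prod.mk.injEq] at h
          exact hf h.1.symm
      simp_rw [hn, hs, Finset.sum_const_zero, zero_add]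
      -- For a fixed message the sums over f' and b' collapse to one term, which carries the uniform
      -- factor 1/(|F||B|); this is why κ is divided by the number of messages.
      have hpick : ∀ s : (Fin D.n → Xf) × (Fin D.n → Yf × Zf),
          ∑ f', ∑ b', ∑ t, ind (b = b') * (ind (f = f') *
            (D.idealWeight good (s.1, s.2, some f', b', t) *
              ind (((fun i => (s.2 i).2), fun i => (t i).2) = z)))
          = ∑ t, D.idealWeight good (s.1, s.2, some f, b, t) *
              ind (((fun i => (s.2 i).2), fun i => (t i).2) = z) := by
        intro s
        simp_rw [← Finset.mul_sum]
        have := fun f' => sum_ind_eq_mul b (fun b' => ind (f = f') *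
          ∑ t, D.idealWeight good (s.1, s.2, some f', b', t) *
              ind (((fun i => (s.2 i).2), fun i => (t i).2) = z))
        simp_rw [this]
        exact sum_ind_eq_mul f (fun f' => ∑ t, D.idealWeight good (s.1, s.2, some f', b, t) *
              ind (((fun i => (s.2 i).2), fun i => (t i).2) = z))
      simp_rw [hpick]
      rw [div_mul_eq_mul_div, le_div_iff₀ (by positivity), Finset.sum_mul]
      refine le_trans (Finset.sum_le_sum fun s _ => ?_) (hκ (f, b) z)
      rw [Finset.sum_mul]
      refine Finset.sum_le_sum fun t _ => ?_
      simp only [idealWeight, Prod.mk.eta]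
      have hP := firstLaw_nonneg D.src F s
      have hi := ind_nonneg (good (f, b) s t)
      have hi' := ind_nonneg (((fun i => (s.2 i).2 : Fin D.n → Zf),
        (fun i => (t i).2 : Fin (D.k + D.d) → Zb)) = z)
      set I' := ind (((fun i => (s.2 i).2 : Fin D.n → Zf),
        (fun i => (t i).2 : Fin (D.k + D.d) → Zb)) = z)
      have hwl := mul_le_mul_of_nonneg_right (D.quantWeight_le (received s) f)
        (by positivity : 0 ≤ firstLaw D.src F s * (D.back (some f) b t).toReal *
          ind (good (f, b) s t) * I')
      refine le_trans (le_of_eq ?_) (hwl.trans_eq ?_)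
      · field_simp
      · ring)
    g (by rw [Fintype.card_prod, Fintype.card_fin, Fintype.card_fin]; push_cast; exact hg)
  have hbal : ∀ k k', Nat.card {m // g (π m) = k} = Nat.card {m // g (π m) = k'} := by
    have hc : ∀ k, (Nat.card {m // g (π m) = k} : ℝ) = (D.cardF * D.cardB : ℝ) / K := by
      intro k
      classical
      rw [← hg k, ← Equiv.sum_comp π, Nat.card_eq_fintype_card, Fintype.card_subtype,
        Finset.card_filter]
      push_cast
      refine Finset.sum_congr rfl fun i _ => ?_
      unfold ind
      split_ifs <;> rfl
    intro k k'
    exact_mod_cast (hc k).trans (hc k').symm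
  refine ⟨D.toProtocol (fun m => g (π m)) hbal, rfl, rfl, rfl, ?_, ?_⟩
  · rw [← toProtocol_outcome] at h1
    exact h1
  · rw [toProtocol_outcome]
    exact h2

end Ideal

end ICCCode

end

section

/-! Exponents of the probabilities of typical sequences. -/

section Exponent

variable {α β Ω : Type*} [Fintype α] [Fintype β] [Fintype Ω]

lemma seqProb_nonneg {α : Type*} (p : PMF α) {n : ℕ} (u : Fin n → α) : 0 ≤ seqProb p u :=
  Finset.prod_nonneg fun _ _ => ENNReal.toReal_nonneg

lemma seqProb_pos_of_ne_zero {α : Type*} {p : PMF α} {n : ℕ} {u : Fin n → α}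
    (h : seqProb p u ≠ 0) : 0 < seqProb p u := lt_of_le_of_ne (seqProb_nonneg p u) h.symm

lemma seqProb_append {α : Type*} (p : PMF α) {k d : ℕ} (u : Fin k → α) (v : Fin d → α) :
    seqProb p (Fin.append u v) = seqProb p u * seqProb p v := by
  simp [seqProb, Fin.prod_univ_add]

/-- The deviation of the negative log-likelihood of a sequence from its expected value. -/
def logDev (p : PMF α) {n : ℕ} (u : Fin n → α) : ℝ :=
  -Real.logb 2 (seqProb p u) - n * entropy p

lemma seqProb_eq_rpow {p : PMF α} {n : ℕ} {u : Fin n → α} (h : seqProb p u ≠ 0) :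
    seqProb p u = 2 ^ (-(n * entropy p + logDev p u)) := by
  rw [logDev, add_sub_cancel, neg_neg, Real.rpow_logb (by norm_num) (by norm_num)
    (seqProb_pos_of_ne_zero h)]

lemma isTypical_iff {p : PMF α} {ε : ℝ} {n : ℕ} (hn : 0 < n) {u : Fin n → α} :
    IsTypical p ε u ↔ seqProb p u ≠ 0 ∧ |logDev p u| < n * ε := by
  have hn' : (0 : ℝ) < n := by exact_mod_cast hn
  unfold IsTypical
  refine and_congr_right fun _ => ?_
  have : -(1 / (n : ℝ)) * Real.logb 2 (seqProb p u) - entropy p = logDev p u / n := by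
    rw [logDev]; field_simp
  rw [this, abs_div, abs_of_pos hn', div_lt_iff₀ hn', mul_comm]

lemma isBipartiteTypical_iff {p : PMF α} {q : PMF β} {ε : ℝ} {n d : ℕ} (hn : 0 < n)
    {u : Fin n → α} {t : Fin d → β} :
    IsBipartiteTypical p q ε u t ↔ seqProb p u ≠ 0 ∧ seqProb q t ≠ 0 ∧
      |logDev p u + logDev q t| < (n + d) * ε := by
  have hn' : (0 : ℝ) < n := by exact_mod_cast hn
  have hd : (0 : ℝ) ≤ d := by positivity
  have hnd : (0 : ℝ) < n + d := by linarith
  unfold IsBipartiteTypical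
  rw [mul_ne_zero_iff, and_assoc]
  refine and_congr_right fun h1 => and_congr_right fun h2 => ?_
  have : -(1 / ((n : ℝ) + d)) * Real.logb 2 (seqProb p u * seqProb q t)
      - (n * entropy p + d * entropy q) / ((n : ℝ) + d) = (logDev p u + logDev q t) / (n + d) := by
    rw [logDev, logDev, Real.logb_mul h1 h2]; field_simp; ring
  rw [this, abs_div, abs_of_pos hnd, div_lt_iff₀ hnd, mul_comm]

lemma logDev_append {p : PMF α} {k d : ℕ} {u : Fin k → α} {v : Fin d → α}
    (hu : seqProb p u ≠ 0) (hv : seqProb p v ≠ 0) :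
    logDev p (Fin.append u v) = logDev p u + logDev p v := by
  rw [logDev, logDev, logDev, seqProb_append, Real.logb_mul hu hv]
  push_cast
  ring

lemma exists_logDev_le (p : PMF α) (k : ℕ) : ∃ C, 0 ≤ C ∧ ∀ u : Fin k → α, |logDev p u| ≤ C :=
  ⟨∑ u : Fin k → α, |logDev p u|, Finset.sum_nonneg fun _ _ => abs_nonneg _, fun u =>
    Finset.single_le_sum (f := fun u : Fin k → α => |logDev p u|) (fun _ _ => abs_nonneg _)
      (Finset.mem_univ u)⟩

/-- A requirement on sequences, with a tolerance, that fails with the probability that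
Chebyshev's inequality gives. -/
def Concentrated (μ : PMF Ω) (E : ∀ n : ℕ, ℝ → (Fin n → Ω) → Prop) : Prop :=
  ∃ V : ℝ, 0 ≤ V ∧ ∀ (n : ℕ) (t : ℝ), 0 < t →
    ∑ u : Fin n → Ω, seqProb μ u * ind (¬ E n t u) ≤ n * V / t ^ 2

lemma sum_seqProb (μ : PMF Ω) (n : ℕ) : ∑ u : Fin n → Ω, seqProb μ u = 1 :=
  sum_iid (p := fun ω => (μ ω).toReal) (pmf_sum_toReal μ)

/-- Union bound; the variance constants add. -/
lemma Concentrated.and {μ : PMF Ω} {E E' : ∀ n : ℕ, ℝ → (Fin n → Ω) → Prop}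
    (h : Concentrated μ E) (h' : Concentrated μ E') :
    Concentrated μ fun n t u => E n t u ∧ E' n t u := by
  obtain ⟨V, hV0, hV⟩ := h
  obtain ⟨V', hV0', hV'⟩ := h'
  refine ⟨V + V', add_nonneg hV0 hV0', fun n t ht => ?_⟩
  have : ∀ u : Fin n → Ω, seqProb μ u * ind (¬ (E n t u ∧ E' n t u))
      ≤ seqProb μ u * ind (¬ E n t u) + seqProb μ u * ind (¬ E' n t u) := by
    intro u
    rw [← mul_add]
    refine mul_le_mul_of_nonneg_left ?_ (seqProb_nonneg μ u)
    exact (ind_mono fun h => not_and_or.mp h).trans (ind_or_le _ _)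
  refine (Finset.sum_le_sum fun u _ => this u).trans ?_
  rw [Finset.sum_add_distrib, mul_add, add_div]
  exact add_le_add (hV n t ht) (hV' n t ht)

lemma concentrated_pos (μ : PMF Ω) :
    Concentrated μ fun n _ u => ∀ i : Fin n, 0 < (μ (u i)).toReal := by
  refine ⟨0, le_rfl, fun n t _ => le_of_eq ?_⟩
  rw [mul_zero, zero_div]
  refine Finset.sum_eq_zero fun u _ => ?_
  by_cases h : ∀ i : Fin n, 0 < (μ (u i)).toReal
  · rw [ind_false (not_not.mpr h), mul_zero]
  · obtain ⟨i, hi⟩ := not_forall.mp h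
    have : (μ (u i)).toReal = 0 := le_antisymm (not_lt.mp hi) ENNReal.toReal_nonneg
    rw [seqProb, Finset.prod_eq_zero (Finset.mem_univ i) this, zero_mul]

/-- The asymptotic equipartition property. -/
lemma concentrated_logDev (μ : PMF Ω) (A : Ω → α) :
    Concentrated μ fun n t u => |logDev (μ.map A) (fun i : Fin n => A (u i))| ≤ t := by
  set φ : Ω → ℝ := fun ω => -Real.logb 2 ((μ.map A) (A ω)).toReal with hφ
  have hm : ∑ ω, (μ ω).toReal * φ ω = entropy (μ.map A) := (rvEntropy_eq μ A).symm
  refine ⟨∑ ω, (μ ω).toReal * (φ ω - ∑ ω, (μ ω).toReal * φ ω) ^ 2,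
    Finset.sum_nonneg fun ω _ => mul_nonneg ENNReal.toReal_nonneg (sq_nonneg _), fun n t ht => ?_⟩
  have hdev := sum_iid_deviation (ι := Fin n) (p := fun ω => (μ ω).toReal)
    (fun _ => ENNReal.toReal_nonneg) (pmf_sum_toReal μ) φ ht
  rw [Fintype.card_fin] at hdev
  refine le_trans (Finset.sum_le_sum fun u _ => ?_) hdev
  -- The logarithm of the product splits only if all factors are nonzero. Sequences with a symbol of
  -- probability zero carry no mass and can be discarded.
  by_cases h : ∀ i : Fin n, 0 < (μ (u i)).toReal
  · refine mul_le_mul_of_nonneg_left (ind_mono fun hu => ?_) (seqProb_nonneg μ u)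
    have : logDev (μ.map A) (fun i => A (u i)) = ∑ i, φ (u i) - n * ∑ ω, (μ ω).toReal * φ ω := by
      rw [logDev, hm, seqProb, Real.logb_prod _ _ fun i _ => (map_pos_of_pos μ A (h i)).ne',
        ← Finset.sum_neg_distrib]
    rw [← this]
    exact not_le.mp hu
  · obtain ⟨i, hi⟩ := not_forall.mp h
    have h0 : (μ (u i)).toReal = 0 := le_antisymm (not_lt.mp hi) ENNReal.toReal_nonneg
    have h1 : seqProb μ u = 0 := Finset.prod_eq_zero (Finset.mem_univ i) h0
    rw [h1, zero_mul]
    exact mul_nonneg (iid_nonneg (fun _ => ENNReal.toReal_nonneg) u) (ind_nonneg _)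

lemma seqProb_map_ne_zero {μ : PMF Ω} (A : Ω → α) {n : ℕ} {u : Fin n → Ω}
    (h : ∀ i, 0 < (μ (u i)).toReal) : seqProb (μ.map A) (fun i => A (u i)) ≠ 0 :=
  Finset.prod_ne_zero_iff.mpr fun i _ => (map_pos_of_pos μ A (h i)).ne'

lemma sum_prod_pair {β γ : Type*} [Fintype β] [Fintype γ] {n : ℕ} (h : Fin n → β → γ → ℝ) :
    ∑ s : (Fin n → β) × (Fin n → γ), ∏ i, h i (s.1 i) (s.2 i) = ∏ i, ∑ x, ∑ y, h i x y := by
  have := sum_prod_fun (ι := Fin n) (β := fun _ => β × γ) (fun i x => h i x.1 x.2)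
  simp_rw [Fintype.sum_prod_type] at this
  rw [← this]
  exact Fintype.sum_equiv (Equiv.arrowProdEquivProdArrow (Fin n) (fun _ => β) fun _ => γ).symm _ _
    fun _ => rfl

end Exponent

lemma pmf_map_equiv {α β : Type*} (p : PMF α) (e : α ≃ β) (b : β) :
    (p.map e) b = p (e.symm b) := by
  classical
  rw [PMF.map_apply, tsum_eq_single (e.symm b)]
  · simp
  · intro a ha
    rw [if_neg]
    intro h
    exact ha (by rw [h]; simp)

/-! Single-letter laws. -/

section Laws

variable {Xf Yf Zf Xb Yb Zb : Type*} [Fintype Xf] [Fintype Yf] [Fintype Zf]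
  [Fintype Xb] [Fintype Yb] [Fintype Zb] (a : SourceAux Xf Yf) (F : DMBC Xf Yf Zf)
  (c : ChannelAux Xb) (B : DMBC Xb Yb Zb)

lemma toReal_law (v : Fin a.cardV) (x : Xf) (y : Yf) (z : Zf) :
    (a.law F (v, x, y, z)).toReal
      = (a.lawX x).toReal * (F x (y, z)).toReal * (a.kernelV y v).toReal := by
  have h : a.law F = (jointPMF a.lawX fun x => jointPMF (F x) fun yz => a.kernelV yz.1).map
      (⟨fun ω => (ω.2.2, ω.1, ω.2.1.1, ω.2.1.2), fun ω => (ω.2.1, (ω.2.2.1, ω.2.2.2), ω.1),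
        fun _ => rfl, fun _ => rfl⟩ : Xf × (Yf × Zf) × Fin a.cardV ≃ Fin a.cardV × Xf × Yf × Zf) := by
    simp only [SourceAux.law, jointPMF, PMF.map, PMF.bind_bind, PMF.pure_bind,
      Function.comp_def, Equiv.coe_fn_mk]
  rw [h, pmf_map_equiv]
  simp only [Equiv.coe_fn_symm_mk]
  rw [jointPMF_apply, jointPMF_apply, ENNReal.toReal_mul, ENNReal.toReal_mul, mul_assoc]

/-- The joint law of `W₂`, `W₁` and the outputs of the backward channel. -/
def outLaw : PMF (Fin c.cardW2 × Fin c.cardW1 × Yb × Zb) :=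
  jointPMF c.lawW2 fun w₂ => jointPMF (c.kernelW1 w₂) fun w₁ => ICCCode.backChannel c B w₁

/-- The law of `Y_b` for given `W₂`. -/
def cloudY (w : Fin c.cardW2) : PMF Yb :=
  ((c.kernelW1 w).bind (ICCCode.backChannel c B)).map Prod.fst

/-- The law of `Z_b` for given `W₂`. -/
def cloudZ (w : Fin c.cardW2) : PMF Zb :=
  ((c.kernelW1 w).bind (ICCCode.backChannel c B)).map Prod.snd

lemma outLaw_eq : outLaw c B = (c.law B).map fun ω => (ω.1, ω.2.1, ω.2.2.2) := by
  simp only [outLaw, ICCCode.backChannel, ChannelAux.law, jointPMF, PMF.map, PMF.bind_bind,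
    PMF.pure_bind, Function.comp_def]

lemma rvEntropy_law {α : Type*} [Fintype α]
    (A : Fin c.cardW2 × Fin c.cardW1 × Yb × Zb → α) :
    rvEntropy (c.law B) (fun ω => A (ω.1, ω.2.1, ω.2.2.2)) = rvEntropy (outLaw c B) A := by
  rw [outLaw_eq, rvEntropy_map]

lemma outLaw_map_W1 : (outLaw c B).map (fun ω => ω.2.1) = c.lawW1 := by
  simp only [outLaw, ChannelAux.lawW1, jointPMF, PMF.map, PMF.bind_bind,
    PMF.pure_bind, Function.comp_def, PMF.bind_const, PMF.bind_pure]

lemma outLaw_map_W2 : (outLaw c B).map (fun ω => ω.1) = c.lawW2 := by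
  simp only [outLaw, jointPMF, PMF.map, PMF.bind_bind,
    PMF.pure_bind, Function.comp_def, PMF.bind_const, PMF.bind_pure]

lemma outLaw_map_W1Y : (outLaw c B).map (fun ω => (ω.2.1, ω.2.2.1)) = c.lawW1Y B := by
  rw [outLaw_eq, PMF.map_comp]; rfl

lemma outLaw_map_W1Y_eq : (outLaw c B).map (fun ω => (ω.2.1, ω.2.2.1))
    = jointPMF c.lawW1 fun w => (ICCCode.backChannel c B w).map Prod.fst := by
  simp only [outLaw, ChannelAux.lawW1, jointPMF, PMF.map, PMF.bind_bind,
    PMF.pure_bind, Function.comp_def]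

lemma outLaw_map_W2Y : (outLaw c B).map (fun ω => (ω.1, ω.2.2.1))
    = jointPMF c.lawW2 (cloudY c B) := by
  simp only [outLaw, cloudY, jointPMF, PMF.map, PMF.bind_bind, PMF.pure_bind, Function.comp_def]

lemma outLaw_map_W2Z : (outLaw c B).map (fun ω => (ω.1, ω.2.2.2))
    = jointPMF c.lawW2 (cloudZ c B) := by
  simp only [outLaw, cloudZ, jointPMF, PMF.map, PMF.bind_bind, PMF.pure_bind, Function.comp_def]

lemma outLaw_map_Y : (outLaw c B).map (fun ω => ω.2.2.1) = c.lawW2.bind fun w => cloudY c B w := by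
  simp only [outLaw, cloudY, jointPMF, PMF.map, PMF.bind_bind, PMF.pure_bind, Function.comp_def]

lemma outLaw_map_W2W1 : (outLaw c B).map (fun ω => (ω.1, ω.2.1))
    = jointPMF c.lawW2 c.kernelW1 := by
  simp only [outLaw, jointPMF, PMF.map, PMF.bind_bind, PMF.pure_bind, Function.comp_def,
    PMF.bind_const]

lemma outLaw_map_W2W1Y : (outLaw c B).map (fun ω => (ω.1, ω.2.1, ω.2.2.1))
    = jointPMF c.lawW2 fun w₂ => jointPMF (c.kernelW1 w₂) fun w₁ =>
      (ICCCode.backChannel c B w₁).map Prod.fst := by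
  simp only [outLaw, jointPMF, PMF.map, PMF.bind_bind, PMF.pure_bind, Function.comp_def]

lemma outLaw_map_W2W1Z : (outLaw c B).map (fun ω => (ω.1, ω.2.1, ω.2.2.2))
    = jointPMF c.lawW2 fun w₂ => jointPMF (c.kernelW1 w₂) fun w₁ =>
      (ICCCode.backChannel c B w₁).map Prod.snd := by
  simp only [outLaw, jointPMF, PMF.map, PMF.bind_bind, PMF.pure_bind, Function.comp_def]

lemma law_map_Y : (a.law F).map (fun ω => ω.2.2.1) = (a.lawX.bind F).map Prod.fst := by
  simp only [SourceAux.law, PMF.map, PMF.bind_bind, PMF.pure_bind, Function.comp_def,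
    PMF.bind_const]

end Laws

end

section

/-! Memoryless kernels on sequences. -/

section Kernel

variable {α β γ : Type*} [Fintype α] [Fintype β] [Fintype γ] {n : ℕ}

/-- The probability of an output sequence of a memoryless channel. -/
def kerProb {α β : Type*} (κ : α → PMF β) {n : ℕ} (u : Fin n → α) (y : Fin n → β) : ℝ :=
  ∏ i, (κ (u i) (y i)).toReal

lemma kerProb_nonneg {α β : Type*} (κ : α → PMF β) {n : ℕ} (u : Fin n → α) (y : Fin n → β) :
    0 ≤ kerProb κ u y := Finset.prod_nonneg fun _ _ => ENNReal.toReal_nonneg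

lemma kerProb_le_one {α β : Type*} (κ : α → PMF β) {n : ℕ} (u : Fin n → α) (y : Fin n → β) :
    kerProb κ u y ≤ 1 :=
  Finset.prod_le_one (fun _ _ => ENNReal.toReal_nonneg) fun i _ =>
    ENNReal.toReal_le_of_le_ofReal zero_le_one (by simpa using (κ (u i)).coe_le_one (y i))

lemma toReal_useChannel (κ : α → PMF β) (u : Fin n → α) (y : Fin n → β) :
    (useChannel κ u y).toReal = kerProb κ u y := toReal_indepSeq _ _

lemma sum_kerProb (κ : α → PMF β) (u : Fin n → α) : ∑ y, kerProb κ u y = 1 := by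
  simp_rw [← toReal_useChannel]
  exact pmf_sum_toReal _

lemma toReal_bind (p : PMF α) (κ : α → PMF β) (b : β) :
    (p.bind κ b).toReal = ∑ a, (p a).toReal * (κ a b).toReal := by
  rw [PMF.bind_apply, tsum_fintype, ENNReal.toReal_sum]
  · simp_rw [ENNReal.toReal_mul]
  · exact fun a _ => ENNReal.mul_ne_top (p.apply_ne_top a) ((κ a).apply_ne_top b)

lemma sum_seqProb_mul_kerProb (p : PMF α) (κ : α → PMF β) (y : Fin n → β) :
    ∑ u, seqProb p u * kerProb κ u y = seqProb (p.bind κ) y := by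
  simp only [seqProb, kerProb, ← Finset.prod_mul_distrib, toReal_bind]
  exact sum_prod_fun (fun i a => (p a).toReal * (κ a (y i)).toReal)

lemma sum_kerProb_mul_kerProb (κ : γ → PMF α) (κ' : α → PMF β) (w : Fin n → γ) (y : Fin n → β) :
    ∑ u, kerProb κ w u * kerProb κ' u y = kerProb (fun w => (κ w).bind κ') w y := by
  simp only [kerProb, ← Finset.prod_mul_distrib, toReal_bind]
  exact sum_prod_fun (fun i a => (κ (w i) a).toReal * (κ' a (y i)).toReal)

lemma seqProb_joint (p : PMF α) (κ : α → PMF β) (u : Fin n → α) (y : Fin n → β) :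
    seqProb (jointPMF p κ) (fun i => (u i, y i)) = seqProb p u * kerProb κ u y := by
  simp only [seqProb, kerProb, ← Finset.prod_mul_distrib, jointPMF_apply, ENNReal.toReal_mul]

lemma seqProb_joint_joint {δ : Type*} (p : PMF α) (κ : α → PMF β) (κ' : β → PMF δ)
    (u : Fin n → α) (v : Fin n → β) (y : Fin n → δ) :
    seqProb (jointPMF p fun a => jointPMF (κ a) κ') (fun i => (u i, v i, y i))
      = seqProb p u * kerProb κ u v * kerProb κ' v y := by
  simp only [seqProb, kerProb, ← Finset.prod_mul_distrib, jointPMF_apply, ENNReal.toReal_mul,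
    mul_assoc]

/-- The first part of a sequence. -/
def head {α : Type*} {k d : ℕ} (t : Fin (k + d) → α) : Fin k → α := fun i => t (Fin.castAdd d i)

/-- The second part of a sequence. -/
def tail {α : Type*} {k d : ℕ} (t : Fin (k + d) → α) : Fin d → α := fun i => t (Fin.natAdd k i)

lemma append_head_tail {α : Type*} {k d : ℕ} (t : Fin (k + d) → α) :
    Fin.append (head t) (tail t) = t := Fin.append_castAdd_natAdd

lemma kerProb_append {k d : ℕ} (κ : α → PMF β) (u : Fin k → α) (v : Fin d → α)
    (t : Fin (k + d) → β) :
    kerProb κ (Fin.append u v) t = kerProb κ u (head t) * kerProb κ v (tail t) := by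
  simp [kerProb, Fin.prod_univ_add, head, tail]

lemma sum_head_mul_tail {k d : ℕ} (φ : (Fin k → β) → ℝ) (ψ : (Fin d → β) → ℝ) :
    ∑ t : Fin (k + d) → β, φ (head t) * ψ (tail t) = (∑ u, φ u) * ∑ v, ψ v := by
  rw [Finset.sum_mul_sum, ← Fintype.sum_prod_type']
  refine (Fintype.sum_equiv (Fin.appendEquiv k d) _ _ fun x => ?_).symm
  congr 2
  · funext i; simp [head, Fin.appendEquiv]
  · funext i; simp [tail, Fin.appendEquiv]

lemma zip_append {α β : Type*} {k d : ℕ} (u : Fin k → α) (v : Fin d → α) (y : Fin (k + d) → β) :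
    (fun i => (Fin.append u v i, y i))
      = Fin.append (fun i => (u i, head y i)) (fun i => (v i, tail y i)) := by
  funext i
  refine Fin.addCases (fun i => ?_) (fun i => ?_) i <;> simp [head, tail]

/-- When r is a joint law with marginals p and q, the bracket multiplied by n is their mutual
information. All exponents of likelihood ratios between sequences come from this formula, up to the
deviations that typicality controls. -/
lemma ratio_eq_rpow {p : PMF α} {q : PMF β} {r : PMF γ} {u : Fin n → α} {v : Fin n → β}
    {w : Fin n → γ} (hp : seqProb p u ≠ 0) (hq : seqProb q v ≠ 0) (hr : seqProb r w ≠ 0) :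
    seqProb r w / (seqProb p u * seqProb q v)
      = 2 ^ (n * (entropy p + entropy q - entropy r) + (logDev p u + logDev q v - logDev r w)) := by
  rw [seqProb_eq_rpow hp, seqProb_eq_rpow hq, seqProb_eq_rpow hr, ← Real.rpow_add (by norm_num),
    ← Real.rpow_sub (by norm_num)]
  congr 1
  ring

end Kernel

/-! Marginal laws. -/

section Marginals

variable {Xf Yf Zf Xb Yb Zb : Type*} [Fintype Xf] [Fintype Yf] [Fintype Zf]
  [Fintype Xb] [Fintype Yb] [Fintype Zb] (a : SourceAux Xf Yf) (F : DMBC Xf Yf Zf)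
  (c : ChannelAux Xb) (B : DMBC Xb Yb Zb)

/-- `P_{X_f}`. -/
def srcX : PMF Xf := (a.law F).map fun ω => ω.2.1

/-- `P_{Y_f}`. -/
def srcY : PMF Yf := (a.law F).map fun ω => ω.2.2.1

/-- `P_{Z_f}`. -/
def srcZ : PMF Zf := (a.law F).map fun ω => ω.2.2.2

/-- `P_{V, Z_f}`. -/
def srcVZ : PMF (Fin a.cardV × Zf) := (a.law F).map fun ω => (ω.1, ω.2.2.2)

/-- `P_{Y_b}`. -/
def outY : PMF Yb := (outLaw c B).map fun ω => ω.2.2.1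

/-- `P_{W₂, Y_b}`. -/
def outW2Y : PMF (Fin c.cardW2 × Yb) := (outLaw c B).map fun ω => (ω.1, ω.2.2.1)

/-- `P_{W₂, Z_b}`. -/
def outW2Z : PMF (Fin c.cardW2 × Zb) := (outLaw c B).map fun ω => (ω.1, ω.2.2.2)

/-- `P_{W₂, W₁}`. -/
def outW2W1 : PMF (Fin c.cardW2 × Fin c.cardW1) := (outLaw c B).map fun ω => (ω.1, ω.2.1)

/-- `P_{W₂, W₁, Z_b}`. -/
def outW2W1Z : PMF (Fin c.cardW2 × Fin c.cardW1 × Zb) :=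
  (outLaw c B).map fun ω => (ω.1, ω.2.1, ω.2.2.2)

/-- The sequence is typical for all marginals of the first round. -/
def SrcTypical (n : ℕ) (t : ℝ) (u : Fin n → Fin a.cardV × Xf × Yf × Zf) : Prop :=
  (∀ i, 0 < (a.law F (u i)).toReal) ∧
  |logDev (a.lawV F) fun i => (u i).1| ≤ t ∧
  |logDev (srcX a F) fun i => (u i).2.1| ≤ t ∧
  |logDev (srcY a F) fun i => (u i).2.2.1| ≤ t ∧
  |logDev (srcZ a F) fun i => (u i).2.2.2| ≤ t ∧
  |logDev (a.lawVX F) fun i => ((u i).1, (u i).2.1)| ≤ t ∧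
  |logDev (a.lawVY F) fun i => ((u i).1, (u i).2.2.1)| ≤ t ∧
  |logDev (srcVZ a F) fun i => ((u i).1, (u i).2.2.2)| ≤ t

/-- The sequence is typical for all marginals of the second round. -/
def ChnTypical (n : ℕ) (t : ℝ) (u : Fin n → Fin c.cardW2 × Fin c.cardW1 × Yb × Zb) : Prop :=
  (∀ i, 0 < (outLaw c B (u i)).toReal) ∧
  |logDev c.lawW2 fun i => (u i).1| ≤ t ∧
  |logDev c.lawW1 fun i => (u i).2.1| ≤ t ∧
  |logDev (outY c B) fun i => (u i).2.2.1| ≤ t ∧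
  |logDev (c.lawW1Y B) fun i => ((u i).2.1, (u i).2.2.1)| ≤ t ∧
  |logDev (outW2Y c B) fun i => ((u i).1, (u i).2.2.1)| ≤ t ∧
  |logDev (outW2Z c B) fun i => ((u i).1, (u i).2.2.2)| ≤ t ∧
  |logDev (outW2W1 c B) fun i => ((u i).1, (u i).2.1)| ≤ t ∧
  |logDev (outW2W1Z c B) fun i => ((u i).1, (u i).2.1, (u i).2.2.2)| ≤ t

lemma concentrated_srcTypical : Concentrated (a.law F) (SrcTypical a F) :=
  (concentrated_pos _).and <| (concentrated_logDev _ _).and <| (concentrated_logDev _ _).and <|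
    (concentrated_logDev _ _).and <| (concentrated_logDev _ _).and <|
    (concentrated_logDev _ _).and <| (concentrated_logDev _ _).and <| concentrated_logDev _ _

lemma concentrated_chnTypical : Concentrated (outLaw c B) (ChnTypical c B) := by
  have h1 := concentrated_logDev (outLaw c B) fun ω => ω.1
  have h2 := concentrated_logDev (outLaw c B) fun ω => ω.2.1
  have h3 := concentrated_logDev (outLaw c B) fun ω => (ω.2.1, ω.2.2.1)
  rw [outLaw_map_W2] at h1
  rw [outLaw_map_W1] at h2
  rw [outLaw_map_W1Y] at h3
  exact (concentrated_pos _).and <| h1.and <| h2.and <|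
    (concentrated_logDev _ _).and <| h3.and <| (concentrated_logDev _ _).and <|
    (concentrated_logDev _ _).and <| (concentrated_logDev _ _).and <| concentrated_logDev _ _

lemma lawVX_map_fst : (a.lawVX F).map Prod.fst = a.lawV F := by
  rw [SourceAux.lawVX, PMF.map_comp]; rfl

lemma lawVX_map_snd : (a.lawVX F).map Prod.snd = srcX a F := by
  rw [SourceAux.lawVX, PMF.map_comp]; rfl

lemma lawVY_map_fst : (a.lawVY F).map Prod.fst = a.lawV F := by
  rw [SourceAux.lawVY, PMF.map_comp]; rfl

lemma lawVY_map_snd : (a.lawVY F).map Prod.snd = srcY a F := by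
  rw [SourceAux.lawVY, PMF.map_comp]; rfl

lemma lawW1Y_map_fst : (c.lawW1Y B).map Prod.fst = c.lawW1 := by
  rw [← outLaw_map_W1Y, PMF.map_comp, ← outLaw_map_W1 c B]; rfl

lemma lawW1Y_map_snd : (c.lawW1Y B).map Prod.snd = outY c B := by
  rw [← outLaw_map_W1Y, PMF.map_comp]; rfl

lemma outY_eq : outY c B = c.lawW2.bind (cloudY c B) := outLaw_map_Y c B

variable {n : ℕ}

lemma seqProb_lawVY (v : Fin n → Fin a.cardV) (y : Fin n → Yf) :
    seqProb (a.lawVY F) (fun i => (v i, y i)) = seqProb (srcY a F) y * kerProb a.kernelV y v := by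
  simp only [seqProb, kerProb, ← Finset.prod_mul_distrib, ICCCode.lawVY_eq, srcY, law_map_Y]

lemma likelihood_eq (v : Fin n → Fin a.cardV) (y : Fin n → Yf) :
    ICCCode.likelihood a F v y = kerProb a.kernelV y v / seqProb (a.lawV F) v :=
  Finset.prod_div_distrib _ _

lemma seqProb_lawW1Y (p : Fin n → Fin c.cardW1) (y : Fin n → Yb) :
    seqProb (c.lawW1Y B) (fun i => (p i, y i))
      = seqProb c.lawW1 p * kerProb (fun w => (ICCCode.backChannel c B w).map Prod.fst) p y := by
  rw [← outLaw_map_W1Y, outLaw_map_W1Y_eq, seqProb_joint]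

lemma seqProb_outW2Y (w : Fin n → Fin c.cardW2) (y : Fin n → Yb) :
    seqProb (outW2Y c B) (fun i => (w i, y i))
      = seqProb c.lawW2 w * kerProb (cloudY c B) w y := by
  rw [outW2Y, outLaw_map_W2Y, seqProb_joint]

lemma seqProb_outW2Z (w : Fin n → Fin c.cardW2) (z : Fin n → Zb) :
    seqProb (outW2Z c B) (fun i => (w i, z i))
      = seqProb c.lawW2 w * kerProb (cloudZ c B) w z := by
  rw [outW2Z, outLaw_map_W2Z, seqProb_joint]

lemma seqProb_outW2W1 (w : Fin n → Fin c.cardW2) (p : Fin n → Fin c.cardW1) :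
    seqProb (outW2W1 c B) (fun i => (w i, p i))
      = seqProb c.lawW2 w * kerProb c.kernelW1 w p := by
  rw [outW2W1, outLaw_map_W2W1, seqProb_joint]

lemma seqProb_outW2W1Z (w : Fin n → Fin c.cardW2) (p : Fin n → Fin c.cardW1) (z : Fin n → Zb) :
    seqProb (outW2W1Z c B) (fun i => (w i, p i, z i))
      = seqProb c.lawW2 w * kerProb c.kernelW1 w p *
        kerProb (fun w => (ICCCode.backChannel c B w).map Prod.snd) p z := by
  rw [outW2W1Z, outLaw_map_W2W1Z, seqProb_joint_joint]

lemma seqProb_outLaw (w : Fin n → Fin c.cardW2) (p : Fin n → Fin c.cardW1)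
    (t : Fin n → Yb × Zb) :
    seqProb (outLaw c B) (fun i => (w i, p i, t i))
      = seqProb c.lawW2 w * kerProb c.kernelW1 w p * kerProb (ICCCode.backChannel c B) p t := by
  rw [outLaw, seqProb_joint_joint]

lemma seqProb_law (v : Fin n → Fin a.cardV) (s : (Fin n → Xf) × (Fin n → Yf × Zf)) :
    seqProb (a.law F) (fun i => (v i, s.1 i, s.2 i))
      = ICCCode.firstLaw a F s * kerProb a.kernelV (ICCCode.received s) v := by
  simp only [seqProb, ICCCode.firstLaw, toReal_indepSeq, toReal_useChannel, kerProb,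
    ← Finset.prod_mul_distrib, ICCCode.received]
  exact Finset.prod_congr rfl fun i _ => toReal_law a F _ _ _ _

lemma sum_lawVX (x : Fin n → Xf) :
    ∑ v : Fin n → Fin a.cardV, seqProb (a.lawVX F) (fun i => (v i, x i)) = seqProb (srcX a F) x := by
  refine (sum_prod_fun (fun i v => (a.lawVX F (v, x i)).toReal)).trans ?_
  exact Finset.prod_congr rfl fun i _ =>
    sum_map_pair_left (a.law F) (fun ω => ω.1) (fun ω => ω.2.1) (x i)

/-- Weighting the first-round law by the likelihood ratio of v yields the conditional law given V =
v, because V depends on the rest only through Y_f. Summing over the other variables leaves the law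
of Z_f given v. -/
lemma sum_firstLaw_likelihood_view (v : Fin n → Fin a.cardV) (z : Fin n → Zf) :
    ∑ s : (Fin n → Xf) × (Fin n → Yf × Zf), ICCCode.firstLaw a F s *
        ICCCode.likelihood a F v (ICCCode.received s) * ind ((fun i => (s.2 i).2) = z)
      = seqProb (srcVZ a F) (fun i => (v i, z i)) / seqProb (a.lawV F) v := by
  have h : ∀ s : (Fin n → Xf) × (Fin n → Yf × Zf), ICCCode.firstLaw a F s *
        ICCCode.likelihood a F v (ICCCode.received s) * ind ((fun i => (s.2 i).2) = z)
      = (∏ i, (a.law F (v i, s.1 i, s.2 i)).toReal * ind ((s.2 i).2 = z i))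
          / seqProb (a.lawV F) v := by
    intro s
    have hi : ind ((fun i => (s.2 i).2) = z) = ∏ i, ind ((s.2 i).2 = z i) := by
      by_cases h : (fun i => (s.2 i).2) = z
      · rw [ind_true h, Finset.prod_eq_one]
        exact fun i _ => ind_true (congrFun h i)
      · obtain ⟨i, hi⟩ := Function.ne_iff.mp h
        rw [ind_false h, Finset.prod_eq_zero (Finset.mem_univ i) (ind_false hi)]
    rw [hi, Finset.prod_mul_distrib, likelihood_eq,
      show ∏ i, (a.law F (v i, s.1 i, s.2 i)).toReal = _ from seqProb_law a F v s]
    ring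
  simp_rw [h]
  rw [← Finset.sum_div, sum_prod_pair (fun i x yz => (a.law F (v i, x, yz)).toReal *
    ind (yz.2 = z i))]
  congr 1
  refine Finset.prod_congr rfl fun i _ => ?_
  rw [srcVZ, toReal_map, Fintype.sum_prod_type, Finset.sum_eq_single (v i)]
  · rw [Fintype.sum_prod_type]
    refine Finset.sum_congr rfl fun x _ => Finset.sum_congr rfl fun yz _ => ?_
    congr 2
    simp
  · intro v' _ hv'
    refine Finset.sum_eq_zero fun r _ => ?_
    rw [ind_false, mul_zero]
    simp [hv']
  · simp

lemma sum_kerProb_view {α β γ : Type*} [Fintype α] [Fintype β] [Fintype γ] (κ : α → PMF (β × γ))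
    (p : Fin n → α) (z : Fin n → γ) :
    ∑ t, kerProb κ p t * ind ((fun i => (t i).2) = z)
      = kerProb (fun w => (κ w).map Prod.snd) p z := by
  have h : ∀ t : Fin n → β × γ, kerProb κ p t * ind ((fun i => (t i).2) = z)
      = ∏ i, (κ (p i) (t i)).toReal * ind ((t i).2 = z i) := by
    intro t
    rw [Finset.prod_mul_distrib]
    congr 1
    by_cases h : (fun i => (t i).2) = z
    · rw [ind_true h, Finset.prod_eq_one]
      exact fun i _ => ind_true (congrFun h i)
    · obtain ⟨i, hi⟩ := Function.ne_iff.mp h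
      rw [ind_false h, Finset.prod_eq_zero (Finset.mem_univ i) (ind_false hi)]
  simp_rw [h]
  rw [sum_prod_fun (fun i yz => (κ (p i) yz).toReal * ind (yz.2 = z i))]
  exact Finset.prod_congr rfl fun i _ => (toReal_map _ _ _).symm

end Marginals

end

section

/-! Random codes of a given block length. -/

variable {Xf Yf Zf Xb Yb Zb : Type*} [Fintype Xf] [Fintype Yf] [Fintype Zf]
  [Fintype Xb] [Fintype Yb] [Fintype Zb]

/-- Block lengths, tolerances and the common information word of an ensemble of codes. -/
structure Ensemble (F : DMBC Xf Yf Zf) (B : DMBC Xb Yb Zb) where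
  /-- auxiliary variables of the first round -/
  src : SourceAux Xf Yf
  /-- auxiliary variables of the second round -/
  chn : ChannelAux Xb
  /-- number of uses of the forward channel -/
  n : ℕ
  /-- length of the information words -/
  k : ℕ
  /-- length of the parity-check words -/
  d : ℕ
  n_pos : 0 < n
  k_pos : 0 < k
  /-- typicality parameter of the protocol -/
  ε : ℝ
  ε_pos : 0 < ε
  /-- tolerance for the true sequences -/
  t : ℝ
  /-- bound for the contribution of the information words -/
  C : ℝ
  /-- the information word -/
  w₀ : Fin k → Fin chn.cardW1
  w₀_typical : IsTypical chn.lawW1 ε w₀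
  dev_le : ∀ (u : Fin k → Fin chn.cardW1) (y : Fin k → Yb), |logDev chn.lawW1 u|
    + |logDev (outY chn B) y| + |logDev (chn.lawW1Y B) fun i => (u i, y i)| ≤ C
  t_lt : t < n * ε
  two_t_lt : 2 * t + C < (n + (k + d : ℕ)) * ε
  half_le : 1 / 2 ≤ ∑ v : Fin n → Fin src.cardV,
    seqProb (src.lawV F) v * ind (IsTypical (src.lawV F) ε v)

/-- `I(V ; X_f)` in terms of the marginal laws. -/
def infoVX (a : SourceAux Xf Yf) (F : DMBC Xf Yf Zf) : ℝ :=
  entropy (a.lawV F) + entropy (srcX a F) - entropy (a.lawVX F)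

/-- `I(V ; Y_f)` in terms of the marginal laws. -/
def infoVY (a : SourceAux Xf Yf) (F : DMBC Xf Yf Zf) : ℝ :=
  entropy (a.lawV F) + entropy (srcY a F) - entropy (a.lawVY F)

/-- `I(V ; Z_f)` in terms of the marginal laws. -/
def infoVZ (a : SourceAux Xf Yf) (F : DMBC Xf Yf Zf) : ℝ :=
  entropy (a.lawV F) + entropy (srcZ a F) - entropy (srcVZ a F)

/-- `I(W₁ ; Y_b)` in terms of the marginal laws. -/
def infoW1Y (c : ChannelAux Xb) (B : DMBC Xb Yb Zb) : ℝ :=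
  entropy c.lawW1 + entropy (outY c B) - entropy (c.lawW1Y B)

/-- `I(W₂ ; Y_b)` in terms of the marginal laws. -/
def infoW2Y (c : ChannelAux Xb) (B : DMBC Xb Yb Zb) : ℝ :=
  entropy c.lawW2 + entropy (outY c B) - entropy (outW2Y c B)

/-- `I(W₁ ; Z_b | W₂)` in terms of the marginal laws. -/
def infoW1ZW2 (c : ChannelAux Xb) (B : DMBC Xb Yb Zb) : ℝ :=
  entropy (outW2W1 c B) + entropy (outW2Z c B) - entropy (outW2W1Z c B) - entropy c.lawW2

/-! ### Sums over words weighted by likelihood ratios. -/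

section Weights

variable (a : SourceAux Xf Yf) (F : DMBC Xf Yf Zf) {n : ℕ}

/-- Equality holds except for words of probability zero, where the quotient in the likelihood ratio
is 0. -/
lemma seqProb_lawV_mul_likelihood_le (v : Fin n → Fin a.cardV) (y : Fin n → Yf) :
    seqProb (a.lawV F) v * ICCCode.likelihood a F v y ≤ kerProb a.kernelV y v := by
  rw [likelihood_eq]
  by_cases h : seqProb (a.lawV F) v = 0
  · rw [h, zero_mul]; exact kerProb_nonneg _ _ _
  · rw [mul_div_cancel₀ _ h]

lemma sum_seqProb_law (v : Fin n → Fin a.cardV) :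
    ∑ s : (Fin n → Xf) × (Fin n → Yf × Zf), seqProb (a.law F) (fun i => (v i, s.1 i, s.2 i))
      = seqProb (a.lawV F) v := by
  refine (sum_prod_pair (fun i x yz => (a.law F (v i, x, yz)).toReal)).trans ?_
  refine Finset.prod_congr rfl fun i _ => ?_
  rw [SourceAux.lawV, toReal_map, Fintype.sum_prod_type, Finset.sum_eq_single (v i)]
  · rw [Fintype.sum_prod_type]
    refine Finset.sum_congr rfl fun x _ => Finset.sum_congr rfl fun yz _ => ?_
    rw [ind_true rfl, mul_one]
  · intro v' _ hv'
    exact Finset.sum_eq_zero fun r _ => by rw [ind_false (by simpa using hv'), mul_zero]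
  · simp

lemma sum_firstLaw : ∑ s : (Fin n → Xf) × (Fin n → Yf × Zf), ICCCode.firstLaw a F s = 1 := by
  rw [Fintype.sum_prod_type]
  simp_rw [ICCCode.firstLaw, ← Finset.mul_sum, pmf_sum_toReal, mul_one]
  exact pmf_sum_toReal _

/-- Sums over all words of the first round. -/
lemma sum_word_firstLaw (φ : (Fin n → Fin a.cardV × Xf × Yf × Zf) → ℝ) :
    ∑ v : Fin n → Fin a.cardV, ∑ s : (Fin n → Xf) × (Fin n → Yf × Zf),
        ICCCode.firstLaw a F s * kerProb a.kernelV (ICCCode.received s) v *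
          φ (fun i => (v i, s.1 i, s.2 i))
      = ∑ u, seqProb (a.law F) u * φ u := by
  simp_rw [← seqProb_law]
  rw [← Fintype.sum_prod_type']
  refine Fintype.sum_equiv
    ((Equiv.refl _).prodCongr (Equiv.arrowProdEquivProdArrow (Fin n) (fun _ => Xf)
      fun _ => Yf × Zf).symm |>.trans
      (Equiv.arrowProdEquivProdArrow (Fin n) (fun _ => Fin a.cardV)
        fun _ => Xf × Yf × Zf).symm) _ _ fun x => rfl

lemma sum_cloud_word (c : ChannelAux Xb) (B : DMBC Xb Yb Zb)
    (φ : (Fin n → Fin c.cardW2 × Fin c.cardW1 × Yb × Zb) → ℝ) :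
    ∑ w : Fin n → Fin c.cardW2, seqProb c.lawW2 w * ∑ p : Fin n → Fin c.cardW1,
        kerProb c.kernelW1 w p * ∑ t : Fin n → Yb × Zb,
          kerProb (ICCCode.backChannel c B) p t * φ (fun i => (w i, p i, t i))
      = ∑ u, seqProb (outLaw c B) u * φ u := by
  simp_rw [Finset.mul_sum, ← mul_assoc, ← seqProb_outLaw]
  have h : ∀ w : Fin n → Fin c.cardW2, ∑ p : Fin n → Fin c.cardW1, ∑ t : Fin n → Yb × Zb,
      seqProb (outLaw c B) (fun i => (w i, p i, t i)) * φ (fun i => (w i, p i, t i))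
      = ∑ s : (Fin n → Fin c.cardW1) × (Fin n → Yb × Zb),
        seqProb (outLaw c B) (fun i => (w i, s.1 i, s.2 i)) * φ (fun i => (w i, s.1 i, s.2 i)) :=
    fun w => by rw [Fintype.sum_prod_type]
  simp_rw [h]
  rw [← Fintype.sum_prod_type']
  refine Fintype.sum_equiv
    ((Equiv.refl _).prodCongr (Equiv.arrowProdEquivProdArrow (Fin n) (fun _ => Fin c.cardW1)
      fun _ => Yb × Zb).symm |>.trans
      (Equiv.arrowProdEquivProdArrow (Fin n) (fun _ => Fin c.cardW2)
        fun _ => Fin c.cardW1 × Yb × Zb).symm) _ _ fun x => rfl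

end Weights

lemma seqProb_ne_zero_of_map {Ω α : Type*} [Fintype Ω] [Fintype α] {μ : PMF Ω} (A : Ω → α)
    {n : ℕ} {u : Fin n → Ω} (h : ∀ i, 0 < (μ (u i)).toReal) {q : PMF α} (hq : μ.map A = q)
    {x : Fin n → α} (hx : ∀ i, A (u i) = x i) : seqProb q x ≠ 0 := by
  obtain rfl : (fun i => A (u i)) = x := funext hx
  rw [← hq]
  exact seqProb_map_ne_zero A h

lemma SrcTypical.ne_zero {a : SourceAux Xf Yf} {F : DMBC Xf Yf Zf} {n : ℕ} {t : ℝ}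
    {v : Fin n → Fin a.cardV} {x : Fin n → Xf} {yz : Fin n → Yf × Zf}
    (h : SrcTypical a F n t (fun i => (v i, x i, yz i))) :
    seqProb (a.lawV F) v ≠ 0 ∧ seqProb (srcX a F) x ≠ 0 ∧
    seqProb (srcY a F) (fun i => (yz i).1) ≠ 0 ∧ seqProb (srcZ a F) (fun i => (yz i).2) ≠ 0 ∧
    seqProb (a.lawVX F) (fun i => (v i, x i)) ≠ 0 ∧
    seqProb (a.lawVY F) (fun i => (v i, (yz i).1)) ≠ 0 ∧
    seqProb (srcVZ a F) (fun i => (v i, (yz i).2)) ≠ 0 := by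
  have h0 : ∀ i, 0 < (a.law F (v i, x i, yz i)).toReal := h.1
  set u := fun i => (v i, x i, yz i) with hu
  exact ⟨seqProb_ne_zero_of_map (μ := a.law F) (u := u) (fun ω => ω.1) h0 rfl fun _ => rfl,
    seqProb_ne_zero_of_map (μ := a.law F) (u := u) (fun ω => ω.2.1) h0 rfl fun _ => rfl,
    seqProb_ne_zero_of_map (μ := a.law F) (u := u) (fun ω => ω.2.2.1) h0 rfl fun _ => rfl,
    seqProb_ne_zero_of_map (μ := a.law F) (u := u) (fun ω => ω.2.2.2) h0 rfl fun _ => rfl,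
    seqProb_ne_zero_of_map (μ := a.law F) (u := u) (fun ω => (ω.1, ω.2.1)) h0 rfl fun _ => rfl,
    seqProb_ne_zero_of_map (μ := a.law F) (u := u) (fun ω => (ω.1, ω.2.2.1)) h0 rfl fun _ => rfl,
    seqProb_ne_zero_of_map (μ := a.law F) (u := u) (fun ω => (ω.1, ω.2.2.2)) h0 rfl fun _ => rfl⟩

lemma ChnTypical.ne_zero {c : ChannelAux Xb} {B : DMBC Xb Yb Zb} {n : ℕ} {t : ℝ}
    {w : Fin n → Fin c.cardW2} {p : Fin n → Fin c.cardW1} {yz : Fin n → Yb × Zb}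
    (h : ChnTypical c B n t (fun i => (w i, p i, yz i))) :
    seqProb c.lawW2 w ≠ 0 ∧ seqProb c.lawW1 p ≠ 0 ∧
    seqProb (outY c B) (fun i => (yz i).1) ≠ 0 ∧
    seqProb (c.lawW1Y B) (fun i => (p i, (yz i).1)) ≠ 0 ∧
    seqProb (outW2Y c B) (fun i => (w i, (yz i).1)) ≠ 0 ∧
    seqProb (outW2Z c B) (fun i => (w i, (yz i).2)) ≠ 0 ∧
    seqProb (outW2W1 c B) (fun i => (w i, p i)) ≠ 0 ∧
    seqProb (outW2W1Z c B) (fun i => (w i, p i, (yz i).2)) ≠ 0 := by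
  have h0 : ∀ i, 0 < (outLaw c B (w i, p i, yz i)).toReal := h.1
  set u := fun i => (w i, p i, yz i) with hu
  exact ⟨seqProb_ne_zero_of_map (μ := outLaw c B) (u := u) (fun ω => ω.1) h0 (outLaw_map_W2 c B) fun _ => rfl,
    seqProb_ne_zero_of_map (μ := outLaw c B) (u := u) (fun ω => ω.2.1) h0 (outLaw_map_W1 c B) fun _ => rfl,
    seqProb_ne_zero_of_map (μ := outLaw c B) (u := u) (fun ω => ω.2.2.1) h0 rfl fun _ => rfl,
    seqProb_ne_zero_of_map (μ := outLaw c B) (u := u) (fun ω => (ω.2.1, ω.2.2.1)) h0 (outLaw_map_W1Y c B) fun _ => rfl,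
    seqProb_ne_zero_of_map (μ := outLaw c B) (u := u) (fun ω => (ω.1, ω.2.2.1)) h0 rfl fun _ => rfl,
    seqProb_ne_zero_of_map (μ := outLaw c B) (u := u) (fun ω => (ω.1, ω.2.2.2)) h0 rfl fun _ => rfl,
    seqProb_ne_zero_of_map (μ := outLaw c B) (u := u) (fun ω => (ω.1, ω.2.1)) h0 rfl fun _ => rfl,
    seqProb_ne_zero_of_map (μ := outLaw c B) (u := u) (fun ω => (ω.1, ω.2.1, ω.2.2.2)) h0 rfl fun _ => rfl⟩

namespace Ensemble

variable {F : DMBC Xf Yf Zf} {B : DMBC Xb Yb Zb} (E : Ensemble F B)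

/-- The probability of the typical words of the first round. -/
def typicalMass : ℝ :=
  ∑ v : Fin E.n → Fin E.src.cardV, seqProb (E.src.lawV F) v * ind (IsTypical (E.src.lawV F) E.ε v)

lemma typicalMass_pos : 0 < E.typicalMass := lt_of_lt_of_le (by norm_num) E.half_le

/-- The law of the words of the first round, conditioned on typicality. -/
def wordLaw (v : Fin E.n → Fin E.src.cardV) : ℝ :=
  seqProb (E.src.lawV F) v * ind (IsTypical (E.src.lawV F) E.ε v) / E.typicalMass

lemma wordLaw_nonneg (v : Fin E.n → Fin E.src.cardV) : 0 ≤ E.wordLaw v :=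
  div_nonneg (mul_nonneg (seqProb_nonneg _ _) (ind_nonneg _)) E.typicalMass_pos.le

/-- Conditioning on a set of mass at least 1/2 at most doubles probabilities. The constants 2 in the
averages of the likelihood ratios come from here. -/
lemma wordLaw_le (v : Fin E.n → Fin E.src.cardV) :
    E.wordLaw v ≤ 2 * seqProb (E.src.lawV F) v := by
  have h0 := seqProb_nonneg (E.src.lawV F) v
  have h : 1 / 2 ≤ E.typicalMass := E.half_le
  rw [wordLaw, div_le_iff₀ E.typicalMass_pos]
  have := mul_le_mul_of_nonneg_left (ind_le_one (IsTypical (E.src.lawV F) E.ε v)) h0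
  nlinarith

/-- All marginals of the true sequences are typical, and the prefix was received with positive
probability. -/
def Good (v : Fin E.n → Fin E.src.cardV) (s : (Fin E.n → Xf) × (Fin E.n → Yf × Zf))
    (w : Fin E.d → Fin E.chn.cardW2) (p : Fin E.d → Fin E.chn.cardW1)
    (u : Fin (E.k + E.d) → Yb × Zb) : Prop :=
  SrcTypical E.src F E.n E.t (fun i => (v i, s.1 i, s.2 i)) ∧
  ChnTypical E.chn B E.d E.t (fun i => (w i, p i, tail u i)) ∧
  kerProb (ICCCode.backChannel E.chn B) E.w₀ (head u) ≠ 0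

/-- The decoding test. -/
def Test (v : Fin E.n → Fin E.src.cardV) (p : Fin E.d → Fin E.chn.cardW1) (x : Fin E.n → Xf)
    (y : Fin (E.k + E.d) → Yb) : Prop :=
  IsBipartiteJointlyTypical (E.src.lawVX F) (E.chn.lawW1Y B) E.ε v (Fin.append E.w₀ p) x y

/-- Likelihood ratio of a word and the first-round inputs. -/
def ratioVX (v : Fin E.n → Fin E.src.cardV) (x : Fin E.n → Xf) : ℝ :=
  seqProb (E.src.lawVX F) (fun i => (v i, x i)) / (seqProb (E.src.lawV F) v * seqProb (srcX E.src F) x)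

/-- Likelihood ratio of a parity-check word and the received sequence. -/
def ratioW1Y (p : Fin E.d → Fin E.chn.cardW1) (y : Fin E.d → Yb) : ℝ :=
  kerProb (fun w => (ICCCode.backChannel E.chn B w).map Prod.fst) p y / seqProb (outY E.chn B) y

/-- Likelihood ratio of a cloud center and the received sequence. -/
def ratioW2Y (w : Fin E.d → Fin E.chn.cardW2) (y : Fin E.d → Yb) : ℝ :=
  kerProb (cloudY E.chn B) w y / seqProb (outY E.chn B) y

lemma ratioVX_nonneg (v : Fin E.n → Fin E.src.cardV) (x : Fin E.n → Xf) : 0 ≤ E.ratioVX v x :=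
  div_nonneg (seqProb_nonneg _ _) (mul_nonneg (seqProb_nonneg _ _) (seqProb_nonneg _ _))

lemma ratioW1Y_nonneg (p : Fin E.d → Fin E.chn.cardW1) (y : Fin E.d → Yb) : 0 ≤ E.ratioW1Y p y :=
  div_nonneg (kerProb_nonneg _ _ _) (seqProb_nonneg _ _)

lemma sum_wordLaw_mul_likelihood (y : Fin E.n → Yf) :
    ∑ v, E.wordLaw v * ICCCode.likelihood E.src F v y ≤ 2 := by
  calc _ ≤ ∑ v, 2 * kerProb E.src.kernelV y v := by
        refine Finset.sum_le_sum fun v _ => ?_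
        have h1 := mul_le_mul_of_nonneg_right (E.wordLaw_le v)
          (ICCCode.likelihood_nonneg E.src F v y)
        have h2 := seqProb_lawV_mul_likelihood_le E.src F v y
        linarith
    _ = 2 := by rw [← Finset.mul_sum, sum_kerProb, mul_one]

lemma sum_wordLaw_mul_ratioVX (x : Fin E.n → Xf) : ∑ v, E.wordLaw v * E.ratioVX v x ≤ 2 := by
  calc _ ≤ ∑ v : Fin E.n → Fin E.src.cardV,
        2 * (seqProb (E.src.lawVX F) (fun i => (v i, x i)) / seqProb (srcX E.src F) x) := by
        refine Finset.sum_le_sum fun v _ => ?_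
        refine (mul_le_mul_of_nonneg_right (E.wordLaw_le v) (E.ratioVX_nonneg v x)).trans ?_
        rw [mul_assoc, ratioVX]
        refine mul_le_mul_of_nonneg_left ?_ zero_le_two
        by_cases h : seqProb (E.src.lawV F) v = 0
        · rw [h, zero_mul]; exact div_nonneg (seqProb_nonneg _ _) (seqProb_nonneg _ _)
        · rw [← div_div, div_right_comm, mul_div_cancel₀ _ h]
    _ ≤ 2 := by
        rw [← Finset.mul_sum, ← Finset.sum_div, sum_lawVX]
        linarith [div_self_le_one (seqProb (srcX E.src F) x)]

lemma sum_kernelW1_mul_ratioW1Y (w : Fin E.d → Fin E.chn.cardW2) (y : Fin E.d → Yb) :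
    ∑ p, kerProb E.chn.kernelW1 w p * E.ratioW1Y p y = E.ratioW2Y w y := by
  simp_rw [ratioW1Y, mul_div_assoc']
  rw [← Finset.sum_div, sum_kerProb_mul_kerProb, ratioW2Y]
  congr 2
  funext w
  rw [cloudY, PMF.map_bind]

/-- Averaging over the cloud centers restores the law of Y_b; the value is 0 instead of 1 where that
law vanishes. -/
lemma sum_lawW2_mul_ratioW2Y (y : Fin E.d → Yb) :
    ∑ w, seqProb E.chn.lawW2 w * E.ratioW2Y w y ≤ 1 := by
  simp_rw [ratioW2Y, mul_div_assoc']
  rw [← Finset.sum_div, sum_seqProb_mul_kerProb, ← outY_eq]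
  exact div_self_le_one _

/-- The ratio is 2 to the power n I(V;Y_f) up to the three deviations of the joint typicality test,
each below nε. -/
lemma likelihood_le {v : Fin E.n → Fin E.src.cardV} {y : Fin E.n → Yf}
    (h : IsJointlyTypical (E.src.lawVY F) E.ε v y) :
    ICCCode.likelihood E.src F v y ≤ 2 ^ (E.n * infoVY E.src F + 3 * (E.n * E.ε)) := by
  obtain ⟨h1, h2, h3⟩ := h
  rw [lawVY_map_fst, isTypical_iff E.n_pos] at h1
  rw [lawVY_map_snd, isTypical_iff E.n_pos] at h2
  rw [isTypical_iff E.n_pos] at h3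
  have e : ICCCode.likelihood E.src F v y = seqProb (E.src.lawVY F) (fun i => (v i, y i)) /
      (seqProb (E.src.lawV F) v * seqProb (srcY E.src F) y) := by
    rw [likelihood_eq, seqProb_lawVY, mul_comm (seqProb (E.src.lawV F) v),
      mul_div_mul_left _ _ h2.1]
  rw [e, ratio_eq_rpow h1.1 h2.1 h3.1]
  refine Real.rpow_le_rpow_of_exponent_le (by norm_num) ?_
  have := abs_lt.mp h1.2; have := abs_lt.mp h2.2; have := abs_lt.mp h3.2
  rw [infoVY]
  linarith

/-- The bipartite test controls only the sum of the deviations of the two rounds, so it bounds the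
product of the two ratios and neither of them alone. Its three conditions contribute 3(n + k + d)ε,
and the three deviations of the common prefix contribute at most C together. -/
lemma one_le_mul_ratio {v : Fin E.n → Fin E.src.cardV} {p : Fin E.d → Fin E.chn.cardW1}
    {x : Fin E.n → Xf} {y : Fin (E.k + E.d) → Yb} (h : E.Test v p x y) :
    1 ≤ (2 : ℝ) ^ (-(E.n * infoVX E.src F + E.d * infoW1Y E.chn B)
        + 3 * ((E.n + (E.k + E.d : ℕ)) * E.ε) + E.C) *
      (E.ratioVX v x * E.ratioW1Y p (tail y)) := by
  obtain ⟨h1, h2, h3⟩ := h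
  rw [lawVX_map_fst, lawW1Y_map_fst, isBipartiteTypical_iff E.n_pos] at h1
  rw [lawVX_map_snd, lawW1Y_map_snd, isBipartiteTypical_iff E.n_pos] at h2
  rw [isBipartiteTypical_iff E.n_pos, zip_append] at h3
  obtain ⟨hv, hw, h1⟩ := h1
  obtain ⟨hx, hy, h2⟩ := h2
  obtain ⟨hvx, hwy, h3⟩ := h3
  rw [← append_head_tail y] at hy h2
  rw [seqProb_append] at hw hy hwy
  have hp := right_ne_zero_of_mul hw
  have hy' := right_ne_zero_of_mul hy
  have hwy' := right_ne_zero_of_mul hwy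
  rw [logDev_append (left_ne_zero_of_mul hw) hp] at h1
  rw [logDev_append (left_ne_zero_of_mul hy) hy'] at h2
  rw [logDev_append (left_ne_zero_of_mul hwy) hwy'] at h3
  have hC := E.dev_le E.w₀ (head y)
  have e : E.ratioW1Y p (tail y) = seqProb (E.chn.lawW1Y B) (fun i => (p i, tail y i)) /
      (seqProb E.chn.lawW1 p * seqProb (outY E.chn B) (tail y)) := by
    rw [ratioW1Y, seqProb_lawW1Y, mul_div_mul_left _ _ hp]
  rw [e, ratioVX, ratio_eq_rpow hv hx hvx, ratio_eq_rpow hp hy' hwy',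
    ← Real.rpow_add (by norm_num), ← Real.rpow_add (by norm_num)]
  refine Real.one_le_rpow (by norm_num) ?_
  have := abs_lt.mp h1; have := abs_lt.mp h2; have := abs_lt.mp h3
  have := neg_abs_le (logDev E.chn.lawW1 E.w₀)
  have := le_abs_self (logDev E.chn.lawW1 E.w₀)
  have := neg_abs_le (logDev (outY E.chn B) (head y))
  have := le_abs_self (logDev (outY E.chn B) (head y))
  have := neg_abs_le (logDev (E.chn.lawW1Y B) fun i => (E.w₀ i, head y i))
  have := le_abs_self (logDev (E.chn.lawW1Y B) fun i => (E.w₀ i, head y i))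
  rw [infoVX, infoW1Y]
  linarith

section SrcTypical

variable {E} {v : Fin E.n → Fin E.src.cardV} {s : (Fin E.n → Xf) × (Fin E.n → Yf × Zf)}
  (h : SrcTypical E.src F E.n E.t (fun i => (v i, s.1 i, s.2 i)))

include h

lemma ratioVX_le : E.ratioVX v s.1 ≤ 2 ^ (E.n * infoVX E.src F + 3 * E.t) := by
  obtain ⟨nv, nx, -, -, nvx, -, -⟩ := SrcTypical.ne_zero (v := v) (x := s.1) (yz := s.2) h
  obtain ⟨-, hv, hx, -, -, hvx, -, -⟩ := h
  rw [ratioVX, ratio_eq_rpow nv nx nvx]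
  refine Real.rpow_le_rpow_of_exponent_le (by norm_num) ?_
  have := abs_le.mp hv; have := abs_le.mp hx; have := abs_le.mp hvx
  rw [infoVX]
  linarith

lemma isJointlyTypical_of_srcTypical :
    IsJointlyTypical (E.src.lawVY F) E.ε v (ICCCode.received s) := by
  obtain ⟨nv, -, ny, -, -, nvy, -⟩ := SrcTypical.ne_zero (v := v) (x := s.1) (yz := s.2) h
  obtain ⟨-, hv, -, hy, -, -, hvy, -⟩ := h
  refine ⟨?_, ?_, ?_⟩
  · rw [lawVY_map_fst, isTypical_iff E.n_pos]
    exact ⟨nv, hv.trans_lt E.t_lt⟩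
  · rw [lawVY_map_snd, isTypical_iff E.n_pos]
    exact ⟨ny, hy.trans_lt E.t_lt⟩
  · rw [isTypical_iff E.n_pos]
    exact ⟨nvy, hvy.trans_lt E.t_lt⟩

end SrcTypical

lemma ratioW2Y_le {w : Fin E.d → Fin E.chn.cardW2} {p : Fin E.d → Fin E.chn.cardW1}
    {u : Fin E.d → Yb × Zb} (h : ChnTypical E.chn B E.d E.t (fun i => (w i, p i, u i))) :
    E.ratioW2Y w (fun i => (u i).1) ≤ 2 ^ (E.d * infoW2Y E.chn B + 3 * E.t) := by
  obtain ⟨hw0, -, ny, -, nwy, -, -, -⟩ := ChnTypical.ne_zero (w := w) (p := p) (yz := u) h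
  obtain ⟨-, hw, -, hy, -, hwy, -, -, -⟩ := h
  have e : E.ratioW2Y w (fun i => (u i).1) = seqProb (outW2Y E.chn B) (fun i => (w i, (u i).1)) /
      (seqProb E.chn.lawW2 w * seqProb (outY E.chn B) (fun i => (u i).1)) := by
    rw [ratioW2Y, seqProb_outW2Y, mul_div_mul_left _ _ hw0]
  rw [e, ratio_eq_rpow hw0 ny nwy]
  refine Real.rpow_le_rpow_of_exponent_le (by norm_num) ?_
  have := abs_le.mp hw; have := abs_le.mp hy; have := abs_le.mp hwy
  rw [infoW2Y]
  linarith

/-- The random coding problem. -/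
def problem : CodingProblem ((Fin E.n → Xf) × (Fin E.n → Yf × Zf)) (Fin E.n → Fin E.src.cardV)
    (Fin E.d → Fin E.chn.cardW2) (Fin E.d → Fin E.chn.cardW1) (Fin (E.k + E.d) → Yb × Zb) where
  PS := ICCCode.firstLaw E.src F
  pv := E.wordLaw
  r₂ := seqProb E.chn.lawW2
  r₁ := kerProb E.chn.kernelW1
  C p u := kerProb (ICCCode.backChannel E.chn B) (Fin.append E.w₀ p) u
  ℓ v s := ICCCode.likelihood E.src F v (ICCCode.received s)
  jt v s := IsJointlyTypical (E.src.lawVY F) E.ε v (ICCCode.received s)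
  good := E.Good
  mat v p s u := E.Test v p s.1 (fun i => (u i).1)
  L₁ v s := E.ratioVX v s.1
  L₂ p u := E.ratioW1Y p (fun i => (tail u i).1)
  L₃ w u := E.ratioW2Y w (fun i => (tail u i).1)
  Γ := 2 ^ (E.n * infoVY E.src F + 3 * (E.n * E.ε))
  τ := 2 ^ (-(E.n * infoVX E.src F + E.d * infoW1Y E.chn B)
        + 3 * ((E.n + (E.k + E.d : ℕ)) * E.ε) + E.C)
  Λ₁ := 2 ^ (E.n * infoVX E.src F + 3 * E.t)
  Λ₃ := 2 ^ (E.d * infoW2Y E.chn B + 3 * E.t)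
  PS_nonneg := ICCCode.firstLaw_nonneg _ _
  PS_sum := sum_firstLaw _ _
  pv_nonneg := E.wordLaw_nonneg
  pv_sum := by
    simp only [wordLaw]
    rw [← Finset.sum_div]
    exact div_self E.typicalMass_pos.ne'
  r₂_nonneg := seqProb_nonneg _
  r₂_sum := sum_seqProb _ _
  r₁_nonneg := kerProb_nonneg _
  r₁_sum := sum_kerProb _
  C_nonneg _ _ := kerProb_nonneg _ _ _
  C_sum _ := sum_kerProb _ _
  ℓ_nonneg _ _ := ICCCode.likelihood_nonneg _ _ _ _
  ℓ_sum s := E.sum_wordLaw_mul_likelihood _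
  L₁_nonneg _ _ := E.ratioVX_nonneg _ _
  L₁_sum _ := E.sum_wordLaw_mul_ratioVX _
  L₂_nonneg _ _ := E.ratioW1Y_nonneg _ _
  L₂_sum _ _ := (E.sum_kernelW1_mul_ratioW1Y _ _).le
  L₃_sum _ := E.sum_lawW2_mul_ratioW2Y _
  τ_nonneg := by positivity
  Γ_nonneg := by positivity
  Λ₁_nonneg := by positivity
  Λ₃_nonneg := by positivity
  jt_le _ _ h := E.likelihood_le h
  mat_le _ s _ _ u v' p' _ h :=
    E.one_le_mul_ratio (v := v') (p := p') (x := s.1) (y := fun i => (u i).1) h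
  good_L₁ v s _ _ _ h := ratioVX_le (v := v) (s := s) h.1
  good_L₃ _ _ w p u h := E.ratioW2Y_le (w := w) (p := p) (u := tail u) h.2.1

/-- Each marginal deviates by at most t in the first round and by at most t on the parity-check
part, and the prefix adds at most C; `two_t_lt` makes the total smaller than the tolerance of the
test. Positive probability of the received prefix ensures that its logarithms are genuine. -/
lemma test_of_good {v : Fin E.n → Fin E.src.cardV} {s : (Fin E.n → Xf) × (Fin E.n → Yf × Zf)}
    {w : Fin E.d → Fin E.chn.cardW2} {p : Fin E.d → Fin E.chn.cardW1}
    {u : Fin (E.k + E.d) → Yb × Zb} (h : E.Good v s w p u) :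
    E.Test v p s.1 (fun i => (u i).1) := by
  obtain ⟨nv, nx, -, -, nvx, -, -⟩ := SrcTypical.ne_zero (v := v) (x := s.1) (yz := s.2) h.1
  obtain ⟨-, hp0, hy0, hpy0, -, -, -, -⟩ :=
    ChnTypical.ne_zero (w := w) (p := p) (yz := tail u) h.2.1
  obtain ⟨⟨-, hv, hx, -, -, hvx, -, -⟩, ⟨-, -, hp, hy, hpy, -, -, -, -⟩, hh⟩ := h
  have hw0 : seqProb E.chn.lawW1 E.w₀ ≠ 0 := E.w₀_typical.1
  have hwy0 : seqProb (E.chn.lawW1Y B) (fun i => (E.w₀ i, (head u i).1)) ≠ 0 := by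
    rw [seqProb_lawW1Y]
    refine mul_ne_zero hw0 (Finset.prod_ne_zero_iff.mpr fun i _ => ?_)
    refine (map_pos_of_pos _ _ ?_).ne'
    exact lt_of_le_of_ne ENNReal.toReal_nonneg
      (Finset.prod_ne_zero_iff.mp hh i (Finset.mem_univ i)).symm
  have hhy0 : seqProb (outY E.chn B) (fun i => (head u i).1) ≠ 0 := by
    rw [← lawW1Y_map_snd]
    refine seqProb_map_ne_zero Prod.snd (u := fun i => (E.w₀ i, (head u i).1)) fun i => ?_
    exact lt_of_le_of_ne ENNReal.toReal_nonneg
      (Finset.prod_ne_zero_iff.mp hwy0 i (Finset.mem_univ i)).symm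
  have hC := E.dev_le E.w₀ fun i => (head u i).1
  have ht := E.two_t_lt
  have a1 := abs_nonneg (logDev E.chn.lawW1 E.w₀)
  have a2 := abs_nonneg (logDev (outY E.chn B) fun i => (head u i).1)
  have a3 := abs_nonneg (logDev (E.chn.lawW1Y B) fun i => (E.w₀ i, (head u i).1))
  have hu : (fun i => (u i).1) = Fin.append (fun i => (head u i).1) (fun i => (tail u i).1) :=
    (append_head_tail (fun i => (u i).1)).symm
  refine ⟨?_, ?_, ?_⟩
  · rw [lawVX_map_fst, lawW1Y_map_fst, isBipartiteTypical_iff E.n_pos, logDev_append hw0 hp0,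
      seqProb_append]
    refine ⟨nv, mul_ne_zero hw0 hp0, ?_⟩
    have := abs_add_le (logDev (E.src.lawV F) v)
      (logDev E.chn.lawW1 E.w₀ + logDev E.chn.lawW1 p)
    have := abs_add_le (logDev E.chn.lawW1 E.w₀) (logDev E.chn.lawW1 p)
    linarith
  · rw [lawVX_map_snd, lawW1Y_map_snd, isBipartiteTypical_iff E.n_pos, hu,
      logDev_append hhy0 hy0, seqProb_append]
    refine ⟨nx, mul_ne_zero hhy0 hy0, ?_⟩
    have := abs_add_le (logDev (srcX E.src F) s.1)
      (logDev (outY E.chn B) (fun i => (head u i).1) + logDev (outY E.chn B) fun i => (tail u i).1)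
    have := abs_add_le (logDev (outY E.chn B) (fun i => (head u i).1))
      (logDev (outY E.chn B) fun i => (tail u i).1)
    linarith
  · rw [isBipartiteTypical_iff E.n_pos, zip_append]
    change _ ∧ seqProb _ (Fin.append (fun i => (E.w₀ i, (head u i).1))
      (fun i => (p i, (tail u i).1))) ≠ 0 ∧ |_ + logDev _ (Fin.append
        (fun i => (E.w₀ i, (head u i).1)) (fun i => (p i, (tail u i).1)))| < _
    rw [logDev_append hwy0 hpy0, seqProb_append]
    refine ⟨nvx, mul_ne_zero hwy0 hpy0, ?_⟩
    have := abs_add_le (logDev (E.src.lawVX F) fun i => (v i, s.1 i))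
      (logDev (E.chn.lawW1Y B) (fun i => (E.w₀ i, (head u i).1))
        + logDev (E.chn.lawW1Y B) fun i => (p i, (tail u i).1))
    have := abs_add_le (logDev (E.chn.lawW1Y B) fun i => (E.w₀ i, (head u i).1))
      (logDev (E.chn.lawW1Y B) fun i => (p i, (tail u i).1))
    linarith

end Ensemble

end

/-! ### Error and leakage of the random ensemble. -/

section

variable {Xf Yf Zf Xb Yb Zb : Type*} [Fintype Xf] [Fintype Yf] [Fintype Zf]
  [Fintype Xb] [Fintype Yb] [Fintype Zb]

namespace Ensemble

variable {F : DMBC Xf Yf Zf} {B : DMBC Xb Yb Zb} (E : Ensemble F B)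

/-- The probability of an atypical first round. -/
def srcDefect : ℝ := ∑ u, seqProb (E.src.law F) u * ind (¬ SrcTypical E.src F E.n E.t u)

/-- The probability of an atypical second round. -/
def chnDefect : ℝ := ∑ u, seqProb (outLaw E.chn B) u * ind (¬ ChnTypical E.chn B E.d E.t u)

lemma chnDefect_nonneg : 0 ≤ E.chnDefect :=
  Finset.sum_nonneg fun _ _ => mul_nonneg (seqProb_nonneg _ _) (ind_nonneg _)

/-- Changing from the conditioned word law and its likelihood ratio to the true joint law costs a
factor of at most 2. -/
lemma sum_wordLaw_firstLaw_le {φ : (Fin E.n → Fin E.src.cardV × Xf × Yf × Zf) → ℝ}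
    (hφ : ∀ u, 0 ≤ φ u) :
    ∑ v, E.wordLaw v * ∑ s : (Fin E.n → Xf) × (Fin E.n → Yf × Zf), ICCCode.firstLaw E.src F s *
        ICCCode.likelihood E.src F v (ICCCode.received s) * φ (fun i => (v i, s.1 i, s.2 i))
      ≤ 2 * ∑ u, seqProb (E.src.law F) u * φ u := by
  rw [← sum_word_firstLaw, Finset.mul_sum]
  refine Finset.sum_le_sum fun v _ => ?_
  rw [Finset.mul_sum, Finset.mul_sum]
  refine Finset.sum_le_sum fun s _ => ?_
  have h1 := mul_le_mul_of_nonneg_right (E.wordLaw_le v)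
    (ICCCode.likelihood_nonneg E.src F v (ICCCode.received s))
  have h2 := seqProb_lawV_mul_likelihood_le E.src F v (ICCCode.received s)
  have h3 : E.wordLaw v * ICCCode.likelihood E.src F v (ICCCode.received s)
      ≤ 2 * kerProb E.src.kernelV (ICCCode.received s) v := by linarith
  have h4 := mul_le_mul_of_nonneg_right h3
    (mul_nonneg (ICCCode.firstLaw_nonneg E.src F s) (hφ fun i => (v i, s.1 i, s.2 i)))
  linarith

lemma one_sub_typicalMass_le : 1 - E.typicalMass ≤ E.srcDefect := by
  have h1 : ∀ v : Fin E.n → Fin E.src.cardV,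
      seqProb (E.src.lawV F) v - seqProb (E.src.lawV F) v * ind (IsTypical (E.src.lawV F) E.ε v)
      = ∑ s : (Fin E.n → Xf) × (Fin E.n → Yf × Zf),
        ICCCode.firstLaw E.src F s * kerProb E.src.kernelV (ICCCode.received s) v *
          ind (¬ IsTypical (E.src.lawV F) E.ε v) := by
    intro v
    simp_rw [← seqProb_law]
    rw [← Finset.sum_mul, sum_seqProb_law, ind_not]
    ring
  rw [typicalMass, ← sum_seqProb (E.src.lawV F) E.n, ← Finset.sum_sub_distrib]
  simp_rw [h1]
  rw [srcDefect, ← sum_word_firstLaw]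
  refine Finset.sum_le_sum fun v _ => Finset.sum_le_sum fun s _ => ?_
  refine mul_le_mul_of_nonneg_left (ind_mono fun h h' => h ?_)
    (mul_nonneg (ICCCode.firstLaw_nonneg _ _ _) (kerProb_nonneg _ _ _))
  have := (isJointlyTypical_of_srcTypical h').1
  rwa [lawVY_map_fst] at this

/-- The mean weight at s is q(s)/M, where q(s) is the conditional probability that V is jointly
typical with the received sequence and M is the typical mass. The average of 1 - q is at most the
source defect, and dividing by M ≥ 1/2 costs at most twice that defect. -/
lemma coveringDefect_le : E.problem.coveringDefect ≤ 3 * E.srcDefect := by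
  have hM := E.typicalMass_pos
  have hM1 : E.typicalMass ≤ 1 := by
    rw [typicalMass, ← sum_seqProb (E.src.lawV F) E.n]
    exact Finset.sum_le_sum fun v _ => mul_le_of_le_one_right (seqProb_nonneg _ _) (ind_le_one _)
  have hM2 : 1 / 2 ≤ E.typicalMass := E.half_le
  set jt : (Fin E.n → Fin E.src.cardV) → (Fin E.n → Xf) × (Fin E.n → Yf × Zf) → Prop :=
    fun v s => IsJointlyTypical (E.src.lawVY F) E.ε v (ICCCode.received s) with hjt
  set q : (Fin E.n → Xf) × (Fin E.n → Yf × Zf) → ℝ := fun s =>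
    ∑ v, kerProb E.src.kernelV (ICCCode.received s) v * ind (jt v s) with hq
  have hterm : ∀ s, ∑ v, E.wordLaw v * (ICCCode.likelihood E.src F v (ICCCode.received s) *
      ind (jt v s)) = q s / E.typicalMass := by
    intro s
    rw [hq, Finset.sum_div]
    refine Finset.sum_congr rfl fun v _ => ?_
    by_cases h : jt v s
    · have h1 := h.1
      rw [lawVY_map_fst] at h1
      rw [wordLaw, ind_true h1, ind_true h, likelihood_eq]
      field_simp [h1.1]
    · rw [ind_false h, mul_zero, mul_zero, mul_zero, zero_div]
  have hq0 : ∀ s, 0 ≤ q s := fun s =>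
    Finset.sum_nonneg fun v _ => mul_nonneg (kerProb_nonneg _ _ _) (ind_nonneg _)
  have hq1 : ∀ s, 1 - q s = ∑ v, kerProb E.src.kernelV (ICCCode.received s) v *
      ind (¬ jt v s) := by
    intro s
    rw [← sum_kerProb E.src.kernelV (ICCCode.received s), hq, ← Finset.sum_sub_distrib]
    exact Finset.sum_congr rfl fun v _ => by rw [ind_not]; ring
  have hq2 : ∀ s, 0 ≤ 1 - q s := fun s => by
    rw [hq1]
    exact Finset.sum_nonneg fun v _ => mul_nonneg (kerProb_nonneg _ _ _) (ind_nonneg _)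
  have hle : ∑ s, ICCCode.firstLaw E.src F s * (1 - q s) ≤ E.srcDefect := by
    rw [srcDefect, ← sum_word_firstLaw, Finset.sum_comm]
    refine Finset.sum_le_sum fun s _ => ?_
    rw [hq1, Finset.mul_sum]
    refine Finset.sum_le_sum fun v _ => ?_
    rw [mul_assoc]
    refine mul_le_mul_of_nonneg_left (mul_le_mul_of_nonneg_left (ind_mono fun h h' => h ?_)
      (kerProb_nonneg _ _ _)) (ICCCode.firstLaw_nonneg _ _ _)
    exact isJointlyTypical_of_srcTypical h'
  calc E.problem.coveringDefect
      = ∑ s, ICCCode.firstLaw E.src F s * |1 - q s / E.typicalMass| :=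
        Finset.sum_congr rfl fun s _ => by rw [← hterm s]; rfl
    _ ≤ ∑ s, (ICCCode.firstLaw E.src F s * (1 - q s)
          + ICCCode.firstLaw E.src F s * (2 * E.srcDefect)) := by
        refine Finset.sum_le_sum fun s _ => ?_
        rw [← mul_add]
        refine mul_le_mul_of_nonneg_left ?_ (ICCCode.firstLaw_nonneg _ _ _)
        have hs := E.one_sub_typicalMass_le
        have h2 := hq2 s
        have h0 := hq0 s
        have e : 1 - q s / E.typicalMass = (1 - q s) - q s * ((1 - E.typicalMass) / E.typicalMass) := by
          field_simp; ring
        have h3 : (1 - E.typicalMass) / E.typicalMass ≤ 2 * E.srcDefect := by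
          rw [div_le_iff₀ hM]
          nlinarith
        have h4 : 0 ≤ (1 - E.typicalMass) / E.typicalMass := div_nonneg (by linarith) hM.le
        rw [e, abs_le]
        constructor
        · nlinarith
        · nlinarith [mul_nonneg h0 h4]
    _ ≤ 3 * E.srcDefect := by
        rw [Finset.sum_add_distrib, ← Finset.sum_mul, sum_firstLaw]
        linarith

/-- A run fails to be good because of the first round, of the second round, or of an impossible
received prefix. The last case has probability zero, and the factors 2 come from conditioning the
V-words on typicality. -/
lemma atypicality_le : E.problem.atypicality ≤ 2 * E.srcDefect + 2 * E.chnDefect := by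
  set bad₁ : (Fin E.n → Fin E.src.cardV) → (Fin E.n → Xf) × (Fin E.n → Yf × Zf) → ℝ :=
    fun v s => ind (¬ SrcTypical E.src F E.n E.t (fun i => (v i, s.1 i, s.2 i))) with hb1
  set bad₂ : (Fin E.d → Fin E.chn.cardW2) → (Fin E.d → Fin E.chn.cardW1) →
      (Fin E.d → Yb × Zb) → ℝ :=
    fun w p u => ind (¬ ChnTypical E.chn B E.d E.t (fun i => (w i, p i, u i))) with hb2
  set A : (Fin E.n → Fin E.src.cardV) → (Fin E.n → Xf) × (Fin E.n → Yf × Zf) → ℝ :=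
    fun v s => ICCCode.firstLaw E.src F s *
      ICCCode.likelihood E.src F v (ICCCode.received s) with hA
  have hA0 : ∀ v s, 0 ≤ A v s := fun v s =>
    mul_nonneg (ICCCode.firstLaw_nonneg _ _ _) (ICCCode.likelihood_nonneg _ _ _ _)
  set D : (Fin E.d → Fin E.chn.cardW1) → (Fin (E.k + E.d) → Yb × Zb) → ℝ := fun p u =>
    kerProb (ICCCode.backChannel E.chn B) (Fin.append E.w₀ p) u with hD
  have hD0 : ∀ p u, 0 ≤ D p u := fun p u => kerProb_nonneg _ _ _
  have hDt : ∀ w p, ∑ u, D p u * bad₂ w p (tail u)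
      = ∑ u : Fin E.d → Yb × Zb, kerProb (ICCCode.backChannel E.chn B) p u * bad₂ w p u := by
    intro w p
    simp_rw [hD, kerProb_append, mul_assoc]
    rw [sum_head_mul_tail (fun h => kerProb (ICCCode.backChannel E.chn B) E.w₀ h)
      (fun u => kerProb (ICCCode.backChannel E.chn B) p u * bad₂ w p u), sum_kerProb, one_mul]
  have hinner : ∀ v w p, ∑ s, ∑ u, A v s * D p u * ind (¬ E.Good v s w p u)
      ≤ ∑ s, A v s * bad₁ v s + (∑ s, A v s) *
        ∑ u : Fin E.d → Yb × Zb, kerProb (ICCCode.backChannel E.chn B) p u * bad₂ w p u := by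
    intro v w p
    rw [← hDt, Finset.sum_mul, ← Finset.sum_add_distrib]
    refine Finset.sum_le_sum fun s _ => ?_
    have h1 : A v s * bad₁ v s = ∑ u, A v s * D p u * bad₁ v s := by
      simp_rw [mul_assoc, mul_comm (D p _), ← mul_assoc]
      rw [← Finset.mul_sum, sum_kerProb, mul_one]
    rw [h1, Finset.mul_sum, ← Finset.sum_add_distrib]
    refine Finset.sum_le_sum fun u _ => ?_
    -- Outputs whose prefix is impossible have weight zero, so the third clause of goodness costs
    -- nothing.
    by_cases h0 : kerProb (ICCCode.backChannel E.chn B) E.w₀ (head u) = 0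
    · have : D p u = 0 := by rw [hD]; simp only; rw [kerProb_append, h0, zero_mul]
      rw [this]; simp
    · rw [← mul_assoc, ← mul_add]
      refine mul_le_mul_of_nonneg_left ?_ (mul_nonneg (hA0 v s) (hD0 p u))
      refine le_trans (ind_mono fun h => ?_) (ind_or_le _ _)
      by_contra hn
      rw [not_or, not_not, not_not] at hn
      exact h ⟨hn.1, hn.2, h0⟩
  have hchn := sum_cloud_word E.chn B
    (fun u => ind (¬ ChnTypical E.chn B E.d E.t u))
  have hv : ∀ v, ∑ w, seqProb E.chn.lawW2 w * ∑ p, kerProb E.chn.kernelW1 w p *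
      ∑ s, ∑ u, A v s * D p u * ind (¬ E.Good v s w p u)
      ≤ ∑ s, A v s * bad₁ v s + (∑ s, A v s) * E.chnDefect := by
    intro v
    have h1 : ∀ w, ∑ p, kerProb E.chn.kernelW1 w p *
        ∑ s, ∑ u, A v s * D p u * ind (¬ E.Good v s w p u)
        ≤ ∑ s, A v s * bad₁ v s + (∑ s, A v s) * ∑ p, kerProb E.chn.kernelW1 w p *
        ∑ u : Fin E.d → Yb × Zb, kerProb (ICCCode.backChannel E.chn B) p u * bad₂ w p u := by
      intro w
      refine (Finset.sum_le_sum fun p _ => mul_le_mul_of_nonneg_left (hinner v w p)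
        (kerProb_nonneg _ _ _)).trans_eq ?_
      simp_rw [mul_add]
      rw [Finset.sum_add_distrib, ← Finset.sum_mul, sum_kerProb, one_mul, Finset.mul_sum]
      congr 1
      exact Finset.sum_congr rfl fun p _ => by ring
    refine (Finset.sum_le_sum fun w _ => mul_le_mul_of_nonneg_left (h1 w)
        (seqProb_nonneg _ _)).trans_eq ?_
    simp_rw [mul_add]
    rw [Finset.sum_add_distrib, ← Finset.sum_mul, sum_seqProb, one_mul, chnDefect, ← hchn,
      Finset.mul_sum]
    congr 1
    exact Finset.sum_congr rfl fun w _ => by ring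
  calc E.problem.atypicality
      ≤ ∑ v, E.wordLaw v * (∑ s, A v s * bad₁ v s + (∑ s, A v s) * E.chnDefect) :=
        Finset.sum_le_sum fun v _ => mul_le_mul_of_nonneg_left (hv v) (E.wordLaw_nonneg v)
    _ ≤ 2 * E.srcDefect + 2 * E.chnDefect := by
        simp_rw [mul_add]
        rw [Finset.sum_add_distrib]
        refine add_le_add (E.sum_wordLaw_firstLaw_le
          (φ := fun u => ind (¬ SrcTypical E.src F E.n E.t u)) fun u => ind_nonneg _) ?_
        have h := E.sum_wordLaw_firstLaw_le (φ := fun _ => 1) fun _ => zero_le_one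
        simp only [mul_one, sum_seqProb] at h
        simp_rw [← mul_assoc]
        rw [← Finset.sum_mul]
        exact mul_le_mul_of_nonneg_right h E.chnDefect_nonneg

/-- What a given word tells the eavesdropper about the first round. -/
lemma sum_firstLaw_view_le (v : Fin E.n → Fin E.src.cardV) (z : Fin E.n → Zf) :
    ∑ s : (Fin E.n → Xf) × (Fin E.n → Yf × Zf), ICCCode.firstLaw E.src F s *
        ICCCode.likelihood E.src F v (ICCCode.received s) *
        ind (SrcTypical E.src F E.n E.t (fun i => (v i, s.1 i, s.2 i))) *
        ind ((fun i => (s.2 i).2) = z)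
      ≤ 2 ^ (E.n * infoVZ E.src F + 3 * E.t) * seqProb (srcZ E.src F) z := by
  have h0 : ∀ s : (Fin E.n → Xf) × (Fin E.n → Yf × Zf), 0 ≤ ICCCode.firstLaw E.src F s *
        ICCCode.likelihood E.src F v (ICCCode.received s) := fun s =>
    mul_nonneg (ICCCode.firstLaw_nonneg _ _ _) (ICCCode.likelihood_nonneg _ _ _ _)
  -- A single typical run with view z suffices: the sum is then at most the full conditional
  -- probability of z given v, and the bound on it only involves (v, z). Without such a run the sum
  -- is zero.
  by_cases hex : ∃ s : (Fin E.n → Xf) × (Fin E.n → Yf × Zf),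
      SrcTypical E.src F E.n E.t (fun i => (v i, s.1 i, s.2 i)) ∧ (fun i => (s.2 i).2) = z
  · obtain ⟨s, hs, rfl⟩ := hex
    refine (Finset.sum_le_sum fun s' _ => mul_le_mul_of_nonneg_right
      (mul_le_of_le_one_right (h0 s') (ind_le_one _)) (ind_nonneg _)).trans ?_
    rw [sum_firstLaw_likelihood_view]
    obtain ⟨nv, -, -, nz, -, -, nvz⟩ := SrcTypical.ne_zero (v := v) (x := s.1) (yz := s.2) hs
    obtain ⟨-, hv, -, -, hz, -, -, hvz⟩ := hs
    have e := ratio_eq_rpow nv nz nvz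
    rw [← div_div, div_eq_iff nz] at e
    rw [e]
    refine mul_le_mul_of_nonneg_right ?_ (seqProb_nonneg _ _)
    refine Real.rpow_le_rpow_of_exponent_le (by norm_num) ?_
    have := abs_le.mp hv; have := abs_le.mp hz; have := abs_le.mp hvz
    rw [infoVZ]
    linarith
  · rw [Finset.sum_eq_zero]
    · exact mul_nonneg (by positivity) (seqProb_nonneg _ _)
    · intro s _
      by_cases h1 : SrcTypical E.src F E.n E.t (fun i => (v i, s.1 i, s.2 i))
      · rw [ind_false (P := _ = z) fun h => hex ⟨s, h1, h⟩, mul_zero]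
      · rw [ind_false h1, mul_zero, zero_mul]

/-- What a given word tells the eavesdropper about the second round, beyond the cloud center. -/
lemma sum_backChannel_view_le (w : Fin E.d → Fin E.chn.cardW2) (p : Fin E.d → Fin E.chn.cardW1)
    (z : Fin (E.k + E.d) → Zb) :
    ∑ u : Fin (E.k + E.d) → Yb × Zb,
        kerProb (ICCCode.backChannel E.chn B) (Fin.append E.w₀ p) u *
        ind (ChnTypical E.chn B E.d E.t (fun i => (w i, p i, tail u i))) *
        ind ((fun i => (u i).2) = z)
      ≤ 2 ^ (E.d * infoW1ZW2 E.chn B + 4 * E.t) * kerProb (cloudZ E.chn B) w (tail z) := by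
  have h0 : ∀ u, 0 ≤ kerProb (ICCCode.backChannel E.chn B) (Fin.append E.w₀ p) u :=
    fun u => kerProb_nonneg _ _ _
  by_cases hex : ∃ u : Fin (E.k + E.d) → Yb × Zb,
      ChnTypical E.chn B E.d E.t (fun i => (w i, p i, tail u i)) ∧ (fun i => (u i).2) = z
  · obtain ⟨u, hu, rfl⟩ := hex
    refine (Finset.sum_le_sum fun u' _ => mul_le_mul_of_nonneg_right
      (mul_le_of_le_one_right (h0 u') (ind_le_one _)) (ind_nonneg _)).trans ?_
    rw [sum_kerProb_view, kerProb_append]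
    -- The law of the eavesdropper's prefix is crudely bounded by 1; the factor |Z_b|^k of the
    -- leakage compensates for this.
    refine (mul_le_of_le_one_left (kerProb_nonneg _ _ _) (kerProb_le_one _ _ _)).trans ?_
    obtain ⟨nw, -, -, -, -, nwz, nwp, nwpz⟩ :=
      ChnTypical.ne_zero (w := w) (p := p) (yz := tail u) hu
    obtain ⟨-, hw, -, -, -, -, hwz, hwp, hwpz⟩ := hu
    have hz : tail (fun i => (u i).2) = fun i => (tail u i).2 := rfl
    rw [hz]
    have ewz := seqProb_outW2Z E.chn B w (fun i => (tail u i).2)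
    have ewp := seqProb_outW2W1 E.chn B w p
    have ewpz := seqProb_outW2W1Z E.chn B w p (fun i => (tail u i).2)
    rw [← ewp] at ewpz
    have e1 : kerProb (fun w => (ICCCode.backChannel E.chn B w).map Prod.snd) p
        (fun i => (tail u i).2) = seqProb (outW2W1Z E.chn B) (fun i => (w i, p i, (tail u i).2)) /
          seqProb (outW2W1 E.chn B) (fun i => (w i, p i)) := by
      rw [ewpz, mul_div_cancel_left₀ _ nwp]
    have e2 : kerProb (cloudZ E.chn B) w (fun i => (tail u i).2)
        = seqProb (outW2Z E.chn B) (fun i => (w i, (tail u i).2)) / seqProb E.chn.lawW2 w := by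
      rw [ewz, mul_div_cancel_left₀ _ nw]
    rw [e1, e2, seqProb_eq_rpow nw, seqProb_eq_rpow nwz, seqProb_eq_rpow nwp,
      seqProb_eq_rpow nwpz, ← Real.rpow_sub (by norm_num), ← Real.rpow_sub (by norm_num),
      ← Real.rpow_add (by norm_num)]
    refine Real.rpow_le_rpow_of_exponent_le (by norm_num) ?_
    have := abs_le.mp hw; have := abs_le.mp hwz; have := abs_le.mp hwp; have := abs_le.mp hwpz
    rw [infoW1ZW2]
    linarith
  · rw [Finset.sum_eq_zero]
    · exact mul_nonneg (by positivity) (kerProb_nonneg _ _ _)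
    · intro u _
      by_cases h1 : ChnTypical E.chn B E.d E.t (fun i => (w i, p i, tail u i))
      · rw [ind_false (P := _ = z) fun h => hex ⟨u, h1, h⟩, mul_zero]
      · rw [ind_false h1, mul_zero, zero_mul]

/-- Bound for the failure probability of the ensemble. -/
def errorBound (MF MB J : ℝ) : ℝ :=
  5 * E.srcDefect + 2 * E.chnDefect
    + √(2 * 2 ^ (E.n * infoVY E.src F + 3 * (E.n * E.ε)) / MF)
    + 2 ^ (-(E.n * infoVX E.src F + E.d * infoW1Y E.chn B)
        + 3 * ((E.n + (E.k + E.d : ℕ)) * E.ε) + E.C) *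
      (1 + 2 ^ (E.d * infoW2Y E.chn B + 3 * E.t) / J) *
      (4 * (MF * MB) + 2 * 2 ^ (E.n * infoVX E.src F + 3 * E.t) * MB)

/-- Bound for the information that the eavesdropper gets. -/
def leakage (J : ℝ) : ℝ :=
  2 ^ (E.n * infoVZ E.src F + 3 * E.t) * 2 ^ (E.d * infoW1ZW2 E.chn B + 4 * E.t) *
    (J * (Fintype.card Zb : ℝ) ^ E.k)

/-- The code given by random coding is turned into a protocol. Its covering defect and average
message error bound the distance to the ideal weight, and the likelihood bounds for the eavesdropper
provide the hypothesis of the hash lemma. The 5 in the source defect is 3 from covering plus 2 from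
atypicality. -/
theorem exists_protocol [Nonempty Xb] {MF MB J K : ℕ} (hMF : 0 < MF) (hMB : 0 < MB) (hJ : 0 < J)
    (hK : 4 ≤ K) (hθ : E.errorBound MF MB J ≤ 1) (g : Fin MF × Fin MB → Fin K)
    (hg : ∀ k, ∑ m, ind (g m = k) = (MF * MB : ℝ) / K) :
    ∃ P : ICCProtocol F B, P.nf = E.n ∧ P.nb = E.k + E.d ∧ P.cardK = K ∧
      P.outcome.toOuterMeasure {ω | ¬ ∃ k, ω.1 = some k ∧ ω.2.1 = some k}
        ≤ ENNReal.ofReal (E.errorBound MF MB J) ∧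
      (1 - 5 * (E.errorBound MF MB J + √(2 * K * (E.leakage J / (MF * MB))))) * (Real.logb 2 K - 2)
        ≤ condEntropy P.outcome (fun ω => ω.1) (fun ω => ω.2.2) := by
  have : NeZero MF := ⟨hMF.ne'⟩
  have : NeZero MB := ⟨hMB.ne'⟩
  have : NeZero J := ⟨hJ.ne'⟩
  obtain ⟨x, hx, hle⟩ := E.problem.exists_code (F := Fin MF) (B := Fin MB) (J := Fin J)
  simp only [Fintype.card_fin] at hle
  have htyp : ∀ f, IsTypical (E.src.lawV F) E.ε (x.1 f) := by
    intro f
    by_contra h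
    have := hx f
    change 0 < E.wordLaw (x.1 f) at this
    rw [wordLaw, ind_false h, mul_zero, zero_div] at this
    exact this.false
  let D : ICCCode F B :=
    { src := E.src, chn := E.chn, n := E.n, k := E.k, d := E.d, n_pos := E.n_pos
      k_pos := E.k_pos, ε := E.ε, ε_pos := E.ε_pos, cardF := MF, cardB := MB
      vWord := x.1, vWord_typical := htyp, prefixWord := E.w₀, prefixWord_typical := E.w₀_typical
      parity := fun m => (x.2.2 m).2, nullWord := fun _ => Classical.arbitrary Xb }
  -- The complement of the error event in `messageError`: the true sequences are good and no other
  -- message passes the test, so decoding succeeds.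
  let good : Fin MF × Fin MB → (Fin E.n → Xf) × (Fin E.n → Yf × Zf) →
      (Fin (E.k + E.d) → Yb × Zb) → Prop := fun m s u =>
    ¬ (¬ E.Good (x.1 m.1) s (x.2.1 (x.2.2 m).1) (x.2.2 m).2 u ∨
      ∃ m', m' ≠ m ∧ E.Test (x.1 m'.1) (x.2.2 m').2 s.1 (fun i => (u i).1))
  have hGood : ∀ m s u, good m s u → E.Good (x.1 m.1) s (x.2.1 (x.2.2 m).1) (x.2.2 m).2 u :=
    fun m s u h => not_not.mp (not_or.mp h).1
  have hfail : E.problem.failureBound (Fin MF) (Fin MB) (Fin J) ≤ E.errorBound MF MB J := by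
    have h1 := E.coveringDefect_le
    have h2 := E.atypicality_le
    have e : E.problem.failureBound (Fin MF) (Fin MB) (Fin J) = E.problem.coveringDefect
      + √(2 * 2 ^ (E.n * infoVY E.src F + 3 * (E.n * E.ε)) / MF) + E.problem.atypicality
      + 2 ^ (-(E.n * infoVX E.src F + E.d * infoW1Y E.chn B)
        + 3 * ((E.n + (E.k + E.d : ℕ)) * E.ε) + E.C) *
      (1 + 2 ^ (E.d * infoW2Y E.chn B + 3 * E.t) / J) *
      (4 * (MF * MB) + 2 * 2 ^ (E.n * infoVX E.src F + 3 * E.t) * MB) := by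
      rw [CodingProblem.failureBound]
      simp only [Fintype.card_fin]
      rfl
    rw [e, errorBound]
    linarith
  have hback : ∀ (m : Fin MF × Fin MB) (u : Fin (E.k + E.d) → Yb × Zb),
      (D.back (some m.1) m.2 u).toReal
        = kerProb (ICCCode.backChannel E.chn B) (Fin.append E.w₀ (x.2.2 m).2) u :=
    fun m u => toReal_useChannel _ _ _
  have hsum : ∑ s, ICCCode.firstLaw D.src F s *
      |1 - (∑ f, D.quantWeight (ICCCode.received s) f) / D.cardF| +
        (∑ m, D.badMass good m) / (D.cardF * D.cardB) ≤ E.errorBound MF MB J := by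
    refine le_trans (le_of_eq ?_) (hle.trans hfail)
    refine congrArg₂ (· + ·) ?_ (congrArg (· / ((MF : ℝ) * MB)) ?_)
    · refine Finset.sum_congr rfl fun s _ => ?_
      simp only [Fintype.card_fin]
      rfl
    · refine Finset.sum_congr rfl fun m _ => Finset.sum_congr rfl fun s _ =>
        Finset.sum_congr rfl fun u _ => ?_
      rw [hback, show (¬ good m s u) = _ from propext not_not]
      rfl
  -- A reference law of the views that does not depend on the message: the product law of Z_f, the
  -- uniform law on the prefix, and the average over all cloud centers of the law of Z_b. Bounding
  -- one cloud by the sum over all of them yields the factor J in the leakage.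
  let σ : (Fin E.n → Zf) × (Fin (E.k + E.d) → Zb) → ℝ := fun z =>
    seqProb (srcZ E.src F) z.1 * (((Fintype.card Zb : ℝ) ^ E.k)⁻¹ *
      ((∑ j, kerProb (cloudZ E.chn B) (x.2.1 j) (tail z.2)) / J))
  have hσ0 : ∀ z, 0 ≤ σ z := fun z => mul_nonneg (seqProb_nonneg _ _) (mul_nonneg (by positivity)
    (div_nonneg (Finset.sum_nonneg fun _ _ => kerProb_nonneg _ _ _) (by positivity)))
  have hJ' : (0 : ℝ) < J := by exact_mod_cast hJ
  have hσ : ∑ z, σ z ≤ 1 := by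
    have h1 : ∑ z, σ z = (∑ z : Fin E.n → Zf, seqProb (srcZ E.src F) z) *
        ∑ z : Fin (E.k + E.d) → Zb, ((Fintype.card Zb : ℝ) ^ E.k)⁻¹ *
          ((∑ j, kerProb (cloudZ E.chn B) (x.2.1 j) (tail z)) / J) := by
      rw [Fintype.sum_prod_type, Finset.sum_mul_sum]
    rw [h1, sum_seqProb, one_mul, sum_head_mul_tail (fun _ => ((Fintype.card Zb : ℝ) ^ E.k)⁻¹)
      (fun z => (∑ j, kerProb (cloudZ E.chn B) (x.2.1 j) z) / J), ← Finset.sum_div,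
      Finset.sum_comm]
    simp_rw [sum_kerProb]
    simp only [Finset.sum_const, Finset.card_univ, Fintype.card_fin, nsmul_eq_mul, mul_one,
      Fintype.card_fun, Nat.cast_pow]
    rw [div_self hJ'.ne', mul_one]
    exact mul_inv_le_one
  have hκ : ∀ (m : Fin MF × Fin MB) (z : (Fin E.n → Zf) × (Fin (E.k + E.d) → Zb)),
      ∑ s : (Fin E.n → Xf) × (Fin E.n → Yf × Zf), ∑ u : Fin (E.k + E.d) → Yb × Zb,
      ICCCode.firstLaw E.src F s *
      ICCCode.likelihood E.src F (x.1 m.1) (ICCCode.received s) *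
      (D.back (some m.1) m.2 u).toReal *
      ind (good m s u) * ind (((fun i => (s.2 i).2), fun i => (u i).2) = z)
        ≤ E.leakage J * σ z := by
    rintro m ⟨z₁, z₂⟩
    set w := x.2.1 (x.2.2 m).1 with hw
    set p := (x.2.2 m).2 with hp
    have h1 := E.sum_firstLaw_view_le (x.1 m.1) z₁
    have h2 := E.sum_backChannel_view_le w p z₂
    have hZ : (0 : ℝ) < (Fintype.card Zb : ℝ) ^ E.k := by
      have : Nonempty Zb := ⟨z₂ ⟨0, by have := E.k_pos; omega⟩⟩
      have : (0 : ℝ) < Fintype.card Zb := by exact_mod_cast Fintype.card_pos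
      positivity
    have h3 : kerProb (cloudZ E.chn B) w (tail z₂)
        ≤ ∑ j, kerProb (cloudZ E.chn B) (x.2.1 j) (tail z₂) :=
      Finset.single_le_sum (f := fun j => kerProb (cloudZ E.chn B) (x.2.1 j) (tail z₂))
        (fun _ _ => kerProb_nonneg _ _ _) (Finset.mem_univ _)
    calc _ ≤ ∑ s : (Fin E.n → Xf) × (Fin E.n → Yf × Zf), ∑ u : Fin (E.k + E.d) → Yb × Zb,
          (ICCCode.firstLaw E.src F s *
            ICCCode.likelihood E.src F (x.1 m.1) (ICCCode.received s) *
            ind (SrcTypical E.src F E.n E.t (fun i => (x.1 m.1 i, s.1 i, s.2 i))) *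
            ind ((fun i => (s.2 i).2) = z₁)) *
          (kerProb (ICCCode.backChannel E.chn B) (Fin.append E.w₀ p) u *
            ind (ChnTypical E.chn B E.d E.t (fun i => (w i, p i, tail u i))) *
            ind ((fun i => (u i).2) = z₂)) := by
          refine Finset.sum_le_sum fun s _ => Finset.sum_le_sum fun u _ => ?_
          rw [hback]
          have hL := mul_nonneg (ICCCode.firstLaw_nonneg E.src F s)
            (ICCCode.likelihood_nonneg E.src F (x.1 m.1) (ICCCode.received s))
          have hk := kerProb_nonneg (ICCCode.backChannel E.chn B) (Fin.append E.w₀ p) u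
          by_cases hg1 : good m s u
          · obtain ⟨g1, g2, -⟩ := hGood m s u hg1
            rw [ind_true g1, ind_true g2]
            by_cases hz : ((fun i => (s.2 i).2 : Fin E.n → Zf),
                (fun i => (u i).2 : Fin (E.k + E.d) → Zb)) = (z₁, z₂)
            · obtain ⟨e1, e2⟩ := Prod.mk.inj hz
              rw [ind_true e1, ind_true e2, ind_true hg1, ind_true hz]
              simp only [mul_one]
              exact le_rfl
            · rw [ind_false hz, mul_zero]
              have := ind_nonneg ((fun i => (s.2 i).2) = z₁)
              have := ind_nonneg ((fun i => (u i).2) = z₂)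
              positivity
          · rw [ind_false hg1, mul_zero, zero_mul]
            have := ind_nonneg ((fun i => (s.2 i).2) = z₁)
            have := ind_nonneg ((fun i => (u i).2) = z₂)
            have := ind_nonneg (SrcTypical E.src F E.n E.t (fun i => (x.1 m.1 i, s.1 i, s.2 i)))
            have := ind_nonneg (ChnTypical E.chn B E.d E.t (fun i => (w i, p i, tail u i)))
            positivity
      _ ≤ (2 ^ (E.n * infoVZ E.src F + 3 * E.t) * seqProb (srcZ E.src F) z₁) *
          (2 ^ (E.d * infoW1ZW2 E.chn B + 4 * E.t) * kerProb (cloudZ E.chn B) w (tail z₂)) := by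
          rw [← Finset.sum_mul_sum]
          refine mul_le_mul h1 h2 (Finset.sum_nonneg fun u _ => mul_nonneg (mul_nonneg
            (kerProb_nonneg _ _ _) (ind_nonneg _)) (ind_nonneg _))
            (mul_nonneg (by positivity) (seqProb_nonneg _ _))
      _ ≤ (2 ^ (E.n * infoVZ E.src F + 3 * E.t) * seqProb (srcZ E.src F) z₁) *
          (2 ^ (E.d * infoW1ZW2 E.chn B + 4 * E.t) *
            ∑ j, kerProb (cloudZ E.chn B) (x.2.1 j) (tail z₂)) := by
          refine mul_le_mul_of_nonneg_left (mul_le_mul_of_nonneg_left h3 (by positivity))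
            (mul_nonneg (by positivity) (seqProb_nonneg _ _))
      _ = E.leakage J * σ (z₁, z₂) := by
          simp only [leakage, σ]
          field_simp
  exact D.exists_secure_key good hK
    (fun m s u h => theUnique_eq_some (E.test_of_good (hGood m s u h)) fun m' hm' => by
      by_contra hne
      exact h (Or.inr ⟨m', hne, hm'⟩))
    hθ hsum hσ0 hσ (κ := E.leakage J) (by unfold leakage; positivity) hκ g hg

end Ensemble

end

section

/-! The single-letter rates in terms of marginal entropies. -/

section Rates

variable {Xf Yf Zf Xb Yb Zb : Type*} [Fintype Xf] [Fintype Yf] [Fintype Zf]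
  [Fintype Xb] [Fintype Yb] [Fintype Zb]

lemma mutualInfo_eq {Ω α β : Type*} [Fintype α] [Fintype β] (μ : PMF Ω) (A : Ω → α) (B : Ω → β) :
    mutualInfo μ A B = entropy (μ.map A) + entropy (μ.map B)
      - entropy (μ.map fun ω => (A ω, B ω)) := by
  simp only [mutualInfo, condEntropy, rvEntropy]; ring

lemma mutualInfo_le_right {Ω α β : Type*} [Fintype Ω] [Fintype α] [Fintype β] (μ : PMF Ω)
    (A : Ω → α) (B : Ω → β) : mutualInfo μ A B ≤ Real.logb 2 (Fintype.card β) := by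
  have h1 := rvEntropy_le_of_comp μ (fun ω => (A ω, B ω)) Prod.fst
  have h2 := rvEntropy_le_logb_card μ B
  simp only [mutualInfo, condEntropy]
  linarith

variable (a : SourceAux Xf Yf) (F : DMBC Xf Yf Zf)

lemma infoVX_eq : infoVX a F = mutualInfo (a.law F) (fun ω => ω.1) (fun ω => ω.2.1) :=
  (mutualInfo_eq _ _ _).symm

lemma infoVZ_eq : infoVZ a F = mutualInfo (a.law F) (fun ω => ω.1) (fun ω => ω.2.2.2) :=
  (mutualInfo_eq _ _ _).symm

lemma infoVZ_nonneg : 0 ≤ infoVZ a F := infoVZ_eq a F ▸ mutualInfo_nonneg _ _ _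

lemma srcSecretRate_eq : a.secretRate F = infoVX a F - infoVZ a F := by
  rw [SourceAux.secretRate, infoVX_eq, infoVZ_eq]

/-- Given `Y`, the variable `V` does not depend on anything else. -/
lemma toReal_law_map {β : Type*} (f : Xf × Yf × Zf → β) (g : β → Yf) (hg : ∀ r, g (f r) = r.2.1)
    (v : Fin a.cardV) (b : β) :
    ((a.law F).map (fun ω => (ω.1, f ω.2)) (v, b)).toReal
      = ((a.law F).map (fun ω => f ω.2) b).toReal * (a.kernelV (g b) v).toReal := by
  have h : (a.law F).map (fun ω => (ω.1, f ω.2))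
      = (jointPMF ((a.law F).map fun ω => f ω.2) fun b => a.kernelV (g b)).map
        (Equiv.prodComm β (Fin a.cardV)) := by
    simp only [SourceAux.law, jointPMF, PMF.map, PMF.bind_bind, PMF.pure_bind, Function.comp_def,
      Equiv.prodComm_apply, Prod.swap_prod_mk, hg, PMF.bind_const]
  rw [h, pmf_map_equiv, Equiv.prodComm_symm, Equiv.prodComm_apply, Prod.swap_prod_mk,
    jointPMF_apply, ENNReal.toReal_mul]

/-- By the Markov chain V - Y_f - X_f, I(V;Y_f|X_f) = I(V;Y_f) - I(V;X_f). -/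
lemma helperRate_eq : a.helperRate F = infoVY a F - infoVX a F := by
  have h := rvEntropy_markov (a.law F) (fun ω => ω.1) (fun ω => ω.2.2.1) (fun ω => ω.2.1) (by
    intro ω _
    have h1 := toReal_law_map a F (fun r => (r.2.1, r.1)) Prod.fst (fun _ => rfl) ω.1
      (ω.2.2.1, ω.2.1)
    have h2 := toReal_law_map a F (fun r => r.2.1) id (fun _ => rfl) ω.1 ω.2.2.1
    simp only [id] at h1 h2
    rw [h1, h2]
    ring)
  simp only [SourceAux.helperRate, condMutualInfo, condEntropy]
  simp only [rvEntropy] at h ⊢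
  simp only [infoVY, infoVX, SourceAux.lawV, SourceAux.lawVX, SourceAux.lawVY, srcX, srcY]
  linarith

variable (c : ChannelAux Xb) (B : DMBC Xb Yb Zb)

lemma totalRate_eq : c.totalRate B = infoW1Y c B := by
  have h1 := rvEntropy_law c B fun ω => ω.2.1
  have h2 := rvEntropy_law c B fun ω => ω.2.2.1
  have h3 := rvEntropy_law c B fun ω => (ω.2.1, ω.2.2.1)
  simp only [rvEntropy, outLaw_map_W1, outLaw_map_W1Y] at h1 h2 h3
  rw [ChannelAux.totalRate, mutualInfo_eq, h1, h2, h3]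
  rfl

lemma totalRate_le : c.totalRate B ≤ Real.logb 2 (Fintype.card Yb) := by
  rw [totalRate_eq]
  have := mutualInfo_le_right (outLaw c B) (fun ω => ω.2.1) (fun ω => ω.2.2.1)
  rw [mutualInfo_eq, outLaw_map_W1, outLaw_map_W1Y] at this
  exact this

lemma infoW2Y_nonneg : 0 ≤ infoW2Y c B := by
  have := mutualInfo_nonneg (outLaw c B) (fun ω => ω.1) (fun ω => ω.2.2.1)
  rw [mutualInfo_eq, outLaw_map_W2] at this
  exact this

lemma rvEntropy_outLaw_markov :
    rvEntropy (outLaw c B) (fun ω => (ω.1, ω.2.1, ω.2.2.1)) + rvEntropy (outLaw c B) (fun ω => ω.2.1)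
      = rvEntropy (outLaw c B) (fun ω => (ω.1, ω.2.1))
        + rvEntropy (outLaw c B) (fun ω => (ω.2.1, ω.2.2.1)) := by
  refine rvEntropy_markov (outLaw c B) (fun ω => ω.1) (fun ω => ω.2.1) (fun ω => ω.2.2.1)
    fun ω _ => ?_
  obtain ⟨w₂, w₁, y, z⟩ := ω
  simp only [outLaw_map_W2W1Y, outLaw_map_W1Y_eq, outLaw_map_W2W1, outLaw_map_W1, jointPMF_apply,
    ENNReal.toReal_mul]
  ring

lemma condMutualInfo_W1Z : condMutualInfo (c.law B) (fun ω => ω.2.1) (fun ω => ω.2.2.2.2)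
    (fun ω => ω.1) = infoW1ZW2 c B := by
  have h1 := rvEntropy_law c B fun ω => (ω.2.1, ω.1)
  have h2 := rvEntropy_law c B fun ω => ω.1
  have h3 := rvEntropy_law c B fun ω => (ω.2.1, ω.2.2.2, ω.1)
  have h4 := rvEntropy_law c B fun ω => (ω.2.2.2, ω.1)
  have e1 := rvEntropy_of_injective (outLaw c B) (fun ω => (ω.1, ω.2.1)) (f := fun p => (p.2, p.1))
    (fun p q h => by simp only [Prod.mk.injEq] at h; exact Prod.ext h.2 h.1)
  have e3 := rvEntropy_of_injective (outLaw c B) (fun ω => (ω.1, ω.2.1, ω.2.2.2))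
    (f := fun p => (p.2.1, p.2.2, p.1))
    (fun p q h => by
      simp only [Prod.mk.injEq] at h; exact Prod.ext h.2.2 (Prod.ext h.1 h.2.1))
  have e4 := rvEntropy_of_injective (outLaw c B) (fun ω => (ω.1, ω.2.2.2))
    (f := fun p => (p.2, p.1))
    (fun p q h => by simp only [Prod.mk.injEq] at h; exact Prod.ext h.2 h.1)
  simp only at h1 h2 h3 h4 e1 e3 e4
  simp only [condMutualInfo, condEntropy]
  rw [h1, h2, h3, h4, e1, e3, e4]
  simp only [rvEntropy, outLaw_map_W2, infoW1ZW2, outW2W1, outW2Z, outW2W1Z]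
  ring

/-- By the Markov chain W₂ - W₁ - Y_b, I(W₁;Y_b|W₂) = I(W₁;Y_b) - I(W₂;Y_b): the cloud centers take
exactly I(W₂;Y_b) from the total rate. -/
lemma condMutualInfo_W1Y : condMutualInfo (c.law B) (fun ω => ω.2.1) (fun ω => ω.2.2.2.1)
    (fun ω => ω.1) = infoW1Y c B - infoW2Y c B := by
  have h1 := rvEntropy_law c B fun ω => (ω.2.1, ω.1)
  have h2 := rvEntropy_law c B fun ω => ω.1
  have h3 := rvEntropy_law c B fun ω => (ω.2.1, ω.2.2.1, ω.1)
  have h4 := rvEntropy_law c B fun ω => (ω.2.2.1, ω.1)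
  have e1 := rvEntropy_of_injective (outLaw c B) (fun ω => (ω.1, ω.2.1)) (f := fun p => (p.2, p.1))
    (fun p q h => by simp only [Prod.mk.injEq] at h; exact Prod.ext h.2 h.1)
  have e3 := rvEntropy_of_injective (outLaw c B) (fun ω => (ω.1, ω.2.1, ω.2.2.1))
    (f := fun p => (p.2.1, p.2.2, p.1))
    (fun p q h => by
      simp only [Prod.mk.injEq] at h; exact Prod.ext h.2.2 (Prod.ext h.1 h.2.1))
  have e4 := rvEntropy_of_injective (outLaw c B) (fun ω => (ω.1, ω.2.2.1))
    (f := fun p => (p.2, p.1))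
    (fun p q h => by simp only [Prod.mk.injEq] at h; exact Prod.ext h.2 h.1)
  have m := rvEntropy_outLaw_markov c B
  simp only at h1 h2 h3 h4 e1 e3 e4
  simp only [condMutualInfo, condEntropy]
  rw [h1, h2, h3, h4, e1, e3, e4]
  simp only [rvEntropy, outLaw_map_W2, outLaw_map_W1, outLaw_map_W1Y] at m ⊢
  simp only [infoW1Y, infoW2Y, outW2Y]
  linarith

lemma infoW1ZW2_nonneg : 0 ≤ infoW1ZW2 c B := by
  have h := condMutualInfo_nonneg (outLaw c B) (fun ω => ω.2.1) (fun ω => ω.2.2.2) (fun ω => ω.1)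
  have h1 := rvEntropy_law c B fun ω => (ω.2.1, ω.1)
  have h2 := rvEntropy_law c B fun ω => ω.1
  have h3 := rvEntropy_law c B fun ω => (ω.2.1, ω.2.2.2, ω.1)
  have h4 := rvEntropy_law c B fun ω => (ω.2.2.2, ω.1)
  simp only at h1 h2 h3 h4
  rw [← condMutualInfo_W1Z]
  simp only [condMutualInfo, condEntropy] at h ⊢
  rwa [h1, h2, h3, h4]

lemma chnSecretRate_eq : c.secretRate B = infoW1Y c B - infoW2Y c B - infoW1ZW2 c B := by
  rw [ChannelAux.secretRate, condMutualInfo_W1Z, condMutualInfo_W1Y]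

lemma helperRate_nonneg : 0 ≤ a.helperRate F := condMutualInfo_nonneg _ _ _ _

lemma srcSecretRate_le : a.secretRate F ≤ Real.logb 2 (Fintype.card Xf) := by
  rw [srcSecretRate_eq, infoVX_eq]
  have := mutualInfo_le_right (a.law F) (fun ω => ω.1) (fun ω => ω.2.1)
  linarith [infoVZ_nonneg a F]

lemma chnSecretRate_le : c.secretRate B ≤ Real.logb 2 (Fintype.card Yb) := by
  have := totalRate_le c B
  rw [totalRate_eq] at this
  rw [chnSecretRate_eq]
  linarith [infoW2Y_nonneg c B, infoW1ZW2_nonneg c B]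

/-- The two secret rates are at most log|X_f| and log|Y_b| whatever the auxiliary alphabets are, and
a weighted mean of them is at most the sum of these nonnegative bounds. -/
theorem bddAbove_rateSet : BddAbove (rateSet F B) := by
  refine ⟨Real.logb 2 (Fintype.card Xf) + Real.logb 2 (Fintype.card Yb), ?_⟩
  have hlog : ∀ m : ℕ, 0 ≤ Real.logb 2 m := fun m => by
    rcases Nat.eq_zero_or_pos m with rfl | h
    · simp
    · exact Real.logb_nonneg (by norm_num) (by exact_mod_cast h)
  have hX := hlog (Fintype.card Xf)
  have hY := hlog (Fintype.card Yb)
  rintro _ ⟨nf, nb, a, c, -, rfl⟩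
  refine div_le_of_le_mul₀ (by positivity) (by positivity) ?_
  have h1 := mul_le_mul_of_nonneg_left (srcSecretRate_le a F) (Nat.cast_nonneg (α := ℝ) nf)
  have h2 := mul_le_mul_of_nonneg_left (chnSecretRate_le c B) (Nat.cast_nonneg (α := ℝ) nb)
  have h3 := mul_nonneg hX (Nat.cast_nonneg (α := ℝ) nb)
  have h4 := mul_nonneg hY (Nat.cast_nonneg (α := ℝ) nf)
  linarith

end Rates

end

section

open Filter Topology

/-! Existence of typical sequences and of balanced functions. -/

lemma eventually_typicalMass {α : Type*} [Fintype α] (p : PMF α) {ε : ℝ} (hε : 0 < ε) :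
    ∀ᶠ n : ℕ in atTop, 1 / 2 ≤ ∑ u : Fin n → α, seqProb p u * ind (IsTypical p ε u) := by
  obtain ⟨V, hV0, hV⟩ := concentrated_logDev p id
  rw [PMF.map_id] at hV
  -- Chebyshev with deviation nε/2 gives 4V/(nε²), which is at most 1/2 once n ≥ 8V/ε².
  filter_upwards [eventually_gt_atTop 0, eventually_ge_atTop ⌈8 * V / ε ^ 2⌉₊] with n hn hn'
  have hn0 : (0 : ℝ) < n := by exact_mod_cast hn
  have h8 : 8 * V / ε ^ 2 ≤ n := (Nat.le_ceil _).trans (by exact_mod_cast hn')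
  have h1 := hV n (n * ε / 2) (by positivity)
  have h2 : n * V / (n * ε / 2) ^ 2 ≤ 1 / 2 := by
    rw [div_le_iff₀ (by positivity)] at h8 ⊢
    nlinarith
  have h3 : ∑ u : Fin n → α, seqProb p u ≤ ∑ u : Fin n → α, (seqProb p u * ind (IsTypical p ε u)
      + seqProb p u * ind (¬ |logDev p u| ≤ n * ε / 2)) := by
    refine Finset.sum_le_sum fun u _ => ?_
    by_cases h0 : seqProb p u = 0
    · rw [h0]; simp
    by_cases h : |logDev p u| ≤ n * ε / 2
    · rw [ind_true (P := IsTypical p ε u)]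
      · have := mul_nonneg (seqProb_nonneg p u) (ind_nonneg (¬ |logDev p u| ≤ n * ε / 2))
        linarith
      · rw [isTypical_iff hn]
        exact ⟨h0, h.trans_lt (by nlinarith [mul_pos hn0 hε])⟩
    · rw [ind_true h]
      have := mul_nonneg (seqProb_nonneg p u) (ind_nonneg (IsTypical p ε u))
      linarith
  rw [sum_seqProb, Finset.sum_add_distrib] at h3
  simp only [id] at h1
  linarith

lemma exists_isTypical {α : Type*} [Fintype α] (p : PMF α) {ε : ℝ} (hε : 0 < ε) :
    ∃ (k : ℕ) (u : Fin k → α), 0 < k ∧ IsTypical p ε u := by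
  obtain ⟨k, h, hk⟩ := ((eventually_typicalMass p hε).and (eventually_gt_atTop 0)).exists
  by_contra hn
  push Not at hn
  rw [Finset.sum_eq_zero fun u _ => by rw [ind_false (hn k u hk), mul_zero]] at h
  norm_num at h

/-- All sizes are powers of two, so divisibility is automatic and a projection of a product works.
-/
lemma exists_balanced {a b c : ℕ} (h : c ≤ a + b) :
    ∃ g : Fin (2 ^ a) × Fin (2 ^ b) → Fin (2 ^ c), ∀ k, ∑ m, ind (g m = k)
      = ((2 ^ a : ℕ) * (2 ^ b : ℕ) : ℝ) / (2 ^ c : ℕ) := by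
  have e : Fin (2 ^ a) × Fin (2 ^ b) ≃ Fin (2 ^ c) × Fin (2 ^ (a + b - c)) :=
    Fintype.equivOfCardEq (by
      simp only [Fintype.card_prod, Fintype.card_fin, ← pow_add]
      rw [Nat.add_sub_cancel' h])
  refine ⟨fun m => (e m).1, fun k => ?_⟩
  rw [e.sum_comp (fun x => ind (x.1 = k)), Fintype.sum_prod_type, Finset.sum_eq_single k]
  · simp only [ind_true, Finset.sum_const, Finset.card_univ, Fintype.card_fin, nsmul_eq_mul,
      mul_one]
    rw [eq_div_iff (by positivity)]
    push_cast
    rw [← pow_add, ← pow_add, Nat.sub_add_cancel h]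
  · intro k' _ hk'
    exact Finset.sum_eq_zero fun x _ => ind_false hk'
  · simp

/-! Bounds for codebooks of given exponential sizes. -/

section Exponents

variable {Xf Yf Zf Xb Yb Zb : Type*} [Fintype Xf] [Fintype Yf] [Fintype Zf]
  [Fintype Xb] [Fintype Yb] [Fintype Zb] {F : DMBC Xf Yf Zf} {B : DMBC Xb Yb Zb}

/-- The slack s is required in every exponent: `ha` provides enough V-words for covering, `hj` makes
the penalty for a shared cloud subdominant, `hab` handles wrong messages with another V-word, and
`hb` those with the true one, for which only the second round discriminates. -/
lemma Ensemble.errorBound_le (E : Ensemble F B) (ht : 0 ≤ E.t) {a b j : ℕ} {s : ℝ}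
    (ha : E.n * infoVY E.src F + 3 * (E.n * E.ε) + s ≤ a) (hj : E.d * infoW2Y E.chn B ≤ j)
    (hab : a + b + 3 * E.t + 3 * ((E.n + (E.k + E.d : ℕ)) * E.ε) + E.C + 3 + s
      ≤ E.n * infoVX E.src F + E.d * infoW1Y E.chn B)
    (hb : b + 6 * E.t + 3 * ((E.n + (E.k + E.d : ℕ)) * E.ε) + E.C + 2 + s
      ≤ E.d * infoW1Y E.chn B) :
    E.errorBound (2 ^ a : ℕ) (2 ^ b : ℕ) (2 ^ j : ℕ) ≤
      5 * E.srcDefect + 2 * E.chnDefect + √(2 * 2 ^ (-s)) + 2 * 2 ^ (-s) := by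
  have h2 : (0 : ℝ) < 2 := by norm_num
  have hpow : ∀ m : ℕ, ((2 ^ m : ℕ) : ℝ) = (2 : ℝ) ^ (m : ℝ) := fun m => by
    rw [Real.rpow_natCast]; push_cast; rfl
  have hone : (2 : ℝ) ^ (1 : ℝ) = 2 := Real.rpow_one 2
  have htwo : (2 : ℝ) ^ (2 : ℝ) = 4 := by norm_num
  rw [errorBound, hpow, hpow, hpow]
  have hsq : √(2 * 2 ^ (E.n * infoVY E.src F + 3 * (E.n * E.ε)) / 2 ^ (a : ℝ))
      ≤ √(2 * 2 ^ (-s)) := by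
    refine Real.sqrt_le_sqrt ?_
    rw [mul_div_assoc, ← Real.rpow_sub h2]
    refine mul_le_mul_of_nonneg_left (Real.rpow_le_rpow_of_exponent_le (by norm_num) ?_) h2.le
    linarith
  have hcloud : 1 + (2 : ℝ) ^ (E.d * infoW2Y E.chn B + 3 * E.t) / 2 ^ (j : ℝ)
      ≤ 2 ^ (1 + 3 * E.t) := by
    rw [← Real.rpow_sub h2, Real.rpow_add h2, hone]
    have h1 : (1 : ℝ) ≤ 2 ^ (3 * E.t) := Real.one_le_rpow (by norm_num) (by linarith)
    have h3 : (2 : ℝ) ^ (E.d * infoW2Y E.chn B + 3 * E.t - j) ≤ 2 ^ (3 * E.t) :=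
      Real.rpow_le_rpow_of_exponent_le (by norm_num) (by linarith)
    linarith
  set τ : ℝ := 2 ^ (-(E.n * infoVX E.src F + E.d * infoW1Y E.chn B)
        + 3 * ((E.n + (E.k + E.d : ℕ)) * E.ε) + E.C) with hτ
  have hτ0 : 0 < τ := by positivity
  have hmain : τ * (1 + 2 ^ (E.d * infoW2Y E.chn B + 3 * E.t) / 2 ^ (j : ℝ)) *
      (4 * (2 ^ (a : ℝ) * 2 ^ (b : ℝ)) + 2 * 2 ^ (E.n * infoVX E.src F + 3 * E.t) * 2 ^ (b : ℝ))
      ≤ 2 * 2 ^ (-s) := by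
    calc _ ≤ τ * 2 ^ (1 + 3 * E.t) * (4 * (2 ^ (a : ℝ) * 2 ^ (b : ℝ))
            + 2 * 2 ^ (E.n * infoVX E.src F + 3 * E.t) * 2 ^ (b : ℝ)) :=
          mul_le_mul_of_nonneg_right (mul_le_mul_of_nonneg_left hcloud hτ0.le) (by positivity)
      _ = 2 ^ (-(E.n * infoVX E.src F + E.d * infoW1Y E.chn B)
            + 3 * ((E.n + (E.k + E.d : ℕ)) * E.ε) + E.C + (1 + 3 * E.t) + (2 + (a + b)))
          + 2 ^ (-(E.n * infoVX E.src F + E.d * infoW1Y E.chn B)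
            + 3 * ((E.n + (E.k + E.d : ℕ)) * E.ε) + E.C + (1 + 3 * E.t)
            + (1 + (E.n * infoVX E.src F + 3 * E.t) + b)) := by
          rw [hτ, Real.rpow_add h2 _ (2 + (a + b : ℝ)), Real.rpow_add h2 2 (a + b : ℝ),
            Real.rpow_add h2 (a : ℝ), htwo, Real.rpow_add h2 _ (_ + (b : ℝ)),
            Real.rpow_add h2 _ (1 + 3 * E.t), Real.rpow_add h2 _ (b : ℝ), Real.rpow_add h2 1 (E.n * infoVX E.src F + 3 * E.t), hone]
          ring
      _ ≤ 2 ^ (-s) + 2 ^ (-s) := by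
          refine add_le_add (Real.rpow_le_rpow_of_exponent_le (by norm_num) ?_)
            (Real.rpow_le_rpow_of_exponent_le (by norm_num) ?_) <;> linarith
      _ = 2 * 2 ^ (-s) := by ring
  linarith

/-- The hash lemma needs the key length c to stay below the message length a + b by the logarithm of
the leakage, with slack s. -/
lemma Ensemble.leakage_le (E : Ensemble F B) {a b c j : ℕ} {s L : ℝ}
    (hL : (Fintype.card Zb : ℝ) ^ E.k ≤ 2 ^ L)
    (h : 1 + c + (E.n * infoVZ E.src F + 3 * E.t) + (E.d * infoW1ZW2 E.chn B + 4 * E.t) + j + L + s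
      ≤ a + b) :
    2 * (2 ^ c : ℕ) * (E.leakage (2 ^ j : ℕ) / ((2 ^ a : ℕ) * (2 ^ b : ℕ))) ≤ (2 : ℝ) ^ (-s) := by
  have h2 : (0 : ℝ) < 2 := by norm_num
  have hpow : ∀ m : ℕ, ((2 ^ m : ℕ) : ℝ) = (2 : ℝ) ^ (m : ℝ) := fun m => by
    rw [Real.rpow_natCast]; push_cast; rfl
  rw [leakage, hpow, hpow, hpow, hpow, mul_div_assoc', div_le_iff₀ (by positivity),
    ← Real.rpow_add h2, ← Real.rpow_add h2, ← Real.rpow_add h2]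
  calc _ ≤ 2 * (2 : ℝ) ^ (c : ℝ) * (2 ^ (E.n * infoVZ E.src F + 3 * E.t
          + (E.d * infoW1ZW2 E.chn B + 4 * E.t)) * (2 ^ (j : ℝ) * 2 ^ L)) := by
        gcongr
    _ = 2 ^ (1 + c + (E.n * infoVZ E.src F + 3 * E.t + (E.d * infoW1ZW2 E.chn B + 4 * E.t))
          + (j + L)) := by
        rw [Real.rpow_add h2 _ (j + L : ℝ), Real.rpow_add h2 (1 + c : ℝ), Real.rpow_add h2 1,
          Real.rpow_add h2 (j : ℝ), Real.rpow_one]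
        ring
    _ ≤ _ := Real.rpow_le_rpow_of_exponent_le (by norm_num) (by linarith)

end Exponents

/-! Limits. -/

lemma tendsto_two_rpow_neg {η : ℝ} (hη : 0 < η) :
    Tendsto (fun q : ℕ => (2 : ℝ) ^ (-(q * η))) atTop (𝓝 0) := by
  have h1 : Tendsto (fun q : ℕ => -((q : ℝ) * η)) atTop atBot :=
    tendsto_neg_atTop_atBot.comp (tendsto_natCast_atTop_atTop.atTop_mul_const hη)
  exact (tendsto_rpow_atBot_of_base_gt_one 2 (by norm_num)).comp h1

lemma tendsto_error_zero {η : ℝ} (hη : 0 < η) (A : ℝ) :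
    Tendsto (fun q : ℕ => A / q + √(2 * 2 ^ (-(q * η))) + 2 * 2 ^ (-(q * η))) atTop (𝓝 0) := by
  have h := tendsto_two_rpow_neg hη
  have h1 := (h.const_mul 2).sqrt
  have h2 := ((tendsto_const_div_atTop_nhds_zero_nat A).add h1).add (h.const_mul 2)
  simpa using h2

/-- The entropy bounds that security needs hold for all large numbers of blocks. -/
lemma eventually_entropy_bounds {e : ℕ → ℝ} (he : Tendsto e atTop (𝓝 0)) {r N k R' δ : ℝ}
    (hr : 0 < r) (hδ : 0 < δ) (hR : N * R' < r) :
    ∀ᶠ q : ℕ in atTop, 0 < (1 - e q) * ((⌊q * r⌋₊ : ℝ) - 2) ∧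
      (q * N + k) * R' < (1 - e q) * ((⌊q * r⌋₊ : ℝ) - 2) ∧
      (1 - δ) * ((⌊q * r⌋₊ : ℝ) + 1) < (1 - e q) * ((⌊q * r⌋₊ : ℝ) - 2) := by
  have hf : Tendsto (fun q : ℕ => (⌊q * r⌋₊ : ℝ) / q) atTop (𝓝 r) := by
    have := (tendsto_nat_floor_mul_div_atTop hr.le).comp (tendsto_natCast_atTop_atTop (R := ℝ))
    refine this.congr fun q => ?_
    simp only [Function.comp, mul_comm]
  have hc : ∀ x : ℝ, Tendsto (fun q : ℕ => x / (q : ℝ)) atTop (𝓝 0) :=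
    tendsto_const_div_atTop_nhds_zero_nat
  -- After division by q the three comparisons become 0 < r, N R' < r and (1 - δ) r < r in the
  -- limit.
  have h1 : Tendsto (fun q : ℕ => (1 - e q) * ((⌊q * r⌋₊ : ℝ) / q - 2 / q)) atTop
      (𝓝 ((1 - 0) * (r - 0))) := (tendsto_const_nhds.sub he).mul (hf.sub (hc 2))
  have h2 : Tendsto (fun q : ℕ => (N + k / q) * R') atTop (𝓝 ((N + 0) * R')) :=
    (tendsto_const_nhds.add (hc k)).mul_const R'
  have h3 : Tendsto (fun q : ℕ => (1 - δ) * ((⌊q * r⌋₊ : ℝ) / q + 1 / q)) atTop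
      (𝓝 ((1 - δ) * (r + 0))) := (hf.add (hc 1)).const_mul _
  simp only [sub_zero, one_mul, add_zero] at h1 h2 h3
  have h31 : (1 - δ) * r < r := by nlinarith
  filter_upwards [h1.eventually_const_lt hr, h2.eventually_lt h1 hR, h3.eventually_lt h1 h31,
    eventually_gt_atTop 0] with q g1 g2 g3 hq
  have hq' : (0 : ℝ) < q := by exact_mod_cast hq
  have e1 : (1 - e q) * ((⌊q * r⌋₊ : ℝ) - 2)
      = q * ((1 - e q) * ((⌊q * r⌋₊ : ℝ) / q - 2 / q)) := by field_simp
  have e2 : (q * N + k) * R' = q * ((N + k / q) * R') := by field_simp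
  have e3 : (1 - δ) * ((⌊q * r⌋₊ : ℝ) + 1)
      = q * ((1 - δ) * ((⌊q * r⌋₊ : ℝ) / q + 1 / q)) := by field_simp
  rw [e1, e2, e3]
  exact ⟨mul_pos hq' g1, mul_lt_mul_of_pos_left g2 hq', mul_lt_mul_of_pos_left g3 hq'⟩

end

/-! ### Choice of the code sizes and achievability. -/

section

open Filter Topology

section Achievability

variable {Xf Yf Zf Xb Yb Zb : Type*} [Fintype Xf] [Fintype Yf] [Fintype Zf]
  [Fintype Xb] [Fintype Yb] [Fintype Zb] {F : DMBC Xf Yf Zf} {B : DMBC Xb Yb Zb}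

set_option maxHeartbeats 1000000 in
/-- Rates that are achieved with a positive proportion of uses of both channels. -/
theorem hasSecureICC_of_lt [Nonempty Xb] (a : SourceAux Xf Yf) (c : ChannelAux Xb) {nf nb : ℕ}
    (hnf : 0 < nf) (hnb : 0 < nb) (hrate : nf * a.helperRate F < nb * c.totalRate B) {R δ : ℝ}
    (hδ : 0 < δ) (hpos : 0 < nf * a.secretRate F + nb * c.secretRate B)
    (hR : (nf + nb) * (R - δ) < nf * a.secretRate F + nb * c.secretRate B) :
    HasSecureICC F B R δ := by
  have hhelp := helperRate_nonneg a F
  rw [helperRate_eq] at hrate hhelp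
  rw [totalRate_eq] at hrate
  rw [srcSecretRate_eq, chnSecretRate_eq] at hpos hR
  have hZ0 := infoVZ_nonneg a F
  have hU0 := infoW2Y_nonneg c B
  have hL0 := infoW1ZW2_nonneg c B
  set ρ := nf * (infoVX a F - infoVZ a F)
    + nb * (infoW1Y c B - infoW2Y c B - infoW1ZW2 c B) with hρ
  have hnf1 : (1 : ℝ) ≤ nf := by exact_mod_cast hnf
  have hnb1 : (1 : ℝ) ≤ nb := by exact_mod_cast hnb
  -- The budget of slack in units of qη: 3nf for the covering margin, 3nf + 3nb for the decoding
  -- test, and 10 for the tolerances, the slack s and rounding. The further 5 in G + 5 covers the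
  -- secrecy tolerances 3t + 4t and s, that is 4.5 units for t = qη/2 and s = qη.
  set G : ℝ := 6 * nf + 3 * nb + 10 with hG
  have hG0 : 0 < G + 5 := by positivity
  obtain ⟨η, hη, hη1, hη2, hη3⟩ : ∃ η : ℝ, 0 < η ∧ (G + 5) * η < ρ ∧
      (G + 5) * η < nb * infoW1Y c B - nf * (infoVY a F - infoVX a F) ∧
      (G + 5) * η < ρ - (nf + nb) * (R - δ) := by
    set m := min ρ (min (nb * infoW1Y c B - nf * (infoVY a F - infoVX a F))
      (ρ - (nf + nb) * (R - δ))) with hm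
    have hm0 : 0 < m := lt_min hpos (lt_min (by linarith) (by linarith))
    have e : (G + 5) * (m / (2 * (G + 5))) = m / 2 := by field_simp
    refine ⟨m / (2 * (G + 5)), by positivity, ?_, ?_, ?_⟩ <;> rw [e]
    · linarith [min_le_left ρ (min (nb * infoW1Y c B - nf * (infoVY a F - infoVX a F))
        (ρ - (nf + nb) * (R - δ)))]
    · have := (min_le_right ρ (min (nb * infoW1Y c B - nf * (infoVY a F - infoVX a F))
        (ρ - (nf + nb) * (R - δ)))).trans (min_le_left _ _)
      linarith
    · have := (min_le_right ρ (min (nb * infoW1Y c B - nf * (infoVY a F - infoVX a F))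
        (ρ - (nf + nb) * (R - δ)))).trans (min_le_right _ _)
      linarith
  -- The prefix is fixed before q grows, so its deviations C and its leakage L are constants.
  obtain ⟨k, w₀, hk, hw₀⟩ := exists_isTypical c.lawW1 hη
  obtain ⟨C₁, hC₁, hC₁'⟩ := exists_logDev_le c.lawW1 k
  obtain ⟨C₂, hC₂, hC₂'⟩ := exists_logDev_le (outY c B) k
  obtain ⟨C₃, hC₃, hC₃'⟩ := exists_logDev_le (c.lawW1Y B) k
  obtain ⟨C, hC, hC'⟩ : ∃ C : ℝ, 0 ≤ C ∧ ∀ (u : Fin k → Fin c.cardW1) (y : Fin k → Yb),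
      |logDev c.lawW1 u| + |logDev (outY c B) y| + |logDev (c.lawW1Y B) fun i => (u i, y i)| ≤ C :=
    ⟨C₁ + C₂ + C₃, by positivity, fun u y =>
      add_le_add (add_le_add (hC₁' u) (hC₂' y)) (hC₃' _)⟩
  obtain ⟨L, hL, hL'⟩ : ∃ L : ℝ, 0 ≤ L ∧ (Fintype.card Zb : ℝ) ^ k ≤ 2 ^ L := by
    have h0 : (0 : ℝ) ≤ (Fintype.card Zb : ℝ) ^ k := by positivity
    refine ⟨Real.logb 2 ((Fintype.card Zb : ℝ) ^ k + 1),
      Real.logb_nonneg (by norm_num) (by linarith), ?_⟩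
    rw [Real.rpow_logb (by norm_num) (by norm_num) (by positivity)]
    linarith
  obtain ⟨V₁, -, hV₁⟩ := concentrated_srcTypical a F
  obtain ⟨V₂, -, hV₂⟩ := concentrated_chnTypical c B
  set r := ρ - (G + 5) * η with hr
  -- Chebyshev with t = qη/2 gives 5 · 4 nf V₁/(qη²) and 2 · 4 nb V₂/(qη²).
  set A : ℝ := (20 * nf * V₁ + 8 * nb * V₂) / η ^ 2 with hA
  obtain ⟨err, herr, herr0⟩ : ∃ err : ℕ → ℝ, (∀ q : ℕ, err q =
      A / q + √(2 * 2 ^ (-(q * η))) + 2 * 2 ^ (-(q * η))) ∧ Tendsto err atTop (𝓝 0) :=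
    ⟨_, fun _ => rfl, tendsto_error_zero hη A⟩
  have hsq0 := (tendsto_two_rpow_neg hη).sqrt
  rw [Real.sqrt_zero] at hsq0
  have he0 : Tendsto (fun q : ℕ => 5 * (err q + √(2 ^ (-(q * η))))) atTop (𝓝 0) := by
    simpa using (herr0.add hsq0).const_mul 5
  have hmul : Tendsto (fun q : ℕ => (q : ℝ) * η) atTop atTop :=
    tendsto_natCast_atTop_atTop.atTop_mul_const hη
  have hmulr : Tendsto (fun q : ℕ => (q : ℝ) * r) atTop atTop :=
    tendsto_natCast_atTop_atTop.atTop_mul_const (by linarith)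
  have hlen : Tendsto (fun q : ℕ => q * nf) atTop atTop :=
    tendsto_id.atTop_mul_const' hnf
  have ev₁ := eventually_entropy_bounds he0 (r := r) (N := nf + nb) (k := k) (R' := R - δ) (δ := δ)
    (by linarith) hδ (by linarith)
  have ev₂ : ∀ᶠ q : ℕ in atTop, 7 + 3 * k * η + C + L ≤ q * η := hmul.eventually_ge_atTop _
  have ev₃ : ∀ᶠ q : ℕ in atTop, 2 ≤ q * r := hmulr.eventually_ge_atTop _
  have ev₄ := hlen.eventually (eventually_typicalMass (a.lawV F) hη)
  have ev₅ : ∀ᶠ q : ℕ in atTop, err q < δ := herr0.eventually_lt_const hδ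
  have ev₆ : ∀ᶠ q : ℕ in atTop, err q < 1 := herr0.eventually_lt_const one_pos
  obtain ⟨q, hq, hent, hqη, hqr, hhalf, herrδ, herr1⟩ := ((eventually_gt_atTop 0).and
    (ev₁.and (ev₂.and (ev₃.and (ev₄.and (ev₅.and ev₆)))))).exists
  have hq' : (0 : ℝ) < q := by exact_mod_cast hq
  have hkη : 0 ≤ 3 * (k : ℝ) * η := by positivity
  have hQ : 0 < (q : ℝ) * η := by positivity
  have hQf : (q : ℝ) * η ≤ q * nf * η := by
    calc (q : ℝ) * η = q * 1 * η := by ring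
      _ ≤ q * nf * η := by gcongr
  have hQb : (q : ℝ) * η ≤ q * nb * η := by
    calc (q : ℝ) * η = q * 1 * η := by ring
      _ ≤ q * nb * η := by gcongr
  obtain ⟨E, rfl, rfl, hEn, hEk, hEd, hEε, hEt, hEC⟩ : ∃ E : Ensemble F B, E.src = a ∧ E.chn = c ∧
      E.n = q * nf ∧ E.k = k ∧ E.d = q * nb ∧ E.ε = η ∧ E.t = q * η / 2 ∧ E.C = C :=
    ⟨{ src := a, chn := c, n := q * nf, k := k, d := q * nb, n_pos := by positivity
       k_pos := hk, ε := η, ε_pos := hη, t := q * η / 2, C := C, w₀ := w₀, w₀_typical := hw₀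
       dev_le := hC'
       t_lt := by push_cast; linarith
       two_t_lt := by push_cast; linarith
       half_le := hhalf }, rfl, rfl, rfl, rfl, rfl, rfl, rfl, rfl⟩
  have hEn' : (E.n : ℝ) = q * nf := by rw [hEn]; push_cast; rfl
  have hEd' : (E.d : ℝ) = q * nb := by rw [hEd]; push_cast; rfl
  have hEt0 : 0 < E.t := by rw [hEt]; positivity
  have hsrc : E.srcDefect ≤ E.n * V₁ / E.t ^ 2 := hV₁ E.n E.t hEt0
  have hchn : E.chnDefect ≤ E.d * V₂ / E.t ^ 2 := hV₂ E.d E.t hEt0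
  -- From here on, a, b, j and c are the binary logarithms of the numbers of V-words, information
  -- words, cloud centers and key values.
  set a := ⌈(q : ℝ) * (nf * infoVY E.src F + 3 * nf * η + η)⌉₊ with ha
  set b := ⌊(q : ℝ) * (nb * infoW1Y E.chn B - nf * (infoVY E.src F - infoVX E.src F) - G * η)⌋₊
    with hb
  set j := ⌈(q : ℝ) * (nb * infoW2Y E.chn B)⌉₊ with hj
  set c := ⌊(q : ℝ) * r⌋₊ with hc
  have hY0 : 0 ≤ infoVY E.src F := by
    have := mutualInfo_nonneg (E.src.law F) (fun ω => ω.1) (fun ω => ω.2.1)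
    rw [← infoVX_eq] at this
    linarith
  have ha1 : (q : ℝ) * (nf * infoVY E.src F + 3 * nf * η + η) ≤ a := Nat.le_ceil _
  have ha2 : (a : ℝ) < q * (nf * infoVY E.src F + 3 * nf * η + η) + 1 :=
    Nat.ceil_lt_add_one (by positivity)
  -- The floor is of a nonnegative number by the choice of η; this is where the strict constraint
  -- between the two rounds enters.
  have hb1 : (b : ℝ) ≤ q * (nb * infoW1Y E.chn B - nf * (infoVY E.src F - infoVX E.src F)
      - G * η) := Nat.floor_le (mul_nonneg hq'.le (by nlinarith))
  have hb2 : (q : ℝ) * (nb * infoW1Y E.chn B - nf * (infoVY E.src F - infoVX E.src F)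
      - G * η) < b + 1 := Nat.lt_floor_add_one _
  have hj1 : (q : ℝ) * (nb * infoW2Y E.chn B) ≤ j := Nat.le_ceil _
  have hj2 : (j : ℝ) < q * (nb * infoW2Y E.chn B) + 1 := Nat.ceil_lt_add_one (by positivity)
  have hc1 : (c : ℝ) ≤ q * r := Nat.floor_le (by linarith)
  have hc2 : 2 ≤ c := Nat.le_floor (by exact_mod_cast hqr)
  have hgap : 0 ≤ (q : ℝ) * (nf * (infoVY E.src F - infoVX E.src F)) := by positivity
  have hZq : 0 ≤ (q : ℝ) * (nf * infoVZ E.src F) := by positivity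
  have hUq : 0 ≤ (q : ℝ) * (nb * infoW2Y E.chn B) := by positivity
  have hLq : 0 ≤ (q : ℝ) * (nb * infoW1ZW2 E.chn B) := by positivity
  rw [hr, hρ, hG] at hc1
  rw [hG] at hb1 hb2
  have hcab : c ≤ a + b := by
    have : (c : ℝ) < a + b + 1 := by linarith
    have : c < a + b + 1 := by exact_mod_cast this
    omega
  obtain ⟨g, hg⟩ := exists_balanced hcab
  have herrE : E.errorBound (2 ^ a : ℕ) (2 ^ b : ℕ) (2 ^ j : ℕ) ≤ err q := by
    refine (E.errorBound_le hEt0.le (s := q * η) ?_ ?_ ?_ ?_).trans ?_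
    · rw [hEn', hEε]; linarith
    · rw [hEd']; linarith
    · push_cast
      rw [hEn', hEd', hEε, hEt, hEC, hEk]; linarith
    · push_cast
      rw [hEn', hEd', hEε, hEt, hEC, hEk]; linarith
    · rw [hEn', hEt] at hsrc
      rw [hEd', hEt] at hchn
      have e : A / q = 5 * (q * nf * V₁ / (q * η / 2) ^ 2) + 2 * (q * nb * V₂ / (q * η / 2) ^ 2) := by
        rw [hA]; field_simp; ring
      rw [herr]
      linarith
  have hleak := E.leakage_le (a := a) (b := b) (c := c) (j := j) (s := q * η) (L := L)
    (by rw [hEk]; exact hL') (by rw [hEn', hEd', hEt]; linarith)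
  obtain ⟨P, hPf, hPb, hPK, hPe, hPh⟩ := E.exists_protocol (MF := 2 ^ a) (MB := 2 ^ b) (J := 2 ^ j)
    (K := 2 ^ c) (by positivity) (by positivity) (by positivity)
    (by calc 4 = 2 ^ 2 := by norm_num
          _ ≤ 2 ^ c := Nat.pow_le_pow_right (by norm_num) hc2)
    (herrE.trans herr1.le) g hg
  have hcr : (2 : ℝ) ≤ c := by exact_mod_cast hc2
  have hlogK : Real.logb 2 ((2 ^ c : ℕ) : ℝ) = c := by
    push_cast
    rw [← Real.rpow_natCast, Real.logb_rpow (by norm_num) (by norm_num)]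
  rw [hlogK] at hPh
  obtain ⟨h1, h2, h3⟩ := hent
  refine ⟨P, isSecure_of_condEntropy_ge (c := (c : ℝ) + 1) ?_
    (hPe.trans_lt ((ENNReal.ofReal_lt_ofReal_iff hδ).mpr (herrE.trans_lt herrδ)))
    (le_trans ?_ hPh) ?_ h1 ?_ h3⟩
  · rw [hPf]; exact Nat.add_pos_left E.n_pos _
  · refine mul_le_mul_of_nonneg_right ?_ (by linarith)
    have := Real.sqrt_le_sqrt hleak
    linarith
  · rw [Fintype.card_fin, hPK]
    push_cast
    have : (1 : ℝ) ≤ 2 ^ c := one_le_pow₀ (by norm_num)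
    calc Real.logb 2 ((2 : ℝ) ^ c + 1) ≤ Real.logb 2 (2 ^ (c + 1)) :=
          Real.logb_le_logb_of_le (by norm_num) (by positivity) (by rw [pow_succ]; linarith)
      _ = c + 1 := by
          rw [← Real.rpow_natCast, Real.logb_rpow (by norm_num) (by norm_num)]
          push_cast; rfl
  · rw [hPf, hPb]
    push_cast
    rw [hEn', hEd', hEk]
    linarith

end Achievability

end

/-! ### Members of the rate set, the constant key, and the supremum. -/

section

section Main

variable {Xf Yf Zf Xb Yb Zb : Type*} [Fintype Xf] [Fintype Yf] [Fintype Zf]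
  [Fintype Xb] [Fintype Yb] [Fintype Zb] {F : DMBC Xf Yf Zf} {B : DMBC Xb Yb Zb}

/-- Rates in the rate set are achieved, also those that use one channel only. -/
theorem hasSecureICC_of_mem_rateSet [Nonempty Xb] {R δ r : ℝ} (hδ : 0 < δ) (hr : r ∈ rateSet F B)
    (hr0 : 0 < r) (hR : R - δ < r) : HasSecureICC F B R δ := by
  obtain ⟨nf, nb, a, c, h, rfl⟩ := hr
  have hh := helperRate_nonneg a F
  have hnb : 0 < nb := by
    refine Nat.pos_of_ne_zero fun h0 => ?_
    rw [h0, Nat.cast_zero, zero_mul] at h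
    have : 0 ≤ nf * a.helperRate F := by positivity
    linarith
  have hnb' : (0 : ℝ) < nb := by exact_mod_cast hnb
  rcases Nat.eq_zero_or_pos nf with rfl | hnf
  · simp only [Nat.cast_zero, zero_mul, zero_add] at h hr0 hR
    rw [mul_div_cancel_left₀ _ hnb'.ne'] at hr0 hR
    -- With nf = 0 a single forward use is added to a large multiple of nb backward uses; m₁, m₂ and
    -- m₃ make the multiple large enough to preserve the constraint, the positivity of the rate and
    -- the comparison with R - δ.
    obtain ⟨m₁, hm₁⟩ := exists_nat_gt (a.helperRate F / (nb * c.totalRate B))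
    obtain ⟨m₂, hm₂⟩ := exists_nat_gt (-a.secretRate F / (nb * c.secretRate B))
    obtain ⟨m₃, hm₃⟩ := exists_nat_gt
      ((R - δ - a.secretRate F) / (nb * (c.secretRate B - (R - δ))))
    have hp₂ : 0 < nb * c.secretRate B := by positivity
    have hp₃ : 0 < nb * (c.secretRate B - (R - δ)) := mul_pos hnb' (by linarith)
    rw [div_lt_iff₀ h] at hm₁
    rw [div_lt_iff₀ hp₂] at hm₂
    rw [div_lt_iff₀ hp₃] at hm₃
    have n₁ : (0 : ℝ) ≤ m₁ := Nat.cast_nonneg m₁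
    have n₂ : (0 : ℝ) ≤ m₂ := Nat.cast_nonneg m₂
    have n₃ : (0 : ℝ) ≤ m₃ := Nat.cast_nonneg m₃
    have g₁ : m₁ * (nb * c.totalRate B) ≤ (m₁ + m₂ + m₃ + 1 : ℝ) * (nb * c.totalRate B) :=
      mul_le_mul_of_nonneg_right (by linarith) h.le
    have g₂ : m₂ * (nb * c.secretRate B) ≤ (m₁ + m₂ + m₃ + 1 : ℝ) * (nb * c.secretRate B) :=
      mul_le_mul_of_nonneg_right (by linarith) hp₂.le
    have g₃ : m₃ * (nb * (c.secretRate B - (R - δ)))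
        ≤ (m₁ + m₂ + m₃ + 1 : ℝ) * (nb * (c.secretRate B - (R - δ))) :=
      mul_le_mul_of_nonneg_right (by linarith) hp₃.le
    refine hasSecureICC_of_lt a c (nf := 1) (nb := (m₁ + m₂ + m₃ + 1) * nb) one_pos
      (by positivity) ?_ hδ ?_ ?_ <;> push_cast <;> linarith
  · have hnf' : (0 : ℝ) < nf := by exact_mod_cast hnf
    have hs : (0 : ℝ) < nf + nb := by positivity
    rw [lt_div_iff₀ hs] at hR
    rw [div_pos_iff_of_pos_right hs] at hr0
    exact hasSecureICC_of_lt a c hnf hnb h hδ hr0 (by linarith)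

/-- A bound for the deviations of single symbols. -/
lemma exists_srcTypical_of_pos (a : SourceAux Xf Yf) (F : DMBC Xf Yf Zf) (n : ℕ) :
    ∃ t : ℝ, 0 ≤ t ∧ ∀ u : Fin n → Fin a.cardV × Xf × Yf × Zf,
      (∀ i, 0 < (a.law F (u i)).toReal) → SrcTypical a F n t u := by
  obtain ⟨t₁, h₁, b₁⟩ := exists_logDev_le (a.lawV F) n
  obtain ⟨t₂, h₂, b₂⟩ := exists_logDev_le (srcX a F) n
  obtain ⟨t₃, h₃, b₃⟩ := exists_logDev_le (srcY a F) n
  obtain ⟨t₄, h₄, b₄⟩ := exists_logDev_le (srcZ a F) n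
  obtain ⟨t₅, h₅, b₅⟩ := exists_logDev_le (a.lawVX F) n
  obtain ⟨t₆, h₆, b₆⟩ := exists_logDev_le (a.lawVY F) n
  obtain ⟨t₇, h₇, b₇⟩ := exists_logDev_le (srcVZ a F) n
  refine ⟨t₁ + t₂ + t₃ + t₄ + t₅ + t₆ + t₇, by positivity, fun u h => ⟨h, ?_, ?_, ?_, ?_, ?_, ?_,
    ?_⟩⟩
  · exact (b₁ _).trans (by linarith)
  · exact (b₂ _).trans (by linarith)
  · exact (b₃ _).trans (by linarith)
  · exact (b₄ _).trans (by linarith)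
  · exact (b₅ _).trans (by linarith)
  · exact (b₆ _).trans (by linarith)
  · exact (b₇ _).trans (by linarith)

lemma logDev_zero {α : Type*} [Fintype α] (p : PMF α) (v : Fin 0 → α) : logDev p v = 0 := by
  simp [logDev, seqProb]

lemma chnTypical_zero (c : ChannelAux Xb) (B : DMBC Xb Yb Zb) {t : ℝ} (ht : 0 ≤ t)
    (u : Fin 0 → Fin c.cardW2 × Fin c.cardW1 × Yb × Zb) : ChnTypical c B 0 t u := by
  unfold ChnTypical
  simp only [logDev_zero, abs_zero, ht, IsEmpty.forall_iff, and_self]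

lemma rvEntropy_eq_zero {Ω α : Type*} [Fintype Ω] [Fintype α] (μ : PMF Ω) (A : Ω → α) {k : α}
    (h : ∀ ω ∈ μ.support, A ω = k) : rvEntropy μ A = 0 := by
  rw [rvEntropy_eq]
  have h0 : ∀ ω, A ω ≠ k → (μ ω).toReal = 0 := fun ω hω => by
    rw [(PMF.apply_eq_zero_iff μ ω).mpr fun hs => hω (h ω hs), ENNReal.toReal_zero]
  refine Finset.sum_eq_zero fun ω _ => ?_
  by_cases hω : A ω = k
  · have : ((μ.map A) (A ω)).toReal = 1 := by
      rw [toReal_map, ← pmf_sum_toReal μ]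
      refine Finset.sum_congr rfl fun ω' _ => ?_
      by_cases h' : A ω' = k
      · rw [ind_true (h'.trans hω.symm), mul_one]
      · rw [h0 ω' h', zero_mul]
    rw [this]; simp
  · rw [h0 ω hω, zero_mul]

/-- A protocol with a constant key never fails. -/
theorem hasSecureICC_of_lt_zero [Nonempty Xf] [Nonempty Xb] {R δ : ℝ} (hδ : 0 < δ)
    (hR : R - δ < 0) : HasSecureICC F B R δ := by
  -- All auxiliary alphabets are singletons, and there is one V-word, one information word and one
  -- key value.
  let a : SourceAux Xf Yf := ⟨1, PMF.pure (Classical.arbitrary Xf), fun _ => PMF.pure 0⟩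
  let c : ChannelAux Xb := ⟨1, 1, PMF.pure 0, fun _ => PMF.pure 0,
    fun _ => PMF.pure (Classical.arbitrary Xb)⟩
  obtain ⟨t, ht, hsrc⟩ := exists_srcTypical_of_pos a F 1
  obtain ⟨C₁, hC₁, hC₁'⟩ := exists_logDev_le c.lawW1 1
  obtain ⟨C₂, hC₂, hC₂'⟩ := exists_logDev_le (outY c B) 1
  obtain ⟨C₃, hC₃, hC₃'⟩ := exists_logDev_le (c.lawW1Y B) 1
  obtain ⟨T, hT, hT'⟩ := exists_logDev_le (a.lawV F) 1
  have hw : c.lawW1 = PMF.pure 0 := PMF.pure_bind _ _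
  let E : Ensemble F B :=
    { src := a, chn := c, n := 1, k := 1, d := 0, n_pos := one_pos, k_pos := one_pos
      -- Larger than every deviation that can occur, so each run of positive probability passes all
      -- typicality tests.
      ε := 2 * t + C₁ + C₂ + C₃ + T + 1, ε_pos := by positivity, t := t, C := C₁ + C₂ + C₃
      w₀ := fun _ => 0
      w₀_typical := by
        rw [isTypical_iff one_pos]
        refine ⟨?_, (hC₁' _).trans_lt ?_⟩
        · rw [hw]; simp [seqProb]
        · push_cast; linarith
      dev_le := fun u y => add_le_add (add_le_add (hC₁' u) (hC₂' y)) (hC₃' _)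
      t_lt := by push_cast; linarith
      two_t_lt := by push_cast; linarith
      half_le := by
        have : ∀ v : Fin 1 → Fin a.cardV, seqProb (a.lawV F) v *
            ind (IsTypical (a.lawV F) (2 * t + C₁ + C₂ + C₃ + T + 1) v) = seqProb (a.lawV F) v := by
          intro v
          by_cases h0 : seqProb (a.lawV F) v = 0
          · rw [h0, zero_mul]
          · rw [ind_true, mul_one]
            rw [isTypical_iff one_pos]
            exact ⟨h0, (hT' v).trans_lt (by push_cast; linarith)⟩
        change _ ≤ ∑ v : Fin 1 → Fin a.cardV, seqProb (a.lawV F) v *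
            ind (IsTypical (a.lawV F) (2 * t + C₁ + C₂ + C₃ + T + 1) v)
        simp_rw [this]
        rw [sum_seqProb]
        norm_num }
  let v₀ : Fin 1 → Fin a.cardV := fun _ => (0 : Fin 1)
  have hv₀ : ∀ v : Fin 1 → Fin a.cardV, v = v₀ := fun v => funext fun i =>
    Subsingleton.elim (α := Fin 1) _ _
  have hv₀' : IsTypical (a.lawV F) E.ε v₀ := by
    by_contra h
    have h1 := E.half_le
    change _ ≤ ∑ v : Fin 1 → Fin a.cardV, seqProb (a.lawV F) v *
      ind (IsTypical (a.lawV F) E.ε v) at h1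
    rw [Finset.sum_eq_zero fun v _ => by rw [hv₀ v, ind_false h, mul_zero]] at h1
    norm_num at h1
  let D : ICCCode F B :=
    { src := a, chn := c, n := 1, k := 1, d := 0, n_pos := one_pos, k_pos := one_pos
      ε := E.ε, ε_pos := E.ε_pos, cardF := 1, cardB := 1, vWord := fun _ => v₀
      vWord_typical := fun _ => hv₀', prefixWord := E.w₀, prefixWord_typical := E.w₀_typical
      parity := fun _ i => i.elim0, nullWord := fun _ => Classical.arbitrary Xb }
  let g : Fin D.cardF × Fin D.cardB → Fin 1 := fun _ => 0
  have hg : ∀ k k', Nat.card {m // g m = k} = Nat.card {m // g m = k'} := fun k k' => by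
    rw [Subsingleton.elim k k']
  have hrun : ∀ ω ∈ D.run.support, (D.message ω).map g = some 0 ∧ (D.estimate ω).map g = some 0 := by
    rintro ⟨x, yz, f, b, u⟩ hω
    have hne : (D.run (x, yz, f, b, u)).toReal ≠ 0 :=
      (ENNReal.toReal_pos ((PMF.mem_support_iff _ _).mp hω) (PMF.apply_ne_top _ _)).ne'
    rw [D.toReal_run] at hne
    have hfirst : ICCCode.firstLaw a F (x, yz) ≠ 0 := left_ne_zero_of_mul hne
    have hquant := left_ne_zero_of_mul (right_ne_zero_of_mul hne)
    have hback := right_ne_zero_of_mul (right_ne_zero_of_mul (right_ne_zero_of_mul hne))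
    have hS : SrcTypical a F 1 t (fun i => (v₀ i, x i, yz i)) := by
      refine hsrc _ fun i => lt_of_le_of_ne ENNReal.toReal_nonneg (Ne.symm ?_)
      have h1 := seqProb_law a F v₀ (x, yz)
      have h2 : kerProb a.kernelV (ICCCode.received (x, yz)) v₀ = 1 :=
        Finset.prod_eq_one fun i _ => by
          change ((PMF.pure (0 : Fin 1)) 0).toReal = 1
          simp
      rw [h2, mul_one] at h1
      exact Finset.prod_ne_zero_iff.mp (h1.trans_ne hfirst) i (Finset.mem_univ i)
    have hjt := E.isJointlyTypical_of_srcTypical (v := v₀) (s := (x, yz)) hS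
    cases f with
    | none =>
      refine absurd ?_ hquant
      change (proportional _ _ none).toReal = 0
      rw [proportional_none, ind_false]
      intro hs
      have := (Finset.sum_eq_zero_iff_of_nonneg fun i _ => D.quantWeight_nonneg _ i).mp hs
        (0 : Fin 1) (Finset.mem_univ _)
      rw [ICCCode.quantWeight, ind_true hjt, mul_one] at this
      exact (ICCCode.likelihood_pos_of_typical _ _ hjt).ne' this
    | some f =>
      refine ⟨rfl, ?_⟩
      have hk : (D.back (some f) b u).toReal
          = kerProb (ICCCode.backChannel c B) (Fin.append E.w₀ fun i => i.elim0) u :=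
        toReal_useChannel _ _ _
      rw [hk, kerProb_append] at hback
      have htest : E.Test v₀ (fun i => i.elim0) x (fun i => (u i).1) :=
        E.test_of_good (s := (x, yz)) (w := fun i => i.elim0)
          ⟨hS, chnTypical_zero c B ht _, left_ne_zero_of_mul hback⟩
      have hdec : D.dec x (fun i => (u i).1) = some (f, b) :=
        theUnique_eq_some htest fun m _ => Prod.ext (Subsingleton.elim (α := Fin 1) _ _)
          (Subsingleton.elim (α := Fin 1) _ _)
      change (D.dec x fun i => (u i).1).map g = _
      rw [hdec]
      rfl
  have hout : ∀ ω ∈ (D.run.map fun ω =>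
      ((D.message ω).map g, (D.estimate ω).map g, D.view ω)).support,
      ω.1 = some 0 ∧ ω.2.1 = some 0 := by
    intro ω hω
    rw [PMF.mem_support_map_iff] at hω
    obtain ⟨ω', hω', rfl⟩ := hω
    exact hrun ω' hω'
  have hsec : ∀ n, IsSecure (D.run.map fun ω =>
      ((D.message ω).map g, (D.estimate ω).map g, D.view ω)) n R δ := by
    -- The key has entropy zero: the rate condition reads 0 > R - δ and the secrecy condition is
    -- vacuous.
    refine fun n => ⟨?_, ?_, ?_⟩
    · rw [rvEntropy_eq_zero _ _ fun ω hω => (hout ω hω).1, zero_div]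
      exact hR
    · refine lt_of_eq_of_lt ?_ (ENNReal.ofReal_pos.mpr hδ)
      rw [PMF.toOuterMeasure_apply_eq_zero_iff, Set.disjoint_left]
      exact fun ω hω h => h ⟨0, hout ω hω⟩
    · exact fun h => absurd (rvEntropy_eq_zero _ _ fun ω hω => (hout ω hω).1) h
  refine ⟨D.toProtocol g hg, ?_⟩
  rw [ICCCode.toProtocol_outcome]
  exact hsec _

/-- Rates that are smaller than the supremum are achieved. -/
theorem hasSecureICC_rateICC [Nonempty Xb] {R δ : ℝ} (hδ : 0 < δ) (hR : R = rateICC F B)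
    (hpos : δ ≤ R) : HasSecureICC F B R δ := by
  have hne : (rateSet F B).Nonempty := by
    rw [Set.nonempty_iff_ne_empty]
    intro h
    -- An empty rate set has supremum 0, which is excluded by 0 < δ ≤ R.
    rw [rateICC, h, Real.sSup_empty] at hR
    linarith
  obtain ⟨r, hr, hlt⟩ := exists_lt_of_lt_csSup hne (show R - δ < sSup (rateSet F B) by
    rw [← rateICC, ← hR]; linarith)
  exact hasSecureICC_of_mem_rateSet hδ hr (by linarith) hlt

end Main

end

end TwoDMBC

end

theorem theorem1 {Xf Yf Zf Xb Yb Zb : Type*}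
    [Fintype Xf] [Fintype Yf] [Fintype Zf] [Fintype Xb] [Fintype Yb] [Fintype Zb]
    [Nonempty Xf] [Nonempty Xb]
    (F : TwoDMBC.DMBC Xf Yf Zf) (B : TwoDMBC.DMBC Xb Yb Zb) :
    BddAbove (TwoDMBC.rateSet F B) ∧ BddAbove (TwoDMBC.rateSet B F) ∧
    ∀ δ : ℝ, 0 < δ →
      TwoDMBC.HasSecureICC F B (max (TwoDMBC.rateICC F B) (TwoDMBC.rateICC B F)) δ ∨
      TwoDMBC.HasSecureICC B F (max (TwoDMBC.rateICC F B) (TwoDMBC.rateICC B F)) δ := by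
  refine ⟨TwoDMBC.bddAbove_rateSet F B, TwoDMBC.bddAbove_rateSet B F, fun δ hδ => ?_⟩
  -- Below δ a constant key is enough. Otherwise the maximum is one of the two suprema, it is at
  -- least δ > 0, and the corresponding party initiates.
  rcases lt_or_ge (max (TwoDMBC.rateICC F B) (TwoDMBC.rateICC B F)) δ with h | h
  · exact Or.inl (TwoDMBC.hasSecureICC_of_lt_zero hδ (by linarith))
  · rcases max_choice (TwoDMBC.rateICC F B) (TwoDMBC.rateICC B F) with hm | hm
    · exact Or.inl (TwoDMBC.hasSecureICC_rateICC hδ hm h)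
    · exact Or.inr (TwoDMBC.hasSecureICC_rateICC hδ hm h)
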